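/- **Theorem 1.2 (Uniqueness).** Let $\mathscr C_0(\mathbb R^3)$ be the set of divergence-free vector fields in $C_0^\infty(\mathbb R^3)$ and let $J^3(\mathbb R^3)$ be its closure in $L^3(\mathbb R^3)$. Let $T>0$. A *solution* on $(0,T)\times\mathbb R^3$ of the Navier–Stokes equations $$U_t+U\cdot\nabla U+\nabla\pi=\Delta U,\qquad \nabla\cdot U=0,$$ in the class $L^\infty(0,T;J^3(\mathbb R^3))$ is a field $U\in L^\infty(0,T;J^3(\mathbb R^3))$ which is locally bounded in time with values in $L^\infty(\mathbb R^3)$, that is $\operatorname{ess\,sup}_{s<\tau<t}\|U(\tau)\|_\infty<\infty$ for all $0<s<t<T$, and which satisfies the equations in the weak sense $$\int_0^T\Big[\big(U,\varphi_t+\Delta\varphi\big)+\big(U\cdot\nabla\varphi,U\big)\Big]\,dt=0$$ for all $\varphi\in C_0^\infty((0,T)\times\mathbb R^3;\mathbb R^3)$ with $\nabla\cdot\varphi(t,\cdot)=0$ for every $t$. Here $(f,g)=\int_{\mathbb R^3}f\cdot g\,dx$. For every $U_0\in J^3(\mathbb R^3)$ there is at most one solution $U$ in the class $L^\infty(0,T;J^3(\mathbb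 R^3))$ such that $$\lim_{t\to0}t^{\frac12}\|U(t)\|_\infty=0\qquad\text{and}\qquad\lim_{t\to0}(U(t),\psi)=(U_0,\psi)\quad\text{for all }\psi\in\mathscr C_0(\mathbb R^3):$$ if $U$ and $\overline U$ are two such solutions with the same $U_0$, then $U(t)=\overline U(t)$ in $L^3(\mathbb R^3)$ for almost every $t\in(0,T)$. (Elements of $L^\infty(0,T;J^3(\mathbb R^3))$ are determined for almost every $t$ only; the limits $t\to0$ are accordingly taken outside a null set of times.) -/

import Mathlib

open MeasureTheory Filter Topology Set
open scoped ENNReal NNReal InnerProductSpace ContDiff Laplacian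

namespace NSUniqueness

/-- Euclidean three-space; the fields take their values in it as well. -/
abbrev E3 : Type := EuclideanSpace ℝ (Fin 3)

instance fact_one_le_three : Fact ((1 : ℝ≥0∞) ≤ 3) := ⟨by norm_num⟩

/-- Vector fields in `L³(ℝ³)`, up to equality almost everywhere. -/
abbrev L3 : Type := Lp E3 3 (volume : Measure E3)

/-- The divergence `∑ i, ∂ᵢ ψᵢ` of a vector field. -/
noncomputable def divergence (ψ : E3 → E3) (x : E3) : ℝ :=
  ∑ i : Fin 3, fderiv ℝ ψ x (EuclideanSpace.single i 1) i

/-- Smooth, compactly supported, divergence-free vector fields on `ℝ³`. -/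
structure IsTestField (ψ : E3 → E3) : Prop where
  contDiff : ContDiff ℝ ∞ ψ
  hasCompactSupport : HasCompactSupport ψ
  divergence_eq_zero : ∀ x, divergence ψ x = 0

/-- `J³(ℝ³)`: the closure in `L³(ℝ³)` of the divergence-free test fields. -/
def J3 : Set L3 := closure {f : L3 | ∃ ψ : E3 → E3, IsTestField ψ ∧ f =ᵐ[volume] ψ}

/-- Smooth fields on `(0,T) × ℝ³`, compactly supported there and divergence-free in space. -/
structure IsSpaceTimeTestField (T : ℝ) (φ : ℝ → E3 → E3) : Prop where
  contDiff : ContDiff ℝ ∞ (Function.uncurry φ)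
  hasCompactSupport : HasCompactSupport (Function.uncurry φ)
  tsupport_subset : tsupport (Function.uncurry φ) ⊆ Ioo 0 T ×ˢ univ
  divergence_eq_zero : ∀ t x, divergence (φ t) x = 0

/-- `U ∈ L^∞(0,T; J³(ℝ³))`. -/
structure MemLinftyJ3 (T : ℝ) (U : ℝ → L3) : Prop where
  memLp : MemLp U ∞ (volume.restrict (Ioo 0 T))
  mem_J3 : ∀ᵐ t ∂(volume.restrict (Ioo 0 T)), U t ∈ J3

/-- `U ∈ L^∞(s,t; L^∞(ℝ³))` for all `0 < s < t < T`. -/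
def IsLocallyBounded (T : ℝ) (U : ℝ → L3) : Prop :=
  ∀ s t : ℝ, 0 < s → s < t → t < T →
    ∃ M : ℝ≥0, ∀ᵐ τ ∂(volume.restrict (Ioo s t)), eLpNorm (U τ) ∞ volume ≤ M

/-- The weak form on `(0,T) × ℝ³` of
`U_t + U·∇U + ∇π = ΔU`, the pressure being eliminated by divergence-free test fields:
`∫₀ᵀ [(U, φ_t + Δφ) + (U·∇φ, U)] dt = 0`.
Here `fderiv ℝ (φ t) x (U t x)` is `U·∇φ` at `(t,x)`. -/
def SatisfiesWeakNS (T : ℝ) (U : ℝ → L3) : Prop :=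
  ∀ φ : ℝ → E3 → E3, IsSpaceTimeTestField T φ →
    ∫ t in Ioo 0 T,
      ((∫ x, ⟪U t x, deriv (fun s => φ s x) t + Δ (φ t) x⟫_ℝ) +
        ∫ x, ⟪fderiv ℝ (φ t) x (U t x), U t x⟫_ℝ) = 0

/-- A solution of the Navier–Stokes equations on `(0,T) × ℝ³` in the class `L^∞(0,T; J³(ℝ³))`.
That `U` is divergence-free is contained in `U(t) ∈ J³(ℝ³)`. -/
structure IsSolution (T : ℝ) (U : ℝ → L3) : Prop where
  memLinftyJ3 : MemLinftyJ3 T U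
  isLocallyBounded : IsLocallyBounded T U
  satisfiesWeakNS : SatisfiesWeakNS T U

/-- The filter of the limit `t → 0`, `t > 0`, up to null sets of times: elements of
`L^∞(0,T; J³(ℝ³))` are determined for almost every time only. -/
noncomputable def aeZeroRight : Filter ℝ := 𝓝[>] (0 : ℝ) ⊓ ae volume

end NSUniqueness

/-! Fix a centre x₀, a coordinate j and a time c, and test the equation with the backward Oseen
kernel. This is the solenoidal field curl curl (Φ eⱼ), where Φ(s, ·) is a multiple of the integral
of the heat kernel over all times beyond c - s. Since Φ solves the backward heat equation, the
linear part of the weak form drops out, and for almost every t < c a Duhamel formula remains: the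
kernel at c - t paired with U(t) equals the kernel at c paired with U₀, plus the integral over (0,t)
of the quadratic term (`IsSolution.linPair_oseen_eq`). The kernel is not compactly supported, so the
potential is cut off in space and the cutoff is removed in the limit. Decay of order |x|⁻³ for the
kernel and |x|⁻⁴ for its gradient places them in L^{3/2} and L³, dual to U and to U ⊗ U. The cutoff
in time is removed by the lemma of du Bois-Reymond (`exists_ae_eq_add_integral`), and the constant
it leaves is read off from the initial condition. On subtracting the formulas for two solutions the
initial terms cancel. The kernel is a gradient plus a Gaussian times eⱼ, and J³ annihilates
gradients, so the left side is a Gaussian mean of (U - V)ⱼ at scale (c - t)^{1/2}; letting c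
decrease to t recovers U - V itself. By scaling, the gradient of the kernel has L¹ norm O((c -
s)^{-1/2}). With S = ‖U‖_∞ + ‖V‖_∞, Young's inequality in dual form gives ‖U - V‖₃(t) ≤ C ∫₀ᵗ (t -
s)^{-1/2} S(s) ‖U - V‖₃(s) ds (`exists_enorm_sub_le`). The decay hypothesis at time zero says that
S(s) ≤ ε s^{-1/2} for small s. The integral of (t - s)^{-1/2} s^{-1/2} over (0,t) does not depend on
t, so for small ε the inequality is a strict contraction and U = V on a short interval. From there
on S is locally bounded, and steps of fixed length carry the equality up to any time below T
(`ae_eq_zero_of_singular_gronwall`). -/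

namespace NSUniqueness

/-! ### Partial derivatives of scalar functions and solenoidal fields -/

/-- The standard basis vectors of `E3`. -/
noncomputable abbrev stdVec (i : Fin 3) : E3 := EuclideanSpace.single i 1

/-- Partial derivatives of a scalar function. -/
noncomputable def pd (i : Fin 3) (f : E3 → ℝ) (x : E3) : ℝ := fderiv ℝ f x (stdVec i)

/-- The Laplacian of a scalar function, as the sum of the pure second partial derivatives. -/
noncomputable def lap (f : E3 → ℝ) (x : E3) : ℝ := ∑ k, pd k (pd k f) x

/-- The solenoidal field `curl curl (f eⱼ) = ∇∂ⱼf - (Δf) eⱼ`. -/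
noncomputable def sol (j : Fin 3) (f : E3 → ℝ) (x : E3) : E3 :=
  (∑ i, pd i (pd j f) x • stdVec i) - lap f x • stdVec j

variable {f g : E3 → ℝ}

lemma contDiff_pd (hf : ContDiff ℝ ∞ f) (i : Fin 3) : ContDiff ℝ ∞ (pd i f) :=
  (hf.fderiv_right (m := ∞) (by simp)).clm_apply contDiff_const

lemma contDiff_lap (hf : ContDiff ℝ ∞ f) : ContDiff ℝ ∞ (lap f) :=
  ContDiff.sum fun k _ => contDiff_pd (contDiff_pd hf k) k

lemma contDiff_sol (hf : ContDiff ℝ ∞ f) (j : Fin 3) : ContDiff ℝ ∞ (sol j f) :=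
  (ContDiff.sum fun i _ => (contDiff_pd (contDiff_pd hf j) i).smul contDiff_const).sub
    ((contDiff_lap hf).smul contDiff_const)

lemma _root_.ContDiff.differentiable_of_smooth {E F : Type*} [NormedAddCommGroup E]
    [NormedSpace ℝ E] [NormedAddCommGroup F] [NormedSpace ℝ F] {f : E → F}
    (hf : ContDiff ℝ ∞ f) : Differentiable ℝ f := hf.differentiable (by simp)

/-- Directional derivatives commute. -/
lemma fderiv_fderiv_comm {E F : Type*} [NormedAddCommGroup E] [NormedSpace ℝ E]
    [NormedAddCommGroup F] [NormedSpace ℝ F] {f : E → F} (hf : ContDiff ℝ ∞ f) (x v w : E) :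
    fderiv ℝ (fun y => fderiv ℝ f y v) x w = fderiv ℝ (fun y => fderiv ℝ f y w) x v := by
  have hd : Differentiable ℝ (fderiv ℝ f) :=
    (hf.fderiv_right (m := ∞) (by simp)).differentiable_of_smooth
  have h := hf.contDiffAt (x := x) |>.isSymmSndFDerivAt
    (by
      rw [minSmoothness_of_isRCLikeNormedField]; exact WithTop.coe_le_coe.2 le_top)
  rw [fderiv_clm_apply (hd x) (differentiableAt_const v),
    fderiv_clm_apply (hd x) (differentiableAt_const w)]
  simpa using h w v

lemma pd_comm (hf : ContDiff ℝ ∞ f) (i j : Fin 3) : pd i (pd j f) = pd j (pd i f) :=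
  funext fun x => fderiv_fderiv_comm hf x _ _

lemma pd_add (hf : ContDiff ℝ ∞ f) (hg : ContDiff ℝ ∞ g) (i : Fin 3) :
    pd i (fun x => f x + g x) = fun x => pd i f x + pd i g x := by
  ext x
  simp [pd, fderiv_fun_add (hf.differentiable_of_smooth x) (hg.differentiable_of_smooth x)]

lemma pd_const_mul (hf : ContDiff ℝ ∞ f) (c : ℝ) (i : Fin 3) :
    pd i (fun x => c * f x) = fun x => c * pd i f x := by
  ext x
  simp [pd, fderiv_const_mul (hf.differentiable_of_smooth x)]

lemma pd_mul (hf : ContDiff ℝ ∞ f) (hg : ContDiff ℝ ∞ g) (i : Fin 3) :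
    pd i (fun x => f x * g x) = fun x => pd i f x * g x + f x * pd i g x := by
  ext x
  simp [pd, fderiv_fun_mul (hf.differentiable_of_smooth x) (hg.differentiable_of_smooth x)]
  ring

lemma pd_sum {ι : Type*} (s : Finset ι) {f : ι → E3 → ℝ} (hf : ∀ k, ContDiff ℝ ∞ (f k))
    (i : Fin 3) : pd i (fun x => ∑ k ∈ s, f k x) = fun x => ∑ k ∈ s, pd i (f k) x := by
  ext x
  simp [pd, fderiv_fun_sum fun k _ => (hf k).differentiable_of_smooth x]

lemma pd_comp_smul (hf : ContDiff ℝ ∞ f) (c : ℝ) (i : Fin 3) :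
    pd i (fun x => f (c • x)) = fun x => c * pd i f (c • x) := by
  ext x
  have h1 : HasFDerivAt (fun x : E3 => c • x) (c • ContinuousLinearMap.id ℝ E3) x :=
    (hasFDerivAt_id x).const_smul c
  have := ((hf.differentiable_of_smooth (c • x)).hasFDerivAt.comp x h1).fderiv
  simp only [pd]
  erw [this]
  simp

lemma pd_congr_nhds {x : E3} (h : f =ᶠ[𝓝 x] g) (i : Fin 3) : pd i f =ᶠ[𝓝 x] pd i g := by
  filter_upwards [h.fderiv (𝕜 := ℝ)] with y hy
  simp [pd, hy]

lemma lap_congr_nhds {x : E3} (h : f =ᶠ[𝓝 x] g) : lap f =ᶠ[𝓝 x] lap g := by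
  have : ∀ᶠ y in 𝓝 x, ∀ k, pd k (pd k f) y = pd k (pd k g) y :=
    eventually_all.2 fun k => pd_congr_nhds (pd_congr_nhds h k) k
  filter_upwards [this] with y hy
  simp [lap, hy]

lemma sol_congr_nhds {x : E3} (h : f =ᶠ[𝓝 x] g) (j : Fin 3) : sol j f =ᶠ[𝓝 x] sol j g := by
  have : ∀ᶠ y in 𝓝 x, ∀ k, pd k (pd j f) y = pd k (pd j g) y :=
    eventually_all.2 fun k => pd_congr_nhds (pd_congr_nhds h j) k
  filter_upwards [this, lap_congr_nhds h] with y hy hl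
  simp [sol, hy, hl]

lemma lap_add (hf : ContDiff ℝ ∞ f) (hg : ContDiff ℝ ∞ g) :
    lap (fun x => f x + g x) = fun x => lap f x + lap g x := by
  ext x
  simp only [lap, ← Finset.sum_add_distrib]
  refine Finset.sum_congr rfl fun k _ => ?_
  rw [pd_add hf hg, pd_add (contDiff_pd hf k) (contDiff_pd hg k)]

lemma lap_const_mul (hf : ContDiff ℝ ∞ f) (c : ℝ) :
    lap (fun x => c * f x) = fun x => c * lap f x := by
  ext x
  simp only [lap, Finset.mul_sum]
  refine Finset.sum_congr rfl fun k _ => ?_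
  rw [pd_const_mul hf, pd_const_mul (contDiff_pd hf k)]

lemma sol_const_mul (hf : ContDiff ℝ ∞ f) (c : ℝ) (j : Fin 3) :
    sol j (fun x => c * f x) = fun x => c • sol j f x := by
  ext1 x
  simp only [sol, lap_const_mul hf, smul_sub, Finset.smul_sum, smul_smul, pd_const_mul hf,
    pd_const_mul (contDiff_pd hf j)]

lemma lap_comp_smul (hf : ContDiff ℝ ∞ f) (c : ℝ) :
    lap (fun x => f (c • x)) = fun x => c ^ 2 * lap f (c • x) := by
  ext x
  have hs : ContDiff ℝ ∞ fun x : E3 => c • x := contDiff_const_smul c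
  simp only [lap, Finset.mul_sum]
  refine Finset.sum_congr rfl fun k _ => ?_
  rw [pd_comp_smul hf, pd_const_mul (f := fun x => pd k f (c • x)) ((contDiff_pd hf k).comp hs),
    pd_comp_smul (contDiff_pd hf k)]
  ring

lemma sol_comp_smul (hf : ContDiff ℝ ∞ f) (c : ℝ) (j : Fin 3) :
    sol j (fun x => f (c • x)) = fun x => c ^ 2 • sol j f (c • x) := by
  ext1 x
  have hs : ContDiff ℝ ∞ fun x : E3 => c • x := contDiff_const_smul c
  have h : ∀ i, pd i (pd j fun x => f (c • x)) x = c ^ 2 * pd i (pd j f) (c • x) := fun i => by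
    rw [pd_comp_smul hf, pd_const_mul (f := fun x => pd j f (c • x)) ((contDiff_pd hf j).comp hs),
      pd_comp_smul (contDiff_pd hf j)]
    ring
  simp only [sol, lap_comp_smul hf, h, smul_sub, Finset.smul_sum, smul_smul]

lemma pd_lap (hf : ContDiff ℝ ∞ f) (i : Fin 3) : pd i (lap f) = lap (pd i f) := by
  have : lap f = fun x => ∑ k, pd k (pd k f) x := rfl
  rw [this, pd_sum _ fun k => contDiff_pd (contDiff_pd hf k) k]
  ext x
  refine Finset.sum_congr rfl fun k _ => ?_
  rw [pd_comm (contDiff_pd hf k), pd_comm hf]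

lemma fderiv_sol_apply (hf : ContDiff ℝ ∞ f) (j k : Fin 3) (x : E3) :
    fderiv ℝ (sol j f) x (stdVec k) = sol j (pd k f) x := by
  have h1 : ∀ i, HasFDerivAt (fun x => pd i (pd j f) x • stdVec i)
      ((fderiv ℝ (pd i (pd j f)) x).smulRight (stdVec i)) x := fun i =>
    ((contDiff_pd (contDiff_pd hf j) i).differentiable_of_smooth x).hasFDerivAt.smul_const _
  have h2 : HasFDerivAt (fun x => lap f x • stdVec j)
      ((fderiv ℝ (lap f) x).smulRight (stdVec j)) x :=
    ((contDiff_lap hf).differentiable_of_smooth x).hasFDerivAt.smul_const _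
  have h3 := (HasFDerivAt.fun_sum (u := Finset.univ) fun i _ => h1 i).sub h2
  have h4 : fderiv ℝ (sol j f) x = _ := h3.fderiv
  rw [h4]
  have e1 : ∀ i, fderiv ℝ (pd i (pd j f)) x (stdVec k) = pd i (pd j (pd k f)) x := fun i => by
    change pd k (pd i (pd j f)) x = _
    rw [pd_comm (contDiff_pd hf j), pd_comm hf k j]
  have e2 : fderiv ℝ (lap f) x (stdVec k) = lap (pd k f) x := congrFun (pd_lap hf k) x
  simp [sol, e1, e2]

lemma sum_apply_stdVec (v : E3) : ∑ k, v k • stdVec k = v := by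
  ext i
  fin_cases i <;> simp [Fin.sum_univ_three]

lemma clm_apply_eq_sum {F : Type*} [NormedAddCommGroup F] [NormedSpace ℝ F]
    (L : E3 →L[ℝ] F) (v : E3) : L v = ∑ k, v k • L (stdVec k) := by
  conv_lhs => rw [← sum_apply_stdVec v]
  simp only [map_sum, map_smul]

lemma fderiv_sol (hf : ContDiff ℝ ∞ f) (j : Fin 3) (x v : E3) :
    fderiv ℝ (sol j f) x v = ∑ k, v k • sol j (pd k f) x := by
  rw [clm_apply_eq_sum]
  simp only [fderiv_sol_apply hf]

lemma abs_apply_le_norm (v : E3) (k : Fin 3) : |v k| ≤ ‖v‖ := by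
  simpa using PiLp.norm_apply_le v k

lemma norm_fderiv_sol_le (hf : ContDiff ℝ ∞ f) (j : Fin 3) (x : E3) :
    ‖fderiv ℝ (sol j f) x‖ ≤ ∑ k, ‖sol j (pd k f) x‖ := by
  refine ContinuousLinearMap.opNorm_le_bound _ (Finset.sum_nonneg fun _ _ => norm_nonneg _)
    fun v => ?_
  rw [fderiv_sol hf, Finset.sum_mul]
  refine norm_sum_le_of_le _ fun k _ => ?_
  rw [norm_smul, mul_comm]
  gcongr
  exact abs_apply_le_norm v k

lemma sol_apply (j i : Fin 3) (x : E3) :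
    sol j f x i = pd i (pd j f) x - if i = j then lap f x else 0 := by
  fin_cases i <;> fin_cases j <;> simp [sol, Fin.sum_univ_three]

/-- The divergence of `∇∂ⱼf` is `Δ∂ⱼf`, which cancels against `∂ⱼΔf`. -/
lemma divergence_sol (hf : ContDiff ℝ ∞ f) (j : Fin 3) (x : E3) : divergence (sol j f) x = 0 := by
  have : ∀ k, fderiv ℝ (sol j f) x (EuclideanSpace.single k 1) k
      = pd k (pd k (pd j f)) x - if k = j then lap (pd j f) x else 0 := fun k => by
    rw [fderiv_sol_apply hf, sol_apply, pd_comm hf j k]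
    split_ifs with h <;> simp [h]
  simp only [divergence, this, Finset.sum_sub_distrib]
  simp [lap]

lemma laplacian_eq_sum_fderiv {F : E3 → E3} (hF : ContDiff ℝ ∞ F) (x : E3) :
    Δ F x = ∑ k, fderiv ℝ (fun y => fderiv ℝ F y (stdVec k)) x (stdVec k) := by
  have hd : Differentiable ℝ (fderiv ℝ F) :=
    (hF.fderiv_right (m := ∞) (by simp)).differentiable_of_smooth
  rw [InnerProductSpace.laplacian_eq_iteratedFDeriv_orthonormalBasis F
    (EuclideanSpace.basisFun (Fin 3) ℝ)]
  refine Finset.sum_congr rfl fun k _ => ?_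
  rw [iteratedFDeriv_two_apply, fderiv_clm_apply (hd x) (differentiableAt_const _)]
  simp

/-- `sol j` has constant coefficients and so commutes with the Laplacian; the linear part of the
equation can be computed on the scalar potential. -/
lemma laplacian_sol (hf : ContDiff ℝ ∞ f) (j : Fin 3) (x : E3) :
    Δ (sol j f) x = sol j (lap f) x := by
  rw [laplacian_eq_sum_fderiv (contDiff_sol hf j)]
  have h1 : ∀ k, fderiv ℝ (fun y => fderiv ℝ (sol j f) y (stdVec k)) x (stdVec k)
      = sol j (pd k (pd k f)) x := fun k => by
    simp only [fderiv_sol_apply hf]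
    exact fderiv_sol_apply (contDiff_pd hf k) j k x
  simp only [h1]
  have hs : ∀ k, ContDiff ℝ ∞ (pd k (pd k f)) := fun k => contDiff_pd (contDiff_pd hf k) k
  have e : lap f = fun x => ∑ k, pd k (pd k f) x := rfl
  ext i
  simp only [WithLp.ofLp_sum, Finset.sum_apply, sol_apply, Finset.sum_sub_distrib]
  congr 1
  · rw [e, pd_sum _ hs, pd_sum _ fun k => contDiff_pd (hs k) j]
  · split_ifs
    · conv_rhs => rw [lap, e]
      simp only [pd_sum _ hs]
      simp only [pd_sum _ fun k => contDiff_pd (hs k) _]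
      rw [Finset.sum_comm]
      rfl
    · simp

/-- Six second derivatives occur: three in the gradient term and three in the Laplacian. -/
lemma norm_sol_le (j : Fin 3) (x : E3) {C : ℝ} (h : ∀ i k, |pd i (pd k f) x| ≤ C) :
    ‖sol j f x‖ ≤ 6 * C := by
  have h1 : ‖∑ i, pd i (pd j f) x • stdVec i‖ ≤ ∑ _i : Fin 3, C :=
    norm_sum_le_of_le _ fun i _ => by
      rw [norm_smul]; simpa using h i j
  have h2 : ‖lap f x • stdVec j‖ ≤ ∑ _i : Fin 3, C := by
    rw [norm_smul]
    simpa [lap] using norm_sum_le_of_le (f := fun k => pd k (pd k f) x) Finset.univ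
      (fun k _ => h k k)
  calc ‖sol j f x‖ ≤ _ := norm_sub_le _ _
    _ ≤ _ := add_le_add h1 h2
    _ = 6 * C := by simp; ring

/-! ### Time-dependent scalar potentials and the test fields they generate -/

/-- Slicewise derivatives are directional derivatives on space-time. Joint smoothness and the
exchange of `∂ₜ` with `∂ᵢ` then follow from the symmetry of the second derivative there. -/
lemma pd_eq_fderiv_uncurry {A : ℝ → E3 → ℝ} (hA : ContDiff ℝ ∞ (Function.uncurry A))
    (i : Fin 3) (s : ℝ) (y : E3) :
    pd i (A s) y = fderiv ℝ (Function.uncurry A) (s, y) (0, stdVec i) := by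
  have h1 : HasFDerivAt (fun y : E3 => (s, y)) (ContinuousLinearMap.inr ℝ ℝ E3) y :=
    hasFDerivAt_prodMk_right s y
  have h2 := (hA.differentiable_of_smooth (s, y)).hasFDerivAt.comp y h1
  have h3 : fderiv ℝ (A s) y = _ := h2.fderiv
  simp [pd, h3]

lemma deriv_eq_fderiv_uncurry {A : ℝ → E3 → ℝ} (hA : ContDiff ℝ ∞ (Function.uncurry A))
    (s : ℝ) (y : E3) :
    HasDerivAt (fun s => A s y) (fderiv ℝ (Function.uncurry A) (s, y) (1, 0)) s := by
  have h1 : HasFDerivAt (fun s : ℝ => (s, y)) (ContinuousLinearMap.inl ℝ ℝ E3) s :=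
    hasFDerivAt_prodMk_left s y
  have h2 := ((hA.differentiable_of_smooth (s, y)).hasFDerivAt.comp s h1).hasDerivAt
  have h3 : HasDerivAt (fun s => A s y) _ s := h2
  simpa using h3

lemma contDiff_uncurry_pd {A : ℝ → E3 → ℝ} (hA : ContDiff ℝ ∞ (Function.uncurry A))
    (i : Fin 3) : ContDiff ℝ ∞ (Function.uncurry fun s => pd i (A s)) := by
  have : (Function.uncurry fun s => pd i (A s))
      = fun p => fderiv ℝ (Function.uncurry A) p (0, stdVec i) := by
    ext ⟨s, y⟩
    exact pd_eq_fderiv_uncurry hA i s y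
  rw [this]
  exact (hA.fderiv_right (m := ∞) (by simp)).clm_apply contDiff_const

lemma contDiff_slice {F : Type*} [NormedAddCommGroup F] [NormedSpace ℝ F] {A : ℝ → E3 → F}
    (hA : ContDiff ℝ ∞ (Function.uncurry A)) (s : ℝ) : ContDiff ℝ ∞ (A s) :=
  hA.comp (contDiff_const.prodMk contDiff_id : ContDiff ℝ ∞ fun y : E3 => (s, y))

lemma contDiff_uncurry_sol {A : ℝ → E3 → ℝ} (hA : ContDiff ℝ ∞ (Function.uncurry A))
    (j : Fin 3) : ContDiff ℝ ∞ (Function.uncurry fun s => sol j (A s)) := by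
  have h1 : ∀ i, ContDiff ℝ ∞ (fun p : ℝ × E3 => pd i (pd j (A p.1)) p.2 • stdVec i) := fun i =>
    (contDiff_uncurry_pd (contDiff_uncurry_pd hA j) i).smul contDiff_const
  have h2 : ∀ i, ContDiff ℝ ∞ (fun p : ℝ × E3 => pd i (pd i (A p.1)) p.2) := fun i =>
    contDiff_uncurry_pd (contDiff_uncurry_pd hA i) i
  exact (ContDiff.sum fun i _ => h1 i).sub
    ((ContDiff.sum fun k _ => h2 k).smul contDiff_const)

lemma hasDerivAt_pd {A : ℝ → E3 → ℝ} (hA : ContDiff ℝ ∞ (Function.uncurry A))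
    (i : Fin 3) (t : ℝ) (y : E3) :
    HasDerivAt (fun s => pd i (A s) y) (pd i (fun z => deriv (fun s => A s z) t) y) t := by
  have h := deriv_eq_fderiv_uncurry (contDiff_uncurry_pd hA i) t y
  convert h using 1
  have e1 : (Function.uncurry fun s => pd i (A s))
      = fun p => fderiv ℝ (Function.uncurry A) p (0, stdVec i) := by
    ext ⟨s, y⟩
    exact pd_eq_fderiv_uncurry hA i s y
  rw [e1, fderiv_fderiv_comm hA]
  have h2 : ContDiff ℝ ∞
      (Function.uncurry fun s z => fderiv ℝ (Function.uncurry A) (s, z) (1, 0)) :=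
    (hA.fderiv_right (m := ∞) (by simp)).clm_apply contDiff_const
  have h3 : (fun z => deriv (fun s => A s z) t)
      = fun z => fderiv ℝ (Function.uncurry A) (t, z) (1, 0) :=
    funext fun z => (deriv_eq_fderiv_uncurry hA t z).deriv
  rw [h3]
  exact pd_eq_fderiv_uncurry h2 i t y

lemma contDiff_uncurry_deriv {A : ℝ → E3 → ℝ} (hA : ContDiff ℝ ∞ (Function.uncurry A)) :
    ContDiff ℝ ∞ (Function.uncurry fun t z => deriv (fun s => A s z) t) := by
  have : (Function.uncurry fun t z => deriv (fun s => A s z) t)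
      = fun p => fderiv ℝ (Function.uncurry A) p (1, 0) := by
    ext ⟨s, y⟩
    exact (deriv_eq_fderiv_uncurry hA s y).deriv
  rw [this]
  exact (hA.fderiv_right (m := ∞) (by simp)).clm_apply contDiff_const

lemma hasDerivAt_sol {A : ℝ → E3 → ℝ} (hA : ContDiff ℝ ∞ (Function.uncurry A))
    (j : Fin 3) (t : ℝ) (y : E3) :
    HasDerivAt (fun s => sol j (A s) y) (sol j (fun z => deriv (fun s => A s z) t) y) t := by
  have h2 : ∀ i k, HasDerivAt (fun s => pd i (pd k (A s)) y)
      (pd i (pd k (fun z => deriv (fun s => A s z) t)) y) t := fun i k => by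
    have := hasDerivAt_pd (contDiff_uncurry_pd hA k) i t y
    have e : (fun z => deriv (fun s => pd k (A s) z) t)
        = pd k (fun z => deriv (fun s => A s z) t) :=
      funext fun z => (hasDerivAt_pd hA k t z).deriv
    rwa [e] at this
  exact (HasDerivAt.fun_sum fun i _ => (h2 i j).smul_const _).sub
    ((HasDerivAt.fun_sum fun k _ => h2 k k).smul_const _)

lemma sol_zero (j : Fin 3) (x : E3) : sol j (fun _ => 0) x = 0 := by
  have : ∀ i, pd i (fun _ : E3 => (0 : ℝ)) = fun _ => 0 := fun i => by ext; simp [pd]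
  simp [sol, lap, this]

/-- Differential operators are local, so a compactly supported potential generates an admissible
test field. -/
lemma tsupport_uncurry_sol_subset (A : ℝ → E3 → ℝ) (j : Fin 3) :
    tsupport (Function.uncurry fun s => sol j (A s)) ⊆ tsupport (Function.uncurry A) := by
  intro p hp
  contrapose! hp
  rw [notMem_tsupport_iff_eventuallyEq] at hp ⊢
  filter_upwards [hp.eventuallyEq_nhds] with q hq
  obtain ⟨s, y⟩ := q
  have hc : Tendsto (fun z : E3 => (s, z)) (𝓝 y) (𝓝 (s, y)) :=
    (Continuous.prodMk_right s).tendsto y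
  have : A s =ᶠ[𝓝 y] fun _ => 0 := by
    filter_upwards [hc.eventually hq] with z hz using hz
  simpa [sol_zero] using (sol_congr_nhds this j).self_of_nhds

lemma tsupport_sol_subset (a : E3 → ℝ) (j : Fin 3) : tsupport (sol j a) ⊆ tsupport a := by
  intro p hp
  contrapose! hp
  rw [notMem_tsupport_iff_eventuallyEq] at hp ⊢
  filter_upwards [hp.eventuallyEq_nhds] with q hq
  simpa [sol_zero] using (sol_congr_nhds (g := fun _ => 0) hq j).self_of_nhds

lemma isTestField_sol {a : E3 → ℝ} (ha : ContDiff ℝ ∞ a) (hc : HasCompactSupport a)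
    (j : Fin 3) (x₀ : E3) : IsTestField fun y => sol j a (y - x₀) where
  contDiff := (contDiff_sol ha j).comp (contDiff_id.sub contDiff_const)
  hasCompactSupport := by
    have h : HasCompactSupport (sol j a) :=
      IsCompact.of_isClosed_subset hc (isClosed_tsupport _) (tsupport_sol_subset a j)
    exact h.comp_homeomorph (Homeomorph.subRight x₀)
  divergence_eq_zero x := by
    simp only [divergence, fderiv_comp_sub]
    exact divergence_sol ha j (x - x₀)

lemma isSpaceTimeTestField_sol {T : ℝ} {A : ℝ → E3 → ℝ} (hA : ContDiff ℝ ∞ (Function.uncurry A))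
    (hc : HasCompactSupport (Function.uncurry A))
    (hs : tsupport (Function.uncurry A) ⊆ Ioo 0 T ×ˢ univ) (j : Fin 3) (x₀ : E3) :
    IsSpaceTimeTestField T fun s y => sol j (A s) (y - x₀) := by
  let e : ℝ × E3 ≃ₜ ℝ × E3 := (Homeomorph.refl ℝ).prodCongr (Homeomorph.subRight x₀)
  have he : (Function.uncurry fun s y => sol j (A s) (y - x₀))
      = (Function.uncurry fun s => sol j (A s)) ∘ e := rfl
  have hc' : HasCompactSupport (Function.uncurry fun s => sol j (A s)) :=
    IsCompact.of_isClosed_subset hc (isClosed_tsupport _) (tsupport_uncurry_sol_subset A j)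
  refine ⟨?_, ?_, ?_, fun t x => ?_⟩
  · rw [he]
    refine (contDiff_uncurry_sol hA j).comp ?_
    exact contDiff_fst.prodMk (contDiff_snd.sub contDiff_const)
  · rw [he]
    exact hc'.comp_homeomorph e
  · rw [he, tsupport_comp_eq_preimage]
    rintro ⟨s, y⟩ h
    have := hs (tsupport_uncurry_sol_subset A j h)
    exact ⟨this.1, mem_univ _⟩
  · simp only [divergence, fderiv_comp_sub]
    exact divergence_sol (contDiff_slice hA t) j (x - x₀)

lemma laplacian_comp_sub {F : E3 → E3} (hF : ContDiff ℝ ∞ F) (x₀ x : E3) :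
    Δ (fun y => F (y - x₀)) x = Δ F (x - x₀) := by
  have h : ContDiff ℝ ∞ fun y => F (y - x₀) := hF.comp (contDiff_id.sub contDiff_const)
  rw [laplacian_eq_sum_fderiv h, laplacian_eq_sum_fderiv hF]
  refine Finset.sum_congr rfl fun k _ => ?_
  simp only [fderiv_comp_sub]
  rw [fderiv_comp_sub (f := fun y => fderiv ℝ F y (stdVec k))]

lemma sol_add {f g : E3 → ℝ} (hf : ContDiff ℝ ∞ f) (hg : ContDiff ℝ ∞ g) (j : Fin 3) (x : E3) :
    sol j (fun x => f x + g x) x = sol j f x + sol j g x := by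
  ext i
  simp only [sol_apply, PiLp.add_apply, lap_add hf hg, pd_add hf hg,
    pd_add (contDiff_pd hf j) (contDiff_pd hg j)]
  split_ifs <;> ring

/-- The linear part of the weak formulation, for the test field generated by a potential. -/
lemma deriv_add_laplacian_sol {A : ℝ → E3 → ℝ} (hA : ContDiff ℝ ∞ (Function.uncurry A))
    (j : Fin 3) (x₀ x : E3) (t : ℝ) :
    deriv (fun s => sol j (A s) (x - x₀)) t + Δ (fun y => sol j (A t) (y - x₀)) x
      = sol j (fun z => deriv (fun s => A s z) t + lap (A t) z) (x - x₀) := by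
  rw [laplacian_comp_sub (contDiff_sol (contDiff_slice hA t) j), (hasDerivAt_sol hA j t _).deriv,
    laplacian_sol (contDiff_slice hA t), sol_add
      (contDiff_slice (contDiff_uncurry_deriv hA) t) (contDiff_lap (contDiff_slice hA t))]

/-! ### Symbol bounds -/

/-- `|∂^α f(x)| ≤ C (1 + |x|)^(m - |α|)` for all multi-indices with `|α| ≤ n`. -/
def SymbolBound : ℕ → ℤ → ℝ → (E3 → ℝ) → Prop
  | 0, m, C, f => ∀ x, |f x| ≤ C * (1 + ‖x‖) ^ m
  | n + 1, m, C, f => (∀ x, |f x| ≤ C * (1 + ‖x‖) ^ m) ∧ ∀ k, SymbolBound n (m - 1) C (pd k f)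

lemma one_le_one_add_norm (x : E3) : 1 ≤ 1 + ‖x‖ := by simp

lemma zpow_weight_pos (x : E3) (m : ℤ) : 0 < (1 + ‖x‖) ^ m := by positivity

namespace SymbolBound

variable {f g : E3 → ℝ} {m m' : ℤ} {C C' : ℝ} {n : ℕ}

lemma bound (h : SymbolBound n m C f) (x : E3) : |f x| ≤ C * (1 + ‖x‖) ^ m := by
  cases n with
  | zero => exact h x
  | succ n => exact h.1 x

lemma nonneg (h : SymbolBound n m C f) : 0 ≤ C := by
  have := (abs_nonneg _).trans (h.bound 0)
  simpa using this

lemma pd (h : SymbolBound (n + 1) m C f) (k : Fin 3) :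
    SymbolBound n (m - 1) C (pd k f) := h.2 k

lemma of_succ (h : SymbolBound (n + 1) m C f) : SymbolBound n m C f := by
  induction n generalizing m f with
  | zero => exact h.1
  | succ n ih => exact ⟨h.1, fun k => ih (h.2 k)⟩

lemma of_le {n' : ℕ} (h : SymbolBound n m C f) (hn : n' ≤ n) : SymbolBound n' m C f := by
  induction hn with
  | refl => exact h
  | step _ ih => exact ih h.of_succ

lemma mono (h : SymbolBound n m C f) (hC : C ≤ C') (hm : m ≤ m') : SymbolBound n m' C' f := by
  have key : ∀ (f : E3 → ℝ) (m m' : ℤ), 0 ≤ C → m ≤ m' → (∀ x, |f x| ≤ C * (1 + ‖x‖) ^ m) →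
      ∀ x, |f x| ≤ C' * (1 + ‖x‖) ^ m' := fun f m m' h0 hm h x => by
    refine (h x).trans (mul_le_mul hC ?_ (zpow_weight_pos x m).le (h0.trans hC))
    exact zpow_le_zpow_right₀ (one_le_one_add_norm x) hm
  induction n generalizing m m' f with
  | zero => exact key _ _ _ h.nonneg hm h
  | succ n ih => exact ⟨key _ _ _ h.nonneg hm h.1, fun k => ih (h.2 k) (by lia)⟩

lemma add (hfs : ContDiff ℝ ∞ f) (hgs : ContDiff ℝ ∞ g) (hf : SymbolBound n m C f)
    (hg : SymbolBound n m C' g) : SymbolBound n m (C + C') fun x => f x + g x := by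
  have key : ∀ (f g : E3 → ℝ) (m : ℤ), (∀ x, |f x| ≤ C * (1 + ‖x‖) ^ m) →
      (∀ x, |g x| ≤ C' * (1 + ‖x‖) ^ m) → ∀ x, |f x + g x| ≤ (C + C') * (1 + ‖x‖) ^ m :=
    fun f g m hf hg x => by
      rw [add_mul]
      exact (abs_add_le _ _).trans (add_le_add (hf x) (hg x))
  induction n generalizing m f g with
  | zero => exact key _ _ _ hf hg
  | succ n ih =>
    refine ⟨key _ _ _ hf.1 hg.1, fun k => ?_⟩
    rw [pd_add hfs hgs]
    exact ih (contDiff_pd hfs k) (contDiff_pd hgs k) (hf.2 k) (hg.2 k)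

lemma const_mul (hfs : ContDiff ℝ ∞ f) (hf : SymbolBound n m C f) (c : ℝ) :
    SymbolBound n m (|c| * C) fun x => c * f x := by
  have key : ∀ (f : E3 → ℝ) (m : ℤ), (∀ x, |f x| ≤ C * (1 + ‖x‖) ^ m) →
      ∀ x, |c * f x| ≤ |c| * C * (1 + ‖x‖) ^ m := fun f m hf x => by
    rw [abs_mul, mul_assoc]
    gcongr
    exact hf x
  induction n generalizing m f with
  | zero => exact key _ _ hf
  | succ n ih =>
    refine ⟨key _ _ hf.1, fun k => ?_⟩
    rw [pd_const_mul hfs]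
    exact ih (contDiff_pd hfs k) (hf.2 k)

/-- Leibniz' rule turns each derivative into two products, both of order `m + m' - 1`; hence the
factor 2 per derivative. -/
lemma mul (hfs : ContDiff ℝ ∞ f) (hgs : ContDiff ℝ ∞ g) (hf : SymbolBound n m C f)
    (hg : SymbolBound n m' C' g) : SymbolBound n (m + m') (2 ^ n * (C * C')) fun x => f x * g x := by
  have key : ∀ (f g : E3 → ℝ) (m m' : ℤ), 0 ≤ C → (∀ x, |f x| ≤ C * (1 + ‖x‖) ^ m) →
      (∀ x, |g x| ≤ C' * (1 + ‖x‖) ^ m') →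
      ∀ x, |f x * g x| ≤ C * C' * (1 + ‖x‖) ^ (m + m') := fun f g m m' hC hf hg x => by
    rw [abs_mul, zpow_add₀ (by positivity)]
    calc |f x| * |g x| ≤ (C * (1 + ‖x‖) ^ m) * (C' * (1 + ‖x‖) ^ m') := by
          gcongr
          exacts [hf x, hg x]
      _ = _ := by ring
  have hCC : 0 ≤ C * C' := mul_nonneg hf.nonneg hg.nonneg
  have key' : ∀ (n : ℕ) (x : E3) (m : ℤ), C * C' * (1 + ‖x‖) ^ m
      ≤ 2 ^ n * (C * C') * (1 + ‖x‖) ^ m := fun n x m => by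
    refine mul_le_mul_of_nonneg_right ?_ (zpow_weight_pos x m).le
    exact le_mul_of_one_le_left hCC (one_le_pow₀ (by norm_num))
  induction n generalizing m m' f g with
  | zero => simpa [SymbolBound] using key _ _ _ _ hf.nonneg hf hg
  | succ n ih =>
    refine ⟨fun x => (key _ _ _ _ hf.nonneg hf.1 hg.1 x).trans (key' _ _ _), fun k => ?_⟩
    rw [pd_mul hfs hgs]
    have h1 := ih (contDiff_pd hfs k) hgs (hf.2 k) hg.of_succ
    have h2 := ih hfs (contDiff_pd hgs k) hf.of_succ (hg.2 k)
    have h3 := add ((contDiff_pd hfs k).mul hgs) (hfs.mul (contDiff_pd hgs k))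
      (h1.mono le_rfl (show m - 1 + m' ≤ m + m' - 1 by lia))
      (h2.mono le_rfl (show m + (m' - 1) ≤ m + m' - 1 by lia))
    exact h3.mono (by rw [pow_succ]; linarith) le_rfl

/-- Bounds for the potential give bounds for the solenoidal field. -/
lemma norm_sol_le (hf : SymbolBound (n + 2) m C f) (j : Fin 3) (x : E3) :
    ‖sol j f x‖ ≤ 6 * C * (1 + ‖x‖) ^ (m - 2) := by
  rw [mul_assoc]
  refine NSUniqueness.norm_sol_le j x fun i k => ?_
  simpa [sub_sub] using ((hf.pd k).pd i).bound x

lemma norm_fderiv_sol_le (hfs : ContDiff ℝ ∞ f) (hf : SymbolBound (n + 3) m C f) (j : Fin 3)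
    (x : E3) : ‖fderiv ℝ (sol j f) x‖ ≤ 18 * C * (1 + ‖x‖) ^ (m - 3) := by
  refine (NSUniqueness.norm_fderiv_sol_le hfs j x).trans ?_
  have : ∀ k, ‖sol j (NSUniqueness.pd k f) x‖ ≤ 6 * C * (1 + ‖x‖) ^ (m - 3) := fun k => by
    have := (hf.pd k).norm_sol_le j x
    rwa [show m - 1 - 2 = m - 3 by ring] at this
  calc _ ≤ ∑ _k : Fin 3, 6 * C * (1 + ‖x‖) ^ (m - 3) := Finset.sum_le_sum fun k _ => this k
    _ = _ := by simp; ring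

lemma lap (hfs : ContDiff ℝ ∞ f) (hf : SymbolBound (n + 2) m C f) :
    SymbolBound n (m - 2) (3 * C) (lap f) := by
  have h : ∀ k, SymbolBound n (m - 2) C (NSUniqueness.pd k (NSUniqueness.pd k f)) := fun k => by
    have := (hf.pd k).pd k
    rwa [show m - 1 - 1 = m - 2 by ring] at this
  have hs : ∀ k, ContDiff ℝ ∞ (NSUniqueness.pd k (NSUniqueness.pd k f)) := fun k =>
    contDiff_pd (contDiff_pd hfs k) k
  have h2 := add ((hs 0).add (hs 1)) (hs 2) (add (hs 0) (hs 1) (h 0) (h 1)) (h 2)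
  have e : NSUniqueness.lap f = fun x => NSUniqueness.pd 0 (NSUniqueness.pd 0 f) x
      + NSUniqueness.pd 1 (NSUniqueness.pd 1 f) x + NSUniqueness.pd 2 (NSUniqueness.pd 2 f) x := by
    ext x
    simp [NSUniqueness.lap, Fin.sum_univ_three]
  rw [e]
  exact h2.mono (by linarith) le_rfl

end SymbolBound

/-- The index type makes constants uniform over a family, such as dilations or truncations. -/
lemma exists_symbolBound_succ {ι : Type*} {F : ι → E3 → ℝ} {n : ℕ} {m : ℤ}
    (h₀ : ∃ C, ∀ i x, |F i x| ≤ C * (1 + ‖x‖) ^ m)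
    (h : ∀ k, ∃ C, ∀ i, SymbolBound n (m - 1) C (pd k (F i))) :
    ∃ C, ∀ i, SymbolBound (n + 1) m C (F i) := by
  obtain ⟨C, hC⟩ := h₀
  choose C' hC' using h
  have h1 : 0 ≤ ∑ k, |C' k| := Finset.sum_nonneg fun _ _ => abs_nonneg _
  refine ⟨|C| + ∑ k, |C' k|, fun i => ⟨fun x => (hC i x).trans ?_, fun k => ?_⟩⟩
  · refine mul_le_mul_of_nonneg_right ?_ (zpow_weight_pos x m).le
    linarith [le_abs_self C]
  · refine (hC' k i).mono ?_ le_rfl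
    have h2 := Finset.single_le_sum (f := fun k => |C' k|) (fun _ _ => abs_nonneg _)
      (Finset.mem_univ k)
    linarith [le_abs_self (C' k), abs_nonneg C]

/-- Dilations by factors from a compact set preserve symbol bounds of non-positive order. -/
lemma exists_symbolBound_comp_smul {n : ℕ} {m : ℤ} {C : ℝ} {f : E3 → ℝ} (hfs : ContDiff ℝ ∞ f)
    (hf : SymbolBound n m C f) (hm : m ≤ 0) {c₀ : ℝ} (hc₀ : 0 < c₀) (c₁ : ℝ) :
    ∃ C', ∀ c : Icc c₀ c₁, SymbolBound n m C' fun x => f (c.1 • x) := by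
  have key : ∀ {m : ℤ} {f : E3 → ℝ}, m ≤ 0 → 0 ≤ C → (∀ x, |f x| ≤ C * (1 + ‖x‖) ^ m) →
      ∃ C', ∀ (c : Icc c₀ c₁) (x : E3), |f (c.1 • x)| ≤ C' * (1 + ‖x‖) ^ m := by
    intro m f hm hC0 hf
    obtain ⟨k, rfl⟩ : ∃ k : ℕ, m = -(k : ℤ) := ⟨m.natAbs, by lia⟩
    have hc : 0 < min c₀ 1 := by positivity
    refine ⟨C * ((min c₀ 1) ^ k)⁻¹, fun c x => (hf _).trans ?_⟩
    -- The order being non-positive, a lower bound for the dilated weight is what is needed.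
    have h1 : min c₀ 1 * (1 + ‖x‖) ≤ 1 + ‖c.1 • x‖ := by
      rw [norm_smul, Real.norm_of_nonneg (hc₀.le.trans c.2.1)]
      nlinarith [min_le_left c₀ 1, min_le_right c₀ 1, c.2.1, norm_nonneg x]
    rw [mul_assoc, zpow_neg, zpow_neg, zpow_natCast, zpow_natCast, ← mul_inv, ← mul_pow]
    gcongr
  induction n generalizing m f with
  | zero => exact key hm hf.nonneg hf
  | succ n ih =>
    refine exists_symbolBound_succ (key hm hf.nonneg hf.1) fun k => ?_
    obtain ⟨C', hC'⟩ := ih (contDiff_pd hfs k) (hf.2 k) (by lia)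
    refine ⟨|c₁| * C', fun c => ?_⟩
    rw [pd_comp_smul hfs]
    refine ((hC' c).const_mul ((contDiff_pd hfs k).comp (contDiff_const_smul _)) c.1).mono ?_ le_rfl
    refine mul_le_mul_of_nonneg_right ?_ (hC' c).nonneg
    exact abs_le_abs_of_nonneg (hc₀.le.trans c.2.1) c.2.2

/-- Uniform symbol bounds of order zero for the dilations of a compactly supported function. -/
lemma exists_symbolBound_cutoff {ρ : E3 → ℝ} (hρ : ContDiff ℝ ∞ ρ) (hc : HasCompactSupport ρ)
    (n k : ℕ) : ∃ C, ∀ R : Ici (1 : ℝ),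
      SymbolBound n (-(k : ℤ)) C fun x => (R.1⁻¹) ^ k * ρ (R.1⁻¹ • x) := by
  obtain ⟨L, hL⟩ : ∃ L : ℝ, ∀ x, L < ‖x‖ → ρ x = 0 := by
    obtain ⟨L, hL⟩ := hc.isCompact.isBounded.exists_norm_le
    refine ⟨L, fun x hx => ?_⟩
    by_contra h
    exact absurd (hL x (subset_tsupport _ h)) (not_le.2 hx)
  have key : ∀ (k : ℕ) {f : E3 → ℝ}, ContDiff ℝ ∞ f → HasCompactSupport f →
      (∀ x, L < ‖x‖ → f x = 0) → ∃ C, ∀ (R : Ici (1 : ℝ)) (x : E3),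
        |(R.1⁻¹) ^ k * f (R.1⁻¹ • x)| ≤ C * (1 + ‖x‖) ^ (-(k : ℤ)) := by
    intro k f hf hc hL
    obtain ⟨B, hB⟩ := hf.continuous.bounded_above_of_compact_support hc
    have hB0 : 0 ≤ B := (norm_nonneg _).trans (hB 0)
    refine ⟨B * (1 + max L 0) ^ k, fun ⟨R, hR⟩ x => ?_⟩
    rw [mem_Ici] at hR
    have hR0 : 0 < R := by linarith
    rcases lt_or_ge L ‖R⁻¹ • x‖ with h | h
    · rw [hL _ h]
      simp only [mul_zero, abs_zero]
      positivity
    -- On the support of the dilated function `‖x‖ ≤ L R`, so each factor `R⁻¹` is worth one power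
    -- of decay.
    · have hx : 1 + ‖x‖ ≤ R * (1 + max L 0) := by
        rw [norm_smul, norm_inv, Real.norm_of_nonneg hR0.le, inv_mul_le_iff₀ hR0] at h
        nlinarith [le_max_left L 0]
      rw [abs_mul, abs_of_nonneg (by positivity), zpow_neg, zpow_natCast]
      have h1 : |f (R⁻¹ • x)| ≤ B := hB _
      have h2 : (1 + ‖x‖) ^ k ≤ R ^ k * (1 + max L 0) ^ k := by
        rw [← mul_pow]; gcongr
      rw [inv_pow, ← div_eq_mul_inv, le_div_iff₀ (by positivity)]
      calc (R ^ k)⁻¹ * |f (R⁻¹ • x)| * (1 + ‖x‖) ^ k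
          ≤ (R ^ k)⁻¹ * B * (R ^ k * (1 + max L 0) ^ k) := by gcongr
        _ = _ := by field_simp
  induction n generalizing k ρ with
  | zero => exact key k hρ hc hL
  | succ n ih =>
    refine exists_symbolBound_succ (key k hρ hc hL) fun i => ?_
    have hsup : ∀ x, L < ‖x‖ → pd i ρ x = 0 := fun x hx => by
      have : ρ =ᶠ[𝓝 x] fun _ => 0 := by
        filter_upwards [(isOpen_lt continuous_const continuous_norm).mem_nhds hx] with y hy
        exact hL y hy
      rw [(pd_congr_nhds this i).self_of_nhds]
      simp [pd]
    have hcs : HasCompactSupport (pd i ρ) := by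
      refine HasCompactSupport.intro (isCompact_closedBall (0 : E3) L) fun x hx => hsup x ?_
      simpa using hx
    -- Differentiation produces one more factor `R⁻¹`; this is why the exponent `k` is carried
    -- through the induction.
    obtain ⟨C', hC'⟩ := ih (contDiff_pd hρ i) hcs (k + 1) hsup
    refine ⟨C', fun R => ?_⟩
    have hs : ContDiff ℝ ∞ fun x : E3 => ρ (R.1⁻¹ • x) := hρ.comp (contDiff_const_smul _)
    rw [pd_const_mul hs, pd_comp_smul hρ]
    have := hC' R
    simp only [pow_succ, mul_assoc] at this
    exact this.mono le_rfl (by push_cast; lia)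

/-! ### The radial profiles `∫₀¹ v²ᵏ e^{-rv²} dv` -/

/-- The function `r ↦ ∫₀¹ v²ᵏ e^{-rv²} dv`. -/
noncomputable def gaussMoment (k : ℕ) (r : ℝ) : ℝ :=
  ∫ v in (0 : ℝ)..1, v ^ (2 * k) * Real.exp (-(r * v ^ 2))

/-- Differentiation under the integral brings down `-v ^ 2`, so the moments are closed under
derivatives. All real `r` are admitted: the composition with `‖x‖ ^ 2 / 4` must be smooth at the
origin too. -/
lemma hasDerivAt_gaussMoment (k : ℕ) (r : ℝ) :
    HasDerivAt (gaussMoment k) (-gaussMoment (k + 1) r) r := by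
  have h := intervalIntegral.hasDerivAt_integral_of_dominated_loc_of_deriv_le
    (μ := volume) (a := 0) (b := 1) (x₀ := r) (s := Metric.ball r 1)
    (bound := fun _ => Real.exp (|r| + 1))
    (F := fun r v => v ^ (2 * k) * Real.exp (-(r * v ^ 2)))
    (F' := fun r v => -(v ^ (2 * (k + 1)) * Real.exp (-(r * v ^ 2))))
    (Metric.ball_mem_nhds r one_pos)
    (Eventually.of_forall fun x => by
      have : Continuous fun v : ℝ => v ^ (2 * k) * Real.exp (-(x * v ^ 2)) := by fun_prop
      exact this.aestronglyMeasurable)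
    (by
      have : Continuous fun v : ℝ => v ^ (2 * k) * Real.exp (-(r * v ^ 2)) := by fun_prop
      exact this.intervalIntegrable _ _)
    (by
      have : Continuous fun v : ℝ => -(v ^ (2 * (k + 1)) * Real.exp (-(r * v ^ 2))) := by fun_prop
      exact this.aestronglyMeasurable)
    (Eventually.of_forall fun v hv x hx => by
      rw [uIoc_of_le zero_le_one] at hv
      have h1 : v ^ (2 * (k + 1)) ≤ 1 := pow_le_one₀ hv.1.le hv.2
      have h2 : 0 ≤ v ^ (2 * (k + 1)) := pow_nonneg hv.1.le _
      have h3 : |x| ≤ |r| + 1 := by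
        have := abs_sub_abs_le_abs_sub x r
        rw [Metric.mem_ball, Real.dist_eq] at hx
        linarith
      have h4 : -(x * v ^ 2) ≤ |r| + 1 := by
        have h5 : v ^ 2 ≤ 1 := pow_le_one₀ hv.1.le hv.2
        have h6 : 0 ≤ v ^ 2 := sq_nonneg v
        nlinarith [neg_abs_le x, abs_nonneg x]
      rw [norm_neg, Real.norm_eq_abs, abs_mul, abs_of_nonneg h2, Real.abs_exp]
      calc _ ≤ 1 * Real.exp (|r| + 1) := by gcongr
        _ = _ := one_mul _)
    (by simp)
    (Eventually.of_forall fun v _ x _ => by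
      have h1 : HasDerivAt (fun x : ℝ => -(x * v ^ 2)) (-(v ^ 2)) x := by
        have : HasDerivAt (fun x : ℝ => -(x * v ^ 2)) _ x :=
          ((hasDerivAt_id x).mul_const (v ^ 2)).neg
        simpa using this
      exact (h1.exp.const_mul (v ^ (2 * k))).congr_deriv (by ring))
  have h2 := h.2
  simp only [intervalIntegral.integral_neg] at h2
  exact h2

lemma contDiff_gaussMoment (k : ℕ) : ContDiff ℝ ∞ (gaussMoment k) := by
  rw [contDiff_infty]
  intro n
  induction n generalizing k with
  | zero =>
    exact contDiff_zero.2 (continuous_iff_continuousAt.2 fun r =>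
      (hasDerivAt_gaussMoment k r).continuousAt)
  | succ n ih =>
    push_cast
    rw [contDiff_succ_iff_deriv]
    refine ⟨fun r => (hasDerivAt_gaussMoment k r).differentiableAt, by simp, ?_⟩
    have : deriv (gaussMoment k) = fun r => -gaussMoment (k + 1) r :=
      funext fun r => (hasDerivAt_gaussMoment k r).deriv
    rw [this]
    exact (ih (k + 1)).neg

/-- Integrate the derivative of `v ^ (2 * k + 1) * exp (-(r * v ^ 2))` over the unit interval. The
cases `k = 0` and `k = 1` yield the heat equation for the potential, the general case the decay of
the moments. -/
lemma gaussMoment_recurrence (k : ℕ) (r : ℝ) :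
    (2 * k + 1) * gaussMoment k r - 2 * r * gaussMoment (k + 1) r = Real.exp (-r) := by
  have h1 : ∀ v : ℝ, HasDerivAt (fun v : ℝ => v ^ (2 * k + 1) * Real.exp (-(r * v ^ 2)))
      ((2 * k + 1) * (v ^ (2 * k) * Real.exp (-(r * v ^ 2)))
        - 2 * r * (v ^ (2 * (k + 1)) * Real.exp (-(r * v ^ 2)))) v := fun v => by
    have h2 : HasDerivAt (fun v : ℝ => -(r * v ^ 2)) (-(r * (2 * v))) v := by
      have : HasDerivAt (fun v : ℝ => -(r * v ^ 2)) _ v :=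
        ((hasDerivAt_pow 2 v).const_mul r).neg
      simpa using this
    refine ((hasDerivAt_pow (2 * k + 1) v).mul h2.exp).congr_deriv ?_
    push_cast
    ring
  have hc : ∀ k : ℕ, IntervalIntegrable
      (fun v : ℝ => v ^ (2 * k) * Real.exp (-(r * v ^ 2))) volume 0 1 := fun k => by
    have : Continuous fun v : ℝ => v ^ (2 * k) * Real.exp (-(r * v ^ 2)) := by fun_prop
    exact this.intervalIntegrable _ _
  have h3 := intervalIntegral.integral_eq_sub_of_hasDerivAt (fun v _ => h1 v)
    (((hc k).const_mul _).sub ((hc (k + 1)).const_mul _))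
  rw [intervalIntegral.integral_sub ((hc k).const_mul _) ((hc (k + 1)).const_mul _),
    intervalIntegral.integral_const_mul, intervalIntegral.integral_const_mul] at h3
  simpa [gaussMoment] using h3

lemma gaussMoment_nonneg (k : ℕ) (r : ℝ) : 0 ≤ gaussMoment k r :=
  intervalIntegral.integral_nonneg zero_le_one fun _ hv =>
    mul_nonneg (pow_nonneg hv.1 _) (Real.exp_pos _).le

lemma gaussMoment_le_one (k : ℕ) {r : ℝ} (hr : 0 ≤ r) : gaussMoment k r ≤ 1 := by
  have hc : Continuous fun v : ℝ => v ^ (2 * k) * Real.exp (-(r * v ^ 2)) := by fun_prop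
  have h := intervalIntegral.integral_mono_on (μ := volume) zero_le_one
    (hc.intervalIntegrable 0 1) (continuous_const (y := (1 : ℝ)).intervalIntegrable 0 1)
    fun v hv => by
      have h1 : v ^ (2 * k) ≤ 1 := pow_le_one₀ hv.1 hv.2
      have h2 : Real.exp (-(r * v ^ 2)) ≤ 1 := by
        rw [Real.exp_le_one_iff]; nlinarith [sq_nonneg v]
      exact mul_le_one₀ h1 (Real.exp_pos _).le h2
  simpa [gaussMoment] using h

/-- Comparison with the Gaussian integral over the half-line; this is the decay |x|⁻¹ of the
potential. -/
lemma sqrt_mul_gaussMoment_zero_le {r : ℝ} (hr : 0 < r) :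
    Real.sqrt r * gaussMoment 0 r ≤ 1 := by
  have hs : 0 < Real.sqrt r := Real.sqrt_pos.2 hr
  have h1 : gaussMoment 0 r ≤ Real.sqrt (Real.pi / r) / 2 := by
    rw [← integral_gaussian_Ioi, gaussMoment, intervalIntegral.integral_of_le zero_le_one]
    have : ∀ v : ℝ, v ^ (2 * 0) * Real.exp (-(r * v ^ 2)) = Real.exp (-r * v ^ 2) := fun v => by
      simp
    simp only [this]
    exact setIntegral_mono_set (integrable_exp_neg_mul_sq hr).integrableOn
      (Eventually.of_forall fun v => (Real.exp_pos _).le)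
      (LE.le.eventuallyLE Ioc_subset_Ioi_self)
  calc Real.sqrt r * gaussMoment 0 r ≤ Real.sqrt r * (Real.sqrt (Real.pi / r) / 2) := by gcongr
    _ = Real.sqrt Real.pi / 2 := by
      rw [Real.sqrt_div Real.pi_pos.le]; field_simp
    _ ≤ 1 := by
      have : Real.sqrt Real.pi ≤ 2 := by
        rw [Real.sqrt_le_left (by norm_num)]
        linarith [Real.pi_le_four]
      linarith

/-! ### The radial functions `x ↦ ∫₀¹ v²ᵏ e^{-|x|²v²/4} dv` -/

/-- The radial function `x ↦ ∫₀¹ v²ᵏ e^{-|x|²v²/4} dv` on `ℝ³`. -/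
noncomputable def radialMoment (k : ℕ) (x : E3) : ℝ := gaussMoment k (‖x‖ ^ 2 / 4)

lemma contDiff_radialMoment (k : ℕ) : ContDiff ℝ ∞ (radialMoment k) :=
  (contDiff_gaussMoment k).comp ((contDiff_norm_sq ℝ).div_const 4)

lemma hasFDerivAt_radialMoment (k : ℕ) (x : E3) :
    HasFDerivAt (radialMoment k) (-(gaussMoment (k + 1) (‖x‖ ^ 2 / 4) / 2) • innerSL ℝ x) x := by
  have h1 : HasFDerivAt (fun x : E3 => ‖x‖ ^ 2 / 4) ((1 / 2 : ℝ) • innerSL ℝ x) x := by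
    have := (hasStrictFDerivAt_norm_sq x).hasFDerivAt.mul_const (1 / 4 : ℝ)
    simp only [div_eq_mul_one_div (‖_‖ ^ 2) (4 : ℝ)]
    refine this.congr_fderiv ?_
    ext y
    simp
    ring
  refine ((hasDerivAt_gaussMoment k _).comp_hasFDerivAt x h1).congr_fderiv ?_
  ext y
  simp
  ring

lemma pd_radialMoment (k : ℕ) (i : Fin 3) :
    pd i (radialMoment k) = fun x => -(1 / 2) * (x i * radialMoment (k + 1) x) := by
  ext x
  rw [pd, (hasFDerivAt_radialMoment k x).fderiv]
  simp [radialMoment, EuclideanSpace.inner_single_right]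
  ring

lemma contDiff_coord (i : Fin 3) : ContDiff ℝ ∞ fun x : E3 => x i :=
  (EuclideanSpace.proj (𝕜 := ℝ) i).contDiff

lemma pd_coord (i k : Fin 3) : pd k (fun x : E3 => x i) = fun _ => if i = k then 1 else 0 := by
  ext x
  have : HasFDerivAt (fun x : E3 => x i) (EuclideanSpace.proj (𝕜 := ℝ) i) x :=
    (EuclideanSpace.proj (𝕜 := ℝ) i).hasFDerivAt
  rw [pd, this.fderiv]
  simp

/-- Summing the second derivatives gives `3 M₁ - 2 r M₂` with `r = ‖x‖ ^ 2 / 4`, the left side of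
the recurrence for `k = 1`. -/
lemma lap_radialMoment_zero (x : E3) :
    lap (radialMoment 0) x = -(1 / 2) * Real.exp (-(‖x‖ ^ 2 / 4)) := by
  have h : ∀ k, pd k (pd k (radialMoment 0)) x
      = -(1 / 2) * (radialMoment 1 x - (1 / 2) * (x k ^ 2 * radialMoment 2 x)) := fun k => by
    rw [pd_radialMoment, pd_const_mul ((contDiff_coord k).mul (contDiff_radialMoment _)),
      pd_mul (contDiff_coord k) (contDiff_radialMoment _), pd_coord, pd_radialMoment]
    simp
    ring
  have hn : ‖x‖ ^ 2 = x 0 ^ 2 + x 1 ^ 2 + x 2 ^ 2 := by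
    simp [EuclideanSpace.norm_sq_eq, Fin.sum_univ_three]
  have hr := gaussMoment_recurrence 1 (‖x‖ ^ 2 / 4)
  simp only [lap, h, Fin.sum_univ_three]
  rw [← hr]
  simp only [radialMoment, hn]
  push_cast
  ring

/-- The left side is the derivative of `lam * radialMoment 0 (lam • x)` at `lam = 1`. It is
evaluated by the recurrence for `k = 0`. -/
lemma add_fderiv_radialMoment_zero (x : E3) :
    radialMoment 0 x + fderiv ℝ (radialMoment 0) x x = Real.exp (-(‖x‖ ^ 2 / 4)) := by
  rw [(hasFDerivAt_radialMoment 0 x).fderiv, ← gaussMoment_recurrence 0]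
  simp [radialMoment]
  ring

/-- Away from the origin the recurrence bounds the moment `k + 1` by `‖x‖⁻²` times the moment `k`,
so each step gains two powers. Near the origin the bound by one suffices. The two entries of the
maximum belong to these two regions. -/
lemma exists_radialMoment_le (k : ℕ) :
    ∃ C, ∀ x : E3, |radialMoment k x| ≤ C * (1 + ‖x‖) ^ (-(2 * k + 1 : ℤ)) := by
  have h0 : ∀ k (x : E3), |radialMoment k x| = radialMoment k x := fun k x =>
    abs_of_nonneg (gaussMoment_nonneg _ _)
  have hp : ∀ (k : ℕ) (x : E3), (1 + ‖x‖) ^ (-(2 * k + 1 : ℤ)) = ((1 + ‖x‖) ^ (2 * k + 1))⁻¹ :=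
    fun k x => by rw [zpow_neg]; norm_cast
  simp only [h0, hp]
  induction k with
  | zero =>
    refine ⟨3, fun x => ?_⟩
    rw [← div_eq_mul_inv, le_div_iff₀ (by positivity)]
    have h1 : radialMoment 0 x ≤ 1 := gaussMoment_le_one 0 (by positivity)
    have h2 : radialMoment 0 x * ‖x‖ ≤ 2 := by
      rcases eq_or_ne x 0 with rfl | hx
      · simp
      · have := sqrt_mul_gaussMoment_zero_le (r := ‖x‖ ^ 2 / 4) (by positivity)
        rw [Real.sqrt_div (by positivity), Real.sqrt_sq (norm_nonneg x),
          show (4 : ℝ) = 2 ^ 2 by norm_num, Real.sqrt_sq (by norm_num)] at this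
        simp only [radialMoment]
        norm_num at this ⊢
        linarith
    simp only [mul_zero, zero_add, pow_one]
    linarith
  | succ k ih =>
    obtain ⟨C, hC⟩ := ih
    have hC0 : 0 ≤ C := by
      have := (gaussMoment_nonneg k _).trans (hC 0)
      simpa using this
    refine ⟨max (2 ^ (2 * (k + 1) + 1)) (8 * (2 * k + 1) * C), fun x => ?_⟩
    rw [← div_eq_mul_inv, le_div_iff₀ (by positivity)]
    rcases le_total ‖x‖ 1 with hx | hx
    · refine le_trans ?_ (le_max_left _ _)
      have h1 : radialMoment (k + 1) x ≤ 1 := gaussMoment_le_one _ (by positivity)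
      calc radialMoment (k + 1) x * (1 + ‖x‖) ^ (2 * (k + 1) + 1)
          ≤ 1 * (1 + 1) ^ (2 * (k + 1) + 1) := by gcongr
        _ = _ := by norm_num
    · refine le_trans ?_ (le_max_right _ _)
      have h1 := gaussMoment_recurrence k (‖x‖ ^ 2 / 4)
      have h2 := Real.exp_pos (-(‖x‖ ^ 2 / 4))
      have h3 : ‖x‖ ^ 2 * radialMoment (k + 1) x ≤ 2 * (2 * k + 1) * radialMoment k x := by
        simp only [radialMoment]; linarith
      have h4 := hC x
      rw [← div_eq_mul_inv, le_div_iff₀ (by positivity)] at h4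
      have h5 : (1 + ‖x‖) ^ 2 ≤ 4 * ‖x‖ ^ 2 := by nlinarith
      have h6 : 0 ≤ radialMoment (k + 1) x := gaussMoment_nonneg _ _
      calc radialMoment (k + 1) x * (1 + ‖x‖) ^ (2 * (k + 1) + 1)
          = radialMoment (k + 1) x * (1 + ‖x‖) ^ 2 * (1 + ‖x‖) ^ (2 * k + 1) := by ring
        _ ≤ radialMoment (k + 1) x * (4 * ‖x‖ ^ 2) * (1 + ‖x‖) ^ (2 * k + 1) := by gcongr
        _ = 4 * (‖x‖ ^ 2 * radialMoment (k + 1) x) * (1 + ‖x‖) ^ (2 * k + 1) := by ring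
        _ ≤ 4 * (2 * (2 * k + 1) * radialMoment k x) * (1 + ‖x‖) ^ (2 * k + 1) := by gcongr
        _ = 8 * (2 * k + 1) * (radialMoment k x * (1 + ‖x‖) ^ (2 * k + 1)) := by ring
        _ ≤ 8 * (2 * k + 1) * C := by gcongr

lemma symbolBound_coord (n : ℕ) (i : Fin 3) : SymbolBound n 1 1 fun x : E3 => x i := by
  have h0 : ∀ x : E3, |x i| ≤ 1 * (1 + ‖x‖) ^ (1 : ℤ) := fun x => by
    have := abs_apply_le_norm x i
    simp; linarith
  -- The derivatives of a coordinate are the constants 0 and 1. The constant 1 has order zero only,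
  -- while 0 has every order, as needed for the further derivatives.
  have hconst : ∀ (n : ℕ) (c : ℝ) (m : ℤ), 0 ≤ c → m ≤ 0 → (c = 0 ∨ m = 0 ∧ c ≤ 1) →
      SymbolBound n m 1 fun _ => c := by
    intro n
    induction n with
    | zero =>
      rintro c m hc hm (rfl | ⟨rfl, h⟩) x
      · simpa using (zpow_weight_pos x m).le
      · simpa [abs_of_nonneg hc] using h
    | succ n ih =>
      intro c m hc hm h
      refine ⟨?_, fun k => ?_⟩
      · rcases h with rfl | ⟨rfl, h⟩ <;> intro x
        · simpa using (zpow_weight_pos x m).le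
        · simpa [abs_of_nonneg hc] using h
      · have : pd k (fun _ : E3 => c) = fun _ => 0 := by ext; simp [pd]
        rw [this]
        exact ih 0 (m - 1) le_rfl (by lia) (Or.inl rfl)
  cases n with
  | zero => exact h0
  | succ n =>
    refine ⟨h0, fun k => ?_⟩
    rw [pd_coord]
    split_ifs
    · exact hconst n 1 (1 - 1) zero_le_one (by norm_num) (Or.inr ⟨by norm_num, le_rfl⟩)
    · exact hconst n 0 (1 - 1) le_rfl (by norm_num) (Or.inl rfl)

/-- A derivative is a coordinate, of order 1, times the next moment, of order `-(2 * k + 3)`: one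
order lower than before, as required. -/
lemma exists_symbolBound_radialMoment (n k : ℕ) :
    ∃ C, SymbolBound n (-(2 * k + 1 : ℤ)) C (radialMoment k) := by
  induction n generalizing k with
  | zero => exact exists_radialMoment_le k
  | succ n ih =>
    obtain ⟨C, hC⟩ := ih (k + 1)
    have h := exists_symbolBound_succ (ι := Unit) (F := fun _ => radialMoment k) (n := n)
      (m := -(2 * k + 1 : ℤ)) (by simpa using exists_radialMoment_le k) fun i => by
        have h1 := (symbolBound_coord n i).mul (contDiff_coord i) (contDiff_radialMoment _) hC
        have h2 := h1.const_mul ((contDiff_coord i).mul (contDiff_radialMoment _)) (-(1 / 2))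
        refine ⟨|-(1 / 2)| * (2 ^ n * (1 * C)), fun _ => ?_⟩
        rw [pd_radialMoment]
        exact h2.mono le_rfl (by push_cast; lia)
    simpa using h

/-! ### The potential of the Oseen kernel -/

/-- A multiple of `∫_σ^∞ G_τ dτ` with `G` the heat kernel and `σ = lam⁻²`. -/
noncomputable def heatPot (lam : ℝ) (x : E3) : ℝ := lam * radialMoment 0 (lam • x)

lemma contDiff_uncurry_heatPot : ContDiff ℝ ∞ (Function.uncurry heatPot) :=
  contDiff_fst.mul ((contDiff_radialMoment 0).comp (contDiff_fst.smul contDiff_snd))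

lemma contDiff_radialMoment_smul (lam : ℝ) :
    ContDiff ℝ ∞ fun x : E3 => radialMoment 0 (lam • x) :=
  (contDiff_radialMoment 0).comp (contDiff_const_smul _)

lemma contDiff_heatPot (lam : ℝ) : ContDiff ℝ ∞ (heatPot lam) :=
  contDiff_slice contDiff_uncurry_heatPot lam

lemma exists_symbolBound_heatPot (n : ℕ) {c₀ : ℝ} (hc₀ : 0 < c₀) (c₁ : ℝ) :
    ∃ C, ∀ lam : Icc c₀ c₁, SymbolBound n (-1) C (heatPot lam) := by
  obtain ⟨C, hC⟩ := exists_symbolBound_radialMoment n 0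
  obtain ⟨C', hC'⟩ := exists_symbolBound_comp_smul (contDiff_radialMoment 0) hC (by simp) hc₀ c₁
  refine ⟨|c₁| * C', fun lam => ?_⟩
  refine ((hC' lam).const_mul (contDiff_radialMoment_smul lam.1) lam.1).mono ?_ (by simp)
  refine mul_le_mul_of_nonneg_right ?_ (hC' lam).nonneg
  exact abs_le_abs_of_nonneg (hc₀.le.trans lam.2.1) lam.2.2

/-- All real `lam` are covered because measurability in the parameter needs integrability for each
of its values; `(Real.sqrt (c - s))⁻¹` is zero once `c ≤ s`. -/
lemma exists_symbolBound_heatPot_single (n : ℕ) (lam : ℝ) :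
    ∃ C, SymbolBound n (-1) C (heatPot lam) := by
  rcases eq_or_ne lam 0 with rfl | h
  · obtain ⟨C, hC⟩ := exists_symbolBound_heatPot n one_pos 1
    have e : heatPot 0 = fun x => 0 * heatPot 1 x := by ext; simp [heatPot]
    exact ⟨_, e ▸ (hC ⟨1, by simp⟩).const_mul (contDiff_heatPot 1) 0⟩
  · obtain ⟨C, hC⟩ := exists_symbolBound_heatPot n (abs_pos.2 h) |lam|
    have h1 := (hC ⟨|lam|, by simp⟩).const_mul (contDiff_heatPot _) (SignType.sign lam : ℝ)
    have e : heatPot lam = fun x => (SignType.sign lam : ℝ) * heatPot |lam| x := by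
      ext x
      simp only [heatPot, radialMoment, norm_smul, Real.norm_eq_abs, abs_abs, ← mul_assoc,
        sign_mul_abs]
    exact ⟨_, e ▸ h1⟩

lemma lap_heatPot (lam : ℝ) (x : E3) :
    lap (heatPot lam) x = -(1 / 2) * (lam ^ 3 * Real.exp (-(‖lam • x‖ ^ 2 / 4))) := by
  have e : heatPot lam = fun x => lam * radialMoment 0 (lam • x) := rfl
  rw [e, lap_const_mul (contDiff_radialMoment_smul lam), lap_comp_smul (contDiff_radialMoment 0)]
  simp only [lap_radialMoment_zero]
  ring

lemma hasDerivAt_invSqrt {c s : ℝ} (h : s < c) :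
    HasDerivAt (fun s => (Real.sqrt (c - s))⁻¹) (1 / 2 * (Real.sqrt (c - s))⁻¹ ^ 3) s := by
  have h0 : 0 < c - s := sub_pos.2 h
  have h1 : HasDerivAt (fun s => c - s) (-1) s := by simpa using (hasDerivAt_id s).const_sub c
  have hs : Real.sqrt (c - s) ≠ 0 := (Real.sqrt_pos.2 h0).ne'
  refine ((h1.sqrt h0.ne').inv hs).congr_deriv ?_
  field_simp

/-- The backward heat equation for the potential. -/
lemma hasDerivAt_heatPot {c s : ℝ} (h : s < c) (y : E3) :
    HasDerivAt (fun s => heatPot (Real.sqrt (c - s))⁻¹ y)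
      (-lap (heatPot (Real.sqrt (c - s))⁻¹) y) s := by
  have h1 := hasDerivAt_invSqrt h
  have h2 : HasDerivAt (fun s => radialMoment 0 ((Real.sqrt (c - s))⁻¹ • y)) _ s :=
    ((contDiff_radialMoment 0).differentiable_of_smooth _).hasFDerivAt.comp_hasDerivAt s
      (h1.smul_const y)
  refine (h1.mul h2).congr_deriv ?_
  -- As `lam' = lam ^ 3 / 2`, both terms of the product rule combine into the scaling derivative of
  -- the profile.
  rw [lap_heatPot, ← add_fderiv_radialMoment_zero]
  simp only [map_smul, smul_eq_mul]
  ring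

/-- A gradient, invisible to solenoidal fields, plus a Gaussian at scale `lam⁻¹`. -/
lemma sol_heatPot (lam : ℝ) (j : Fin 3) (x : E3) :
    sol j (heatPot lam) x = (∑ i, pd i (pd j (heatPot lam)) x • stdVec i)
      + (1 / 2 * (lam ^ 3 * Real.exp (-(‖lam • x‖ ^ 2 / 4)))) • stdVec j := by
  rw [sol, lap_heatPot, neg_mul, neg_smul, sub_neg_eq_add]

/-! ### Integrability of the weights -/

lemma memLp_weight {m : ℕ} {p : ℝ} (hp : 0 < p) (h : 3 < m * p) :
    MemLp (fun x : E3 => (1 + ‖x‖) ^ (-(m : ℤ))) (ENNReal.ofReal p) := by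
  have hc : Continuous fun x : E3 => (1 + ‖x‖) ^ (-(m : ℤ)) :=
    (continuous_const.add continuous_norm).zpow₀ _ fun x =>
      Or.inl (by linarith [norm_nonneg x] : (0 : ℝ) < 1 + ‖x‖).ne'
  rw [← integrable_norm_rpow_iff hc.aestronglyMeasurable (by simpa using hp) (by simp),
    ENNReal.toReal_ofReal hp.le]
  have h1 := integrable_one_add_norm (E := E3) (μ := volume) (r := m * p) (by simpa using h)
  refine h1.congr (Eventually.of_forall fun x => ?_)
  simp only
  rw [Real.norm_of_nonneg (zpow_weight_pos x _).le, ← Real.rpow_intCast,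
    ← Real.rpow_mul (by positivity)]
  congr 1
  push_cast
  ring

lemma memLp_weight_three_halves :
    MemLp (fun x : E3 => (1 + ‖x‖) ^ (-3 : ℤ)) (ENNReal.ofReal (3 / 2)) :=
  memLp_weight (m := 3) (by norm_num) (by norm_num)

lemma memLp_weight_three : MemLp (fun x : E3 => (1 + ‖x‖) ^ (-4 : ℤ)) 3 := by
  have := memLp_weight (m := 4) (p := 3) (by norm_num) (by norm_num)
  simpa using this

lemma integrable_weight : Integrable (fun x : E3 => (1 + ‖x‖) ^ (-4 : ℤ)) := by
  have := memLp_weight (m := 4) (p := 1) (by norm_num) (by norm_num)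
  simpa [memLp_one_iff_integrable] using this

lemma MemLp.comp_sub {F : Type*} [NormedAddCommGroup F] {f : E3 → F} {p : ℝ≥0∞} (hf : MemLp f p)
    (x₀ : E3) : MemLp (fun x => f (x - x₀)) p :=
  hf.comp_measurePreserving (measurePreserving_sub_right volume x₀)

/-! ### The `L¹` norm of the gradient of the Oseen kernel -/

lemma exists_norm_fderiv_sol_heatPot_le :
    ∃ C, ∀ (lam : ℝ) (j : Fin 3) (x : E3),
      ‖fderiv ℝ (sol j (heatPot lam)) x‖ ≤ C * lam ^ 4 * (1 + ‖lam • x‖) ^ (-4 : ℤ) := by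
  obtain ⟨C, hC⟩ := exists_symbolBound_radialMoment 3 0
  refine ⟨18 * C, fun lam j x => (norm_fderiv_sol_le (contDiff_heatPot lam) j x).trans ?_⟩
  have e : heatPot lam = fun x => lam * radialMoment 0 (lam • x) := rfl
  have hs : ∀ k, ContDiff ℝ ∞ fun x : E3 => pd k (radialMoment 0) (lam • x) := fun k =>
    (contDiff_pd (contDiff_radialMoment 0) k).comp (contDiff_const_smul _)
  have h : ∀ k, ‖sol j (pd k (heatPot lam)) x‖
      ≤ lam ^ 4 * (6 * C * (1 + ‖lam • x‖) ^ (-4 : ℤ)) := fun k => by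
    rw [e, pd_const_mul (contDiff_radialMoment_smul lam), pd_comp_smul (contDiff_radialMoment 0),
      sol_const_mul (contDiff_const.mul (hs k)), sol_const_mul (hs k),
      sol_comp_smul (contDiff_pd (contDiff_radialMoment 0) k)]
    simp only [smul_smul]
    -- One factor `lam` comes from the prefactor of the potential, three from the three derivatives.
    rw [norm_smul, show lam * (lam * lam ^ 2) = lam ^ 4 by ring, Real.norm_of_nonneg (by positivity)]
    gcongr
    simpa using (hC.pd k).norm_sol_le j (lam • x)
  calc _ ≤ ∑ _k : Fin 3, lam ^ 4 * (6 * C * (1 + ‖lam • x‖) ^ (-4 : ℤ)) :=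
        Finset.sum_le_sum fun k _ => h k
    _ = _ := by simp; ring

/-- The change of variables contributes `lam⁻³`, leaving `lam ^ 4 * lam⁻³ = lam`, that is `(c -
s)^{-1/2}` in the application. -/
lemma exists_lintegral_fderiv_sol_heatPot_le :
    ∃ K : ℝ≥0, ∀ (lam : ℝ) (j : Fin 3), 0 < lam →
      ∫⁻ x, ‖fderiv ℝ (sol j (heatPot lam)) x‖ₑ ≤ K * ENNReal.ofReal lam := by
  obtain ⟨C, hC⟩ := exists_norm_fderiv_sol_heatPot_le
  refine ⟨Real.toNNReal (C * ∫ x : E3, (1 + ‖x‖) ^ (-4 : ℤ)), fun lam j hl => ?_⟩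
  have hi : Integrable fun x : E3 => C * lam ^ 4 * (1 + ‖lam • x‖) ^ (-4 : ℤ) :=
    (integrable_weight.comp_smul hl.ne').const_mul _
  calc ∫⁻ x, ‖fderiv ℝ (sol j (heatPot lam)) x‖ₑ
      ≤ ∫⁻ x : E3, ENNReal.ofReal (C * lam ^ 4 * (1 + ‖lam • x‖) ^ (-4 : ℤ)) := by
        refine lintegral_mono fun x => ?_
        rw [← ofReal_norm]
        exact ENNReal.ofReal_le_ofReal (hC lam j x)
    _ = ENNReal.ofReal (∫ x : E3, C * lam ^ 4 * (1 + ‖lam • x‖) ^ (-4 : ℤ)) :=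
        (ofReal_integral_eq_lintegral_ofReal hi (Eventually.of_forall fun x =>
          (norm_nonneg _).trans (hC lam 0 x))).symm
    _ = ENNReal.ofReal (C * (∫ x : E3, (1 + ‖x‖) ^ (-4 : ℤ)) * lam) := by
        rw [integral_const_mul, Measure.integral_comp_smul volume
          (fun x : E3 => (1 + ‖x‖) ^ (-4 : ℤ)) lam]
        simp only [finrank_euclideanSpace, Fintype.card_fin, smul_eq_mul]
        rw [abs_of_pos (by positivity)]
        congr 1
        field_simp
    _ = _ := by
        rw [ENNReal.ofReal_mul' hl.le]
        rfl

/-! ### Linear and quadratic pairings on `L³` -/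

/-- The exponent conjugate to `3`. -/
noncomputable abbrev threeHalves : ℝ≥0∞ := ENNReal.ofReal (3 / 2)

lemma inv_threeHalves : threeHalves⁻¹ = ENNReal.ofReal (2 / 3) := by
  rw [← ENNReal.ofReal_inv_of_pos (by norm_num)]
  norm_num

lemma inv_three : (3 : ℝ≥0∞)⁻¹ = ENNReal.ofReal (1 / 3) := by
  rw [show (3 : ℝ≥0∞) = ENNReal.ofReal 3 by simp, ← ENNReal.ofReal_inv_of_pos (by norm_num)]
  norm_num

instance holderTriple_three_three : ENNReal.HolderTriple 3 3 threeHalves :=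
  ⟨by rw [inv_threeHalves, inv_three, ← ENNReal.ofReal_add (by norm_num) (by norm_num)]; norm_num⟩

instance holderTriple_three_threeHalves : ENNReal.HolderTriple 3 threeHalves 1 :=
  ⟨by rw [inv_threeHalves, inv_three, ← ENNReal.ofReal_add (by norm_num) (by norm_num)]; norm_num⟩

instance holderTriple_threeHalves_three : ENNReal.HolderTriple threeHalves 3 1 :=
  ⟨by rw [inv_threeHalves, inv_three, ← ENNReal.ofReal_add (by norm_num) (by norm_num)]; norm_num⟩

instance fact_one_le_threeHalves : Fact (1 ≤ threeHalves) :=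
  ⟨by rw [ENNReal.one_le_ofReal]; norm_num⟩

/-- The pairing `∫ u · b`. -/
noncomputable def linPair (b : E3 → E3) (u : L3) : ℝ := ∫ x, ⟪u x, b x⟫_ℝ

/-- The quadratic form `∫ (b u) · u`. -/
noncomputable def quadPair (b : E3 → E3 →L[ℝ] E3) (u : L3) : ℝ := ∫ x, ⟪b x (u x), u x⟫_ℝ

variable {b : E3 → E3} {B : E3 → E3 →L[ℝ] E3}

lemma linPair_eq_lpPairing (hb : MemLp b threeHalves) (u : L3) :
    linPair b u = (innerSL ℝ (E := E3)).lpPairing volume 3 threeHalves u (hb.toLp b) := by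
  rw [ContinuousLinearMap.lpPairing_eq_integral]
  refine integral_congr_ae ?_
  filter_upwards [hb.coeFn_toLp] with x hx
  simp only [hx]
  rfl

lemma continuous_linPair (hb : MemLp b threeHalves) : Continuous (linPair b) := by
  have : linPair b
      = fun u => (innerSL ℝ (E := E3)).lpPairing volume 3 threeHalves u (hb.toLp b) :=
    funext (linPair_eq_lpPairing hb)
  rw [this]
  fun_prop

lemma linPair_sub (hb : MemLp b threeHalves) (u v : L3) :
    linPair b (u - v) = linPair b u - linPair b v := by
  simp [linPair_eq_lpPairing hb]

lemma integrable_inner (hb : MemLp b threeHalves) (u : L3) :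
    Integrable fun x => ⟪u x, b x⟫_ℝ :=
  memLp_one_iff_integrable.1 ((innerSL ℝ (E := E3)).memLp_of_bilin 1 (Lp.memLp u) hb)

lemma memLp_clm_apply (hB : MemLp B 3) (u : L3) : MemLp (fun x => B x (u x)) threeHalves :=
  (ContinuousLinearMap.id ℝ (E3 →L[ℝ] E3)).memLp_of_bilin threeHalves hB (Lp.memLp u)

lemma quadPair_eq_lpPairing (hB : MemLp B 3) (u : L3) :
    quadPair B u = (innerSL ℝ (E := E3)).lpPairing volume threeHalves 3
      ((ContinuousLinearMap.id ℝ (E3 →L[ℝ] E3)).holderL volume 3 3 threeHalves (hB.toLp B) u)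
        u := by
  rw [ContinuousLinearMap.lpPairing_eq_integral]
  refine integral_congr_ae ?_
  filter_upwards [hB.coeFn_toLp,
    (ContinuousLinearMap.id ℝ (E3 →L[ℝ] E3)).coeFn_holder (r := threeHalves) (hB.toLp B) u]
    with x hx hx'
  simp only [ContinuousLinearMap.holderL_apply_apply, hx, hx']
  rfl

lemma continuous_quadPair (hB : MemLp B 3) : Continuous (quadPair B) := by
  have := funext (quadPair_eq_lpPairing hB)
  rw [this]
  fun_prop

lemma integrable_quadPair (hB : MemLp B 3) (u : L3) : Integrable fun x => ⟪B x (u x), u x⟫_ℝ :=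
  memLp_one_iff_integrable.1
    ((innerSL ℝ (E := E3)).memLp_of_bilin 1 (memLp_clm_apply hB u) (Lp.memLp u))

lemma enorm_linPair_le (hb : AEStronglyMeasurable b) (u : L3) :
    ‖linPair b u‖ₑ ≤ ‖u‖ₑ * eLpNorm b threeHalves volume := by
  refine (enorm_integral_le_lintegral_enorm _).trans ?_
  rw [← eLpNorm_one_eq_lintegral_enorm, Lp.enorm_def]
  have := eLpNorm_le_eLpNorm_mul_eLpNorm_of_nnnorm (p := 3) (q := threeHalves) (r := 1)
    (Lp.memLp u).1 hb
    (fun x y => ⟪x, y⟫_ℝ) 1 (Eventually.of_forall fun x => by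
      simpa using nnnorm_inner_le_nnnorm (𝕜 := ℝ) (u x) (b x))
  simpa using this

lemma enorm_quadPair_le (hB : AEStronglyMeasurable B) (u : L3) :
    ‖quadPair B u‖ₑ ≤ eLpNorm B 3 volume * ‖u‖ₑ * ‖u‖ₑ := by
  refine (enorm_integral_le_lintegral_enorm _).trans ?_
  have hBu : AEStronglyMeasurable fun x => B x (u x) :=
    (ContinuousLinearMap.id ℝ (E3 →L[ℝ] E3)).aestronglyMeasurable_comp₂ hB (Lp.memLp u).1
  rw [← eLpNorm_one_eq_lintegral_enorm, Lp.enorm_def]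
  have h1 := eLpNorm_le_eLpNorm_mul_eLpNorm_of_nnnorm (r := 1) (p := threeHalves)
    (q := 3) hBu
    (Lp.memLp u).1 (fun x y => ⟪x, y⟫_ℝ) 1 (Eventually.of_forall fun x => by
      simpa using nnnorm_inner_le_nnnorm (𝕜 := ℝ) (B x (u x)) (u x))
  have h2 := eLpNorm_le_eLpNorm_mul_eLpNorm_of_nnnorm (r := threeHalves) (p := 3)
    (q := 3) hB
    (Lp.memLp u).1 (fun L y => L y) 1 (Eventually.of_forall fun x => by
      simpa using (B x).le_opNNNorm (u x))
  refine h1.trans ?_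
  simp only [ENNReal.coe_one, one_mul] at h2 ⊢
  gcongr

lemma tendsto_linPair {ι : Type*} {l : Filter ι} [l.IsCountablyGenerated] {F : ι → E3 → E3}
    {G : E3 → ℝ} (hF : ∀ᶠ n in l, AEStronglyMeasurable (F n)) (hG : MemLp G threeHalves)
    (hle : ∀ᶠ n in l, ∀ x, ‖F n x‖ ≤ G x) (hlim : ∀ x, Tendsto (fun n => F n x) l (𝓝 (b x)))
    (u : L3) : Tendsto (fun n => linPair (F n) u) l (𝓝 (linPair b u)) := by
  have hint : Integrable fun x => ‖u x‖ * G x :=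
    memLp_one_iff_integrable.1 ((ContinuousLinearMap.mul ℝ ℝ).memLp_of_bilin 1
      (Lp.memLp u).norm hG)
  refine tendsto_integral_filter_of_dominated_convergence _ ?_ ?_ hint ?_
  · filter_upwards [hF] with n hn
    exact (Lp.memLp u).1.inner hn
  · filter_upwards [hle] with n hn
    refine Eventually.of_forall fun x => (norm_inner_le_norm _ _).trans ?_
    gcongr
    exact hn x
  · exact Eventually.of_forall fun x => tendsto_const_nhds.inner (hlim x)

lemma tendsto_quadPair {ι : Type*} {l : Filter ι} [l.IsCountablyGenerated]
    {F : ι → E3 → E3 →L[ℝ] E3} {G : E3 → ℝ} (hF : ∀ᶠ n in l, AEStronglyMeasurable (F n))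
    (hG : MemLp G 3) (hle : ∀ᶠ n in l, ∀ x, ‖F n x‖ ≤ G x)
    (hlim : ∀ x, Tendsto (fun n => F n x) l (𝓝 (B x))) (u : L3) :
    Tendsto (fun n => quadPair (F n) u) l (𝓝 (quadPair B u)) := by
  have hint' : MemLp (fun x => G x * ‖u x‖) threeHalves :=
    (ContinuousLinearMap.mul ℝ ℝ).memLp_of_bilin threeHalves hG (Lp.memLp u).norm
  have hint : Integrable fun x => G x * ‖u x‖ * ‖u x‖ :=
    memLp_one_iff_integrable.1 ((ContinuousLinearMap.mul ℝ ℝ).memLp_of_bilin 1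
      hint' (Lp.memLp u).norm)
  refine tendsto_integral_filter_of_dominated_convergence _ ?_ ?_ hint ?_
  · filter_upwards [hF] with n hn
    exact ((ContinuousLinearMap.id ℝ (E3 →L[ℝ] E3)).aestronglyMeasurable_comp₂ hn
      (Lp.memLp u).1).inner (Lp.memLp u).1
  · filter_upwards [hle] with n hn
    refine Eventually.of_forall fun x => (norm_inner_le_norm _ _).trans ?_
    gcongr
    exact ((F n x).le_opNorm _).trans (by gcongr; exact hn x)
  · exact Eventually.of_forall fun x =>
      (((ContinuousLinearMap.apply ℝ E3 (u x)).continuous.tendsto _).comp (hlim x)).inner tendsto_const_nhds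

/-- Dominated convergence in `L^p`. -/
lemma tendsto_eLpNorm_sub_of_dominated {ι F : Type*} [NormedAddCommGroup F] {l : Filter ι}
    [l.IsCountablyGenerated] {f : ι → E3 → F} {g : E3 → F} {G : E3 → ℝ} {p : ℝ} (hp : 0 < p)
    (hf : ∀ᶠ n in l, StronglyMeasurable (f n)) (hg : StronglyMeasurable g)
    (hG : MemLp G (ENNReal.ofReal p)) (hle : ∀ᶠ n in l, ∀ x, ‖f n x‖ ≤ G x) (hgG : ∀ x, ‖g x‖ ≤ G x)
    (hlim : ∀ x, Tendsto (fun n => f n x) l (𝓝 (g x))) :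
    Tendsto (fun n => eLpNorm (fun x => f n x - g x) (ENNReal.ofReal p) volume) l (𝓝 0) := by
  have hp' : ENNReal.ofReal p ≠ 0 := by simpa using hp
  have h2G : MemLp (fun x => 2 * G x) (ENNReal.ofReal p) := hG.const_mul 2
  have hfin := lintegral_rpow_enorm_lt_top_of_eLpNorm_lt_top hp' ENNReal.ofReal_ne_top h2G.2
  rw [ENNReal.toReal_ofReal hp.le] at hfin
  have h := tendsto_lintegral_filter_of_dominated_convergence (μ := volume) (l := l)
    (F := fun n x => ‖f n x - g x‖ₑ ^ p) (f := fun _ => 0) (fun x => ‖2 * G x‖ₑ ^ p)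
    (by
      filter_upwards [hf] with n hn
      exact (hn.sub hg).enorm.pow_const p) (by
      filter_upwards [hle] with n hn
      refine Eventually.of_forall fun x => ?_
      gcongr
      rw [enorm_le_iff_norm_le]
      refine (norm_sub_le _ _).trans ?_
      rw [Real.norm_of_nonneg (by have := (norm_nonneg _).trans (hgG x); positivity)]
      linarith [hn x, hgG x]) hfin.ne (Eventually.of_forall fun x => by
      have h1 : Tendsto (fun n => ‖f n x - g x‖ₑ) l (𝓝 0) := by
        have := ((hlim x).sub_const (g x)).enorm
        simpa using this
      have h2 := h1.ennrpow_const p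
      simpa [hp] using h2)
  simp only [lintegral_zero] at h
  have h3 := h.ennrpow_const (1 / p)
  simp only [eLpNorm_eq_lintegral_rpow_enorm_toReal hp' ENNReal.ofReal_ne_top,
    ENNReal.toReal_ofReal hp.le]
  simpa [hp] using h3

/-! ### Measurable dependence on parameters -/

noncomputable instance measurableSpaceL3 : MeasurableSpace L3 := borel L3
instance fact_three_ne_top : Fact ((3 : ℝ≥0∞) ≠ ⊤) := ⟨by simp⟩

instance borelSpaceL3 : BorelSpace L3 := ⟨rfl⟩

/-- The pairing is a Carathéodory function: continuous in the field, measurable in the parameter.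
Hence it is jointly measurable and may be evaluated along a measurable curve of fields. -/
lemma stronglyMeasurable_linPair {P : Type*} [MeasurableSpace P] {b : P → E3 → E3}
    (hb : StronglyMeasurable (Function.uncurry b)) (hLp : ∀ p, MemLp (b p) threeHalves) :
    StronglyMeasurable fun q : L3 × P => linPair (b q.2) q.1 := by
  refine stronglyMeasurable_uncurry_of_continuous_of_stronglyMeasurable
    (u := fun u p => linPair (b p) u) (fun p => continuous_linPair (hLp p)) fun u => ?_
  have : StronglyMeasurable (Function.uncurry fun (p : P) (x : E3) => ⟪u x, b p x⟫_ℝ) :=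
    ((Lp.stronglyMeasurable u).comp_measurable measurable_snd).inner hb
  exact this.integral_prod_right

lemma stronglyMeasurable_quadPair {P : Type*} [MeasurableSpace P] {b : P → E3 → E3 →L[ℝ] E3}
    (hb : StronglyMeasurable (Function.uncurry b)) (hLp : ∀ p, MemLp (b p) 3) :
    StronglyMeasurable fun q : L3 × P => quadPair (b q.2) q.1 := by
  refine stronglyMeasurable_uncurry_of_continuous_of_stronglyMeasurable
    (u := fun u p => quadPair (b p) u) (fun p => continuous_quadPair (hLp p)) fun u => ?_
  have hu : StronglyMeasurable fun q : P × E3 => u q.2 :=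
    (Lp.stronglyMeasurable u).comp_measurable measurable_snd
  have : StronglyMeasurable (Function.uncurry fun (p : P) (x : E3) => ⟪b p x (u x), u x⟫_ℝ) :=
    ((ContinuousLinearMap.id ℝ (E3 →L[ℝ] E3)).continuous₂.comp_stronglyMeasurable
      (hb.prodMk hu)).inner hu
  exact this.integral_prod_right

/-! ### Testing the equation with the Oseen kernel -/

/-- The column `j` of the Oseen kernel centred at `x₀`, up to a constant factor. -/
noncomputable def oseen (j : Fin 3) (lam : ℝ) (x₀ y : E3) : E3 := sol j (heatPot lam) (y - x₀)

/-- The gradient of `oseen j lam x₀`. -/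
noncomputable def oseenGrad (j : Fin 3) (lam : ℝ) (x₀ y : E3) : E3 →L[ℝ] E3 :=
  fderiv ℝ (sol j (heatPot lam)) (y - x₀)

lemma continuous_oseen (j : Fin 3) :
    Continuous fun q : (ℝ × E3) × E3 => oseen j q.1.1 q.1.2 q.2 := by
  have h : Continuous fun q : ℝ × E3 => sol j (heatPot q.1) q.2 :=
    (contDiff_uncurry_sol contDiff_uncurry_heatPot j).continuous
  have h' : Continuous fun q : (ℝ × E3) × E3 => (q.1.1, q.2 - q.1.2) :=
    continuous_fst.fst.prodMk (continuous_snd.sub continuous_fst.snd)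
  simpa only [oseen, Function.comp_def] using h.comp h'

lemma continuous_uncurry_fderiv {F : ℝ → E3 → E3} (hF : ContDiff ℝ ∞ (Function.uncurry F)) :
    Continuous fun q : ℝ × E3 => fderiv ℝ (F q.1) q.2 := by
  have : ContDiff ℝ ∞ (Function.uncurry fun (q : ℝ × E3) (y : E3) => F q.1 y) :=
    hF.comp (contDiff_fst.fst.prodMk contDiff_snd)
  exact (ContDiff.fderiv (m := ∞) (n := 0) this contDiff_snd (by simp)).continuous

lemma continuous_oseenGrad (j : Fin 3) :
    Continuous fun q : (ℝ × E3) × E3 => oseenGrad j q.1.1 q.1.2 q.2 := by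
  have h : Continuous fun q : ℝ × E3 => fderiv ℝ (sol j (heatPot q.1)) q.2 :=
    continuous_uncurry_fderiv (contDiff_uncurry_sol contDiff_uncurry_heatPot j)
  have h' : Continuous fun q : (ℝ × E3) × E3 => (q.1.1, q.2 - q.1.2) :=
    continuous_fst.fst.prodMk (continuous_snd.sub continuous_fst.snd)
  exact h.comp h'

lemma memLp_of_norm_le_weight {F : Type*} [NormedAddCommGroup F] {f : E3 → F} {C : ℝ} {m : ℤ}
    {p : ℝ≥0∞} (hw : MemLp (fun x : E3 => (1 + ‖x‖) ^ m) p) (hf : AEStronglyMeasurable f) (x₀ : E3)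
    (h : ∀ x, ‖f x‖ ≤ C * (1 + ‖x - x₀‖) ^ m) : MemLp f p :=
  ((MemLp.comp_sub hw x₀).const_mul C).mono' hf (Eventually.of_forall h)

lemma memLp_oseen (j : Fin 3) (lam : ℝ) (x₀ : E3) : MemLp (oseen j lam x₀) threeHalves := by
  obtain ⟨C, hC⟩ := exists_symbolBound_heatPot_single 2 lam
  exact memLp_of_norm_le_weight memLp_weight_three_halves
    ((continuous_oseen j).comp (Continuous.prodMk_right (lam, x₀))).aestronglyMeasurable x₀
    fun x => hC.norm_sol_le j (x - x₀)

lemma memLp_oseenGrad (j : Fin 3) (lam : ℝ) (x₀ : E3) : MemLp (oseenGrad j lam x₀) 3 := by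
  obtain ⟨C, hC⟩ := exists_symbolBound_heatPot_single 3 lam
  exact memLp_of_norm_le_weight memLp_weight_three
    ((continuous_oseenGrad j).comp (Continuous.prodMk_right (lam, x₀))).aestronglyMeasurable x₀
    fun x => hC.norm_fderiv_sol_le (contDiff_heatPot lam) j (x - x₀)

/-- A smooth cutoff function, equal to one on the unit ball. -/
lemma exists_cutoff : ∃ ρ : E3 → ℝ, ContDiff ℝ ∞ ρ ∧ HasCompactSupport ρ ∧
    ∀ x, ‖x‖ ≤ 1 → ρ x = 1 := by
  let f : ContDiffBump (0 : E3) := ⟨1, 2, one_pos, one_lt_two⟩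
  exact ⟨f, f.contDiff, f.hasCompactSupport, fun x hx => f.one_of_mem_closedBall (by simpa using hx)⟩

/-- The dilated cutoffs. -/
noncomputable def dilate (ρ : E3 → ℝ) (n : ℕ) (x : E3) : ℝ := ρ (((n : ℝ) + 1)⁻¹ • x)

/-! ### Truncation of the potential in space and time -/

section Cutoff

variable {ρ : E3 → ℝ}

lemma contDiff_dilate (hρ : ContDiff ℝ ∞ ρ) (n : ℕ) : ContDiff ℝ ∞ (dilate ρ n) :=
  hρ.comp (contDiff_const_smul _)

lemma hasCompactSupport_dilate (hc : HasCompactSupport ρ) (n : ℕ) :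
    HasCompactSupport (dilate ρ n) :=
  hc.comp_homeomorph (Homeomorph.smulOfNeZero (((n : ℝ) + 1)⁻¹) (by positivity))

/-- Equality on a neighbourhood, not only at the point, so that derivatives there are eventually
unaffected by the cutoff. -/
lemma eventually_dilate_eq_one (h1 : ∀ x, ‖x‖ ≤ 1 → ρ x = 1) (z : E3) :
    ∀ᶠ n : ℕ in atTop, ∀ᶠ y in 𝓝 z, dilate ρ n y = 1 := by
  obtain ⟨N, hN⟩ := exists_nat_gt ‖z‖
  filter_upwards [eventually_ge_atTop N] with n hn
  have : ‖z‖ < (n : ℝ) + 1 := by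
    have : (N : ℝ) ≤ n := by exact_mod_cast hn
    linarith
  filter_upwards [(isOpen_lt continuous_norm continuous_const).mem_nhds this] with y hy
  refine h1 _ ?_
  rw [norm_smul, norm_inv, Real.norm_of_nonneg (by positivity), inv_mul_le_iff₀ (by positivity)]
  simpa using hy.le

lemma exists_symbolBound_dilate (hρ : ContDiff ℝ ∞ ρ) (hc : HasCompactSupport ρ) (k : ℕ) :
    ∃ C, ∀ n : ℕ, SymbolBound k 0 C (dilate ρ n) := by
  obtain ⟨C, hC⟩ := exists_symbolBound_cutoff hρ hc k 0
  refine ⟨C, fun n => ?_⟩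
  simpa using! hC ⟨(n : ℝ) + 1, by simp⟩

/-- The truncated potential. -/
noncomputable def truncPot (ρ : E3 → ℝ) (η : ℝ → ℝ) (c : ℝ) (n : ℕ) (s : ℝ) (y : E3) : ℝ :=
  η s * (dilate ρ n y * heatPot (Real.sqrt (c - s))⁻¹ y)

/-- The backward heat operator applied to the truncated potential. -/
noncomputable def truncSource (ρ : E3 → ℝ) (η : ℝ → ℝ) (c : ℝ) (n : ℕ) (s : ℝ) (y : E3) : ℝ :=
  deriv η s * (dilate ρ n y * heatPot (Real.sqrt (c - s))⁻¹ y)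
    + η s * (lap (fun y => dilate ρ n y * heatPot (Real.sqrt (c - s))⁻¹ y) y
      + -1 * (dilate ρ n y * lap (heatPot (Real.sqrt (c - s))⁻¹) y))

variable {η : ℝ → ℝ} {b c : ℝ}

lemma tsupport_truncPot_subset (n : ℕ) :
    tsupport (Function.uncurry (truncPot ρ η c n)) ⊆ tsupport η ×ˢ tsupport (dilate ρ n) := by
  refine closure_minimal ?_ ((isClosed_tsupport _).prod (isClosed_tsupport _))
  rintro ⟨s, y⟩ h
  simp only [Function.mem_support, Function.uncurry_apply_pair, truncPot, mul_ne_zero_iff] at h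
  exact ⟨subset_tsupport _ h.1, subset_tsupport _ h.2.1⟩

/-- The square root is singular only at `s = c`, and `η` vanishes near all times from `c` on. -/
lemma contDiff_truncPot (hρ : ContDiff ℝ ∞ ρ) (hη : ContDiff ℝ ∞ η)
    (hs : tsupport η ⊆ Iio c) (n : ℕ) : ContDiff ℝ ∞ (Function.uncurry (truncPot ρ η c n)) := by
  refine contDiff_iff_contDiffAt.2 fun p => ?_
  by_cases hp : p ∈ tsupport (Function.uncurry (truncPot ρ η c n))
  swap
  · exact contDiffAt_const.congr_of_eventuallyEq (notMem_tsupport_iff_eventuallyEq.1 hp)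
  have hp' : p.1 < c := hs (tsupport_truncPot_subset n hp).1
  have h0 : c - p.1 ≠ 0 := (sub_pos.2 hp').ne'
  have h1 : ContDiffAt ℝ ∞ (fun p : ℝ × E3 => (Real.sqrt (c - p.1))⁻¹) p :=
    ((contDiffAt_const.sub contDiffAt_fst).sqrt h0).inv (Real.sqrt_pos.2 (sub_pos.2 hp')).ne'
  have h2 : ContDiffAt ℝ ∞ (fun p : ℝ × E3 => heatPot (Real.sqrt (c - p.1))⁻¹ p.2) p :=
    ContDiffAt.comp (g := Function.uncurry heatPot) p contDiff_uncurry_heatPot.contDiffAt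
      (h1.prodMk contDiffAt_snd)
  exact (hη.comp contDiff_fst).contDiffAt.mul
    (((contDiff_dilate hρ n).comp contDiff_snd).contDiffAt.mul h2)

/-- The backward heat equation cancels the main terms. What is left comes from `η'` and from the
commutator of the Laplacian with the spatial cutoff. -/
lemma deriv_truncPot_add_lap (hρ : ContDiff ℝ ∞ ρ) (hη : ContDiff ℝ ∞ η)
    (hs : tsupport η ⊆ Iio c) (n : ℕ) (t : ℝ) (z : E3) :
    deriv (fun s => truncPot ρ η c n s z) t + lap (truncPot ρ η c n t) z
      = truncSource ρ η c n t z := by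
  have hm : ContDiff ℝ ∞ fun y => dilate ρ n y * heatPot (Real.sqrt (c - t))⁻¹ y :=
    (contDiff_dilate hρ n).mul (contDiff_heatPot _)
  have h1 : lap (truncPot ρ η c n t) z
      = η t * lap (fun y => dilate ρ n y * heatPot (Real.sqrt (c - t))⁻¹ y) z :=
    congrFun (lap_const_mul hm (η t)) z
  have h2 : deriv (fun s => truncPot ρ η c n s z) t
      = deriv η t * (dilate ρ n z * heatPot (Real.sqrt (c - t))⁻¹ z)
        + η t * (dilate ρ n z * -lap (heatPot (Real.sqrt (c - t))⁻¹) z) := by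
    by_cases ht : t ∈ tsupport η
    · exact ((hη.differentiable_of_smooth t).hasDerivAt.mul
        ((hasDerivAt_heatPot (hs ht) z).const_mul (dilate ρ n z))).deriv
    · have h0 := notMem_tsupport_iff_eventuallyEq.1 ht
      have h3 : (fun s => truncPot ρ η c n s z) =ᶠ[𝓝 t] fun _ => 0 := by
        filter_upwards [h0] with s hs
        simp [truncPot, hs]
      rw [h3.deriv_eq, h0.deriv_eq, h0.self_of_nhds]
      simp
  rw [h1, h2, truncSource]
  ring

lemma invSqrt_mem_Icc (hbc : b < c) {s : ℝ} (hs : s ∈ Ioo 0 b) :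
    (Real.sqrt (c - s))⁻¹ ∈ Icc (Real.sqrt c)⁻¹ (Real.sqrt (c - b))⁻¹ := by
  have h1 : 0 < Real.sqrt (c - b) := Real.sqrt_pos.2 (by linarith)
  have h2 : 0 < Real.sqrt (c - s) := Real.sqrt_pos.2 (by linarith [hs.2])
  constructor
  · gcongr
    linarith [hs.1]
  · gcongr
    exact hs.2.le

/-- Uniform symbol bounds for the truncated potentials and their sources. -/
lemma exists_symbolBound_trunc (hρ : ContDiff ℝ ∞ ρ) (hρc : HasCompactSupport ρ)
    (hη : ContDiff ℝ ∞ η) (hηc : HasCompactSupport η) (hb : 0 < b) (hbc : b < c)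
    (hs : tsupport η ⊆ Ioo 0 b) :
    ∃ C, ∀ n t, SymbolBound 4 (-1) C (truncPot ρ η c n t) ∧
      SymbolBound 2 (-1) C (truncSource ρ η c n t) := by
  obtain ⟨C₁, h₁⟩ := exists_symbolBound_heatPot 4 (c₀ := (Real.sqrt c)⁻¹)
    (inv_pos.2 (Real.sqrt_pos.2 (hb.trans hbc))) (Real.sqrt (c - b))⁻¹
  obtain ⟨C₂, h₂⟩ := exists_symbolBound_dilate hρ hρc 4
  obtain ⟨K₁, hK₁⟩ := hη.continuous.bounded_above_of_compact_support hηc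
  obtain ⟨K₂, hK₂⟩ := (hη.continuous_deriv (by simp)).bounded_above_of_compact_support hηc.deriv
  have hK₁0 : 0 ≤ K₁ := (norm_nonneg _).trans (hK₁ 0)
  have hK₂0 : 0 ≤ K₂ := (norm_nonneg _).trans (hK₂ 0)
  obtain ⟨t₀, ht₀⟩ : (Ioo 0 b).Nonempty := nonempty_Ioo.2 hb
  have hC₁ := (h₁ ⟨_, invSqrt_mem_Icc hbc ht₀⟩).nonneg
  have hC₂ := (h₂ 0).nonneg
  have main : ∀ n, ∀ t ∈ Ioo 0 b, SymbolBound 4 (-1) (K₁ * (2 ^ 4 * (C₂ * C₁)))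
      (truncPot ρ η c n t) ∧ SymbolBound 2 (-1) (K₂ * (2 ^ 4 * (C₂ * C₁))
        + K₁ * (3 * (2 ^ 4 * (C₂ * C₁)) + 1 * (2 ^ 2 * (C₂ * (3 * C₁)))))
      (truncSource ρ η c n t) := by
    intro n t ht
    have hΦ := h₁ ⟨_, invSqrt_mem_Icc hbc ht⟩
    simp only at hΦ
    set lam := (Real.sqrt (c - t))⁻¹
    have sΦ := contDiff_heatPot lam
    have sρ := contDiff_dilate hρ n
    have sm : ContDiff ℝ ∞ fun y => dilate ρ n y * heatPot lam y := sρ.mul sΦ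
    have hm : SymbolBound 4 (-1) _ fun y => dilate ρ n y * heatPot lam y :=
      (h₂ n).mul sρ sΦ hΦ
    have hl : SymbolBound 2 (-1 - 2) _ (lap fun y => dilate ρ n y * heatPot lam y) := hm.lap sm
    have hr : SymbolBound 2 (-1 - 2) _ fun y => -1 * (dilate ρ n y * lap (heatPot lam) y) :=
      ((((h₂ n).of_le (by norm_num : 2 ≤ 4)).mul sρ (contDiff_lap sΦ) (hΦ.lap sΦ)).const_mul
        (sρ.mul (contDiff_lap sΦ)) (-1)).mono le_rfl (by norm_num)
    have sr : ContDiff ℝ ∞ fun y => -1 * (dilate ρ n y * lap (heatPot lam) y) :=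
      contDiff_const.mul (sρ.mul (contDiff_lap sΦ))
    have hsum := SymbolBound.add (contDiff_lap sm) sr hl hr
    have ssum := (contDiff_lap sm).add sr
    refine ⟨(hm.const_mul sm (η t)).mono ?_ le_rfl, ?_⟩
    · exact mul_le_mul_of_nonneg_right (hK₁ t) (by positivity)
    · refine (SymbolBound.add (contDiff_const.mul sm) (contDiff_const.mul ssum)
        ((hm.of_le (by norm_num : 2 ≤ 4)).const_mul sm (deriv η t))
        ((hsum.const_mul ssum (η t)).mono (m' := -1) le_rfl (by norm_num))).mono ?_ le_rfl
      simp only [abs_neg, abs_one]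
      refine add_le_add (mul_le_mul_of_nonneg_right (hK₂ t) (by positivity))
        (mul_le_mul_of_nonneg_right (hK₁ t) (by positivity))
  refine ⟨max (K₁ * (2 ^ 4 * (C₂ * C₁))) (K₂ * (2 ^ 4 * (C₂ * C₁))
        + K₁ * (3 * (2 ^ 4 * (C₂ * C₁)) + 1 * (2 ^ 2 * (C₂ * (3 * C₁))))), fun n t => ?_⟩
  by_cases ht : t ∈ tsupport η
  · exact ⟨(main n t (hs ht)).1.mono (le_max_left _ _) le_rfl,
      (main n t (hs ht)).2.mono (le_max_right _ _) le_rfl⟩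
  · have h0 := notMem_tsupport_iff_eventuallyEq.1 ht
    have e1 : η t = 0 := h0.self_of_nhds
    have e2 : deriv η t = 0 := by rw [h0.deriv_eq]; simp
    have z := main n t₀ ht₀
    have z1 := z.1.const_mul ((contDiff_const.mul ((contDiff_dilate hρ n).mul
      (contDiff_heatPot _))) : ContDiff ℝ ∞ (truncPot ρ η c n t₀)) 0
    -- Off the support of `η` both functions vanish; written as a zero multiple they inherit a
    -- symbol bound.
    have f1 : truncPot ρ η c n t = fun x => 0 * truncPot ρ η c n t₀ x := by
      ext; simp [truncPot, e1]
    have f2 : truncSource ρ η c n t = fun x => 0 * truncPot ρ η c n t₀ x := by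
      ext; simp [truncSource, e1, e2]
    rw [f1, f2]
    have hp : 0 ≤ max (K₁ * (2 ^ 4 * (C₂ * C₁))) (K₂ * (2 ^ 4 * (C₂ * C₁))
        + K₁ * (3 * (2 ^ 4 * (C₂ * C₁)) + 1 * (2 ^ 2 * (C₂ * (3 * C₁))))) :=
      z.1.nonneg.trans (le_max_left _ _)
    exact ⟨z1.mono (by simpa using hp) le_rfl,
      (z1.of_le (by norm_num : 2 ≤ 4)).mono (by simpa using hp) le_rfl⟩

lemma contDiff_truncSource (hρ : ContDiff ℝ ∞ ρ) (hη : ContDiff ℝ ∞ η)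
    (hs : tsupport η ⊆ Iio c) (n : ℕ) :
    ContDiff ℝ ∞ (Function.uncurry (truncSource ρ η c n)) := by
  have hA := contDiff_truncPot hρ hη hs n
  have h : Function.uncurry (truncSource ρ η c n)
      = fun p => deriv (fun s => truncPot ρ η c n s p.2) p.1 + lap (truncPot ρ η c n p.1) p.2 := by
    ext ⟨t, z⟩
    exact (deriv_truncPot_add_lap hρ hη hs n t z).symm
  rw [h]
  refine (contDiff_uncurry_deriv hA).add ?_
  exact ContDiff.sum fun k _ => contDiff_uncurry_pd (contDiff_uncurry_pd hA k) k

/-- At a fixed point the sequence is eventually constant: where the cutoff is one near the point,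
the commutator vanishes. -/
lemma tendsto_sol_truncSource (h1 : ∀ x, ‖x‖ ≤ 1 → ρ x = 1) (j : Fin 3) (t : ℝ) (z : E3) :
    Tendsto (fun n => sol j (truncSource ρ η c n t) z) atTop
      (𝓝 (deriv η t • sol j (heatPot (Real.sqrt (c - t))⁻¹) z)) := by
  refine tendsto_const_nhds.congr' ?_
  filter_upwards [eventually_dilate_eq_one h1 z] with n hn
  set lam := (Real.sqrt (c - t))⁻¹
  have e1 : (fun y => dilate ρ n y * heatPot lam y) =ᶠ[𝓝 z] heatPot lam := by
    filter_upwards [hn] with y hy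
    simp [hy]
  have e2 : truncSource ρ η c n t =ᶠ[𝓝 z] fun y => deriv η t * heatPot lam y := by
    filter_upwards [hn, lap_congr_nhds e1] with y hy hl
    simp only [truncSource]
    rw [hl, hy]
    ring
  rw [(sol_congr_nhds e2 j).self_of_nhds, sol_const_mul (contDiff_heatPot lam)]

lemma tendsto_fderiv_sol_truncPot (h1 : ∀ x, ‖x‖ ≤ 1 → ρ x = 1) (j : Fin 3) (t : ℝ) (z : E3) :
    Tendsto (fun n => fderiv ℝ (sol j (truncPot ρ η c n t)) z) atTop
      (𝓝 (η t • fderiv ℝ (sol j (heatPot (Real.sqrt (c - t))⁻¹)) z)) := by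
  refine tendsto_const_nhds.congr' ?_
  filter_upwards [eventually_dilate_eq_one h1 z] with n hn
  set lam := (Real.sqrt (c - t))⁻¹
  have e2 : truncPot ρ η c n t =ᶠ[𝓝 z] fun y => η t * heatPot lam y := by
    filter_upwards [hn] with y hy
    simp [truncPot, hy, lam]
  rw [(sol_congr_nhds e2 j).fderiv_eq, sol_const_mul (contDiff_heatPot lam)]
  exact (fderiv_const_smul
    ((contDiff_sol (contDiff_heatPot lam) j).differentiable_of_smooth z) (η t)).symm

end Cutoff

/-! ### Estimates uniform in the centre and removal of the spatial cutoff -/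

lemma eLpNorm_le_of_norm_le_weight {F : Type*} [NormedAddCommGroup F] {f : E3 → F} {C : ℝ} {m : ℤ}
    (p : ℝ≥0∞) (x₀ : E3) (h : ∀ x, ‖f x‖ ≤ C * (1 + ‖x - x₀‖) ^ m) :
    eLpNorm f p volume ≤ ‖C‖ₑ * eLpNorm (fun x : E3 => (1 + ‖x‖) ^ m) p volume := by
  have hc : Continuous fun x : E3 => (1 + ‖x‖) ^ m :=
    (continuous_const.add continuous_norm).zpow₀ _ fun x =>
      Or.inl (by linarith [norm_nonneg x] : (0 : ℝ) < 1 + ‖x‖).ne'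
  calc eLpNorm f p volume
      ≤ eLpNorm (fun x => C • (1 + ‖x - x₀‖) ^ m) p volume :=
        eLpNorm_mono_real h
    _ = ‖C‖ₑ * eLpNorm ((fun x : E3 => (1 + ‖x‖) ^ m) ∘ fun x => x - x₀) p volume :=
        eLpNorm_const_smul C _ p volume
    _ = _ := by
        rw [eLpNorm_comp_measurePreserving hc.aestronglyMeasurable
          (measurePreserving_sub_right volume x₀)]

/-- Uniform estimates for the pairings with kernels dominated by the weights. -/
lemma exists_pairing_le (C : ℝ) : ∃ K : ℝ, 0 ≤ K ∧
    (∀ (b : E3 → E3) (x₀ : E3), AEStronglyMeasurable b →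
      (∀ x, ‖b x‖ ≤ C * (1 + ‖x - x₀‖) ^ (-3 : ℤ)) → ∀ u, |linPair b u| ≤ K * ‖u‖) ∧
    ∀ (B : E3 → E3 →L[ℝ] E3) (x₀ : E3), AEStronglyMeasurable B →
      (∀ x, ‖B x‖ ≤ C * (1 + ‖x - x₀‖) ^ (-4 : ℤ)) → ∀ u, |quadPair B u| ≤ K * ‖u‖ ^ 2 := by
  set W₁ := ‖C‖ₑ * eLpNorm (fun x : E3 => (1 + ‖x‖) ^ (-3 : ℤ)) threeHalves volume with hW₁
  set W₂ := ‖C‖ₑ * eLpNorm (fun x : E3 => (1 + ‖x‖) ^ (-4 : ℤ)) 3 volume with hW₂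
  have f₁ : W₁ ≠ ⊤ := ENNReal.mul_ne_top enorm_ne_top memLp_weight_three_halves.2.ne
  have f₂ : W₂ ≠ ⊤ := ENNReal.mul_ne_top enorm_ne_top memLp_weight_three.2.ne
  refine ⟨max W₁.toReal W₂.toReal, by positivity, fun b x₀ hb h u => ?_, fun B x₀ hB h u => ?_⟩
  · have h1 : ‖linPair b u‖ₑ ≤ ‖u‖ₑ * W₁ :=
      (enorm_linPair_le hb u).trans (by gcongr; exact eLpNorm_le_of_norm_le_weight _ x₀ h)
    have h2 := ENNReal.toReal_mono (ENNReal.mul_ne_top enorm_ne_top f₁) h1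
    rw [ENNReal.toReal_mul, toReal_enorm, toReal_enorm, mul_comm] at h2
    exact h2.trans (by gcongr; exact le_max_left _ _)
  · have h1 : ‖quadPair B u‖ₑ ≤ W₂ * ‖u‖ₑ * ‖u‖ₑ :=
      (enorm_quadPair_le hB u).trans (by gcongr; exact eLpNorm_le_of_norm_le_weight _ x₀ h)
    have h2 := ENNReal.toReal_mono (by finiteness) h1
    rw [ENNReal.toReal_mul, ENNReal.toReal_mul, toReal_enorm, toReal_enorm] at h2
    refine h2.trans ?_
    rw [mul_assoc, ← sq]
    gcongr
    exact le_max_right _ _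

lemma MemLinftyJ3.exists_norm_le {T : ℝ} {U : ℝ → L3} (hU : MemLinftyJ3 T U) :
    ∃ M : ℝ, 0 ≤ M ∧ ∀ᵐ t ∂(volume.restrict (Ioo 0 T)), ‖U t‖ ≤ M := by
  have h := hU.memLp.2
  rw [eLpNorm_exponent_top] at h
  refine ⟨(eLpNormEssSup U (volume.restrict (Ioo 0 T))).toReal, by positivity, ?_⟩
  filter_upwards [enorm_ae_le_eLpNormEssSup U (volume.restrict (Ioo 0 T))] with t ht
  have := ENNReal.toReal_mono h.ne ht
  rwa [toReal_enorm] at this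

lemma linPair_smul (a : ℝ) (b : E3 → E3) (u : L3) :
    linPair (fun x => a • b x) u = a * linPair b u := by
  simp only [linPair, inner_smul_right, integral_const_mul]

lemma quadPair_smul (a : ℝ) (B : E3 → E3 →L[ℝ] E3) (u : L3) :
    quadPair (fun x => a • B x) u = a * quadPair B u := by
  simp only [quadPair, _root_.smul_apply, real_inner_smul_left, integral_const_mul]

/-- The equation tested with the Oseen kernel, cut off in time. -/
lemma IsSolution.integral_oseen_eq_zero {T : ℝ} {U : ℝ → L3} (hU : IsSolution T U)
    (hm : StronglyMeasurable U) {b c : ℝ} (hb : 0 < b) (hbc : b < c) (hbT : b ≤ T) {η : ℝ → ℝ}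
    (hη : ContDiff ℝ ∞ η) (hηc : HasCompactSupport η) (hs : tsupport η ⊆ Ioo 0 b) (j : Fin 3)
    (x₀ : E3) :
    ∫ t in Ioo 0 T, (deriv η t * linPair (oseen j (Real.sqrt (c - t))⁻¹ x₀) (U t)
      + η t * quadPair (oseenGrad j (Real.sqrt (c - t))⁻¹ x₀) (U t)) = 0 := by
  obtain ⟨ρ, hρ, hρc, h1⟩ := exists_cutoff
  have hsc : tsupport η ⊆ Iio c := fun t ht => (hs ht).2.trans hbc
  obtain ⟨C, hC⟩ := exists_symbolBound_trunc hρ hρc hη hηc hb hbc hs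
  have hC0 : 0 ≤ C := (hC 0 0).1.nonneg
  obtain ⟨M, hM0, hM⟩ := hU.memLinftyJ3.exists_norm_le
  set f : ℕ → ℝ → E3 → E3 := fun n t x => sol j (truncSource ρ η c n t) (x - x₀) with hf
  set B : ℕ → ℝ → E3 → E3 →L[ℝ] E3 := fun n t x => fderiv ℝ (sol j (truncPot ρ η c n t)) (x - x₀)
    with hB
  have hsub : Continuous fun q : ℝ × E3 => (q.1, q.2 - x₀) := by fun_prop
  have cf : ∀ n, Continuous (Function.uncurry (f n)) := fun n => by
    have h : Continuous fun q : ℝ × E3 => sol j (truncSource ρ η c n q.1) q.2 :=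
      (contDiff_uncurry_sol (contDiff_truncSource hρ hη hsc n) j).continuous
    simpa only [hf, hB, Function.uncurry_def, Function.comp_def] using h.comp hsub
  have cB : ∀ n, Continuous (Function.uncurry (B n)) := fun n => by
    have h : Continuous fun q : ℝ × E3 => fderiv ℝ (sol j (truncPot ρ η c n q.1)) q.2 :=
      continuous_uncurry_fderiv (contDiff_uncurry_sol (contDiff_truncPot hρ hη hsc n) j)
    simpa only [hf, hB, Function.uncurry_def, Function.comp_def] using h.comp hsub
  have mf : ∀ n t, AEStronglyMeasurable (f n t) := fun n t =>
    ((cf n).comp (Continuous.prodMk_right t)).aestronglyMeasurable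
  have mB : ∀ n t, AEStronglyMeasurable (B n t) := fun n t =>
    ((cB n).comp (Continuous.prodMk_right t)).aestronglyMeasurable
  -- The factor 6 is enlarged to 18, the one for gradients, so that a single constant serves both
  -- kernels.
  have bf : ∀ n t x, ‖f n t x‖ ≤ 18 * C * (1 + ‖x - x₀‖) ^ (-3 : ℤ) := fun n t x => by
    refine ((hC n t).2.norm_sol_le j (x - x₀)).trans ?_
    gcongr
    · norm_num
    · simp
    · norm_num
  have bB : ∀ n t x, ‖B n t x‖ ≤ 18 * C * (1 + ‖x - x₀‖) ^ (-4 : ℤ) := fun n t x =>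
    (hC n t).1.norm_fderiv_sol_le (n := 1) (contDiff_slice (contDiff_truncPot hρ hη hsc n) t) j
      (x - x₀)
  obtain ⟨K, hK0, hK₁, hK₂⟩ := exists_pairing_le (18 * C)
  have hzero : ∀ n, ∫ t in Ioo 0 T, (linPair (f n t) (U t) + quadPair (B n t) (U t)) = 0 := by
    intro n
    have hA := contDiff_truncPot hρ hη hsc n
    have htest := isSpaceTimeTestField_sol (T := T) hA
      (IsCompact.of_isClosed_subset (hηc.prod (hasCompactSupport_dilate hρc n))
        (isClosed_tsupport _) (tsupport_truncPot_subset n))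
      (fun p hp => ⟨⟨(hs (tsupport_truncPot_subset n hp).1).1,
        (hs (tsupport_truncPot_subset n hp).1).2.trans_le hbT⟩, mem_univ _⟩) j x₀
    refine Eq.trans (integral_congr_ae (Eventually.of_forall fun t => ?_))
      (hU.satisfiesWeakNS _ htest)
    simp only [linPair, quadPair, hf, hB, fderiv_comp_sub, deriv_add_laplacian_sol hA,
      deriv_truncPot_add_lap hρ hη hsc]
  -- The bounds are uniform in `n` and `t`, so a constant dominates on the finite interval.
  have hlim := tendsto_integral_of_dominated_convergence (μ := volume.restrict (Ioo 0 T))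
    (F := fun n t => linPair (f n t) (U t) + quadPair (B n t) (U t))
    (f := fun t => deriv η t * linPair (oseen j (Real.sqrt (c - t))⁻¹ x₀) (U t)
      + η t * quadPair (oseenGrad j (Real.sqrt (c - t))⁻¹ x₀) (U t))
    (fun _ => K * M + K * M ^ 2) (fun n => ?_) (integrable_const _) (fun n => ?_) ?_
  · simp only [hzero] at hlim
    exact tendsto_nhds_unique hlim tendsto_const_nhds
  · have h1 := (stronglyMeasurable_linPair (cf n).stronglyMeasurable fun t =>
      memLp_of_norm_le_weight memLp_weight_three_halves (mf n t) x₀ (bf n t)).comp_measurable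
        (hm.measurable.prodMk measurable_id)
    have h2 := (stronglyMeasurable_quadPair (cB n).stronglyMeasurable fun t =>
      memLp_of_norm_le_weight memLp_weight_three (mB n t) x₀ (bB n t)).comp_measurable
        (hm.measurable.prodMk measurable_id)
    exact (h1.add h2).aestronglyMeasurable
  · filter_upwards [hM] with t ht
    refine (norm_add_le _ _).trans (add_le_add ?_ ?_)
    · exact (hK₁ _ x₀ (mf n t) (bf n t) (U t)).trans (by gcongr)
    · exact (hK₂ _ x₀ (mB n t) (bB n t) (U t)).trans (by gcongr)
  · refine Eventually.of_forall fun t => Tendsto.add ?_ ?_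
    · rw [← linPair_smul]
      exact tendsto_linPair (Eventually.of_forall fun n => mf n t)
        ((MemLp.comp_sub memLp_weight_three_halves x₀).const_mul (18 * C))
        (Eventually.of_forall fun n => bf n t)
        (fun x => tendsto_sol_truncSource h1 j t (x - x₀)) _
    · rw [← quadPair_smul]
      exact tendsto_quadPair (Eventually.of_forall fun n => mB n t)
        ((MemLp.comp_sub memLp_weight_three x₀).const_mul (18 * C))
        (Eventually.of_forall fun n => bB n t)
        (fun x => tendsto_fderiv_sol_truncPot h1 j t (x - x₀)) _

/-! ### The lemma of du Bois-Reymond -/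

/-- A primitive of a compactly supported smooth function of mean zero is smooth and compactly
supported in the same interval. -/
lemma exists_primitive_tsupport_subset {a b : ℝ} (hab : a < b) {ψ : ℝ → ℝ} (hψ : ContDiff ℝ ∞ ψ)
    (hc : HasCompactSupport ψ) (hs : tsupport ψ ⊆ Ioo a b) (h0 : ∫ t, ψ t = 0) :
    ∃ η : ℝ → ℝ, ContDiff ℝ ∞ η ∧ HasCompactSupport η ∧ tsupport η ⊆ Ioo a b ∧ deriv η = ψ := by
  obtain ⟨α, β, hα, hβ, hsub⟩ : ∃ α β, a < α ∧ β < b ∧ tsupport ψ ⊆ Icc α β := by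
    rcases (tsupport ψ).eq_empty_or_nonempty with h | h
    · exact ⟨(a + b) / 2, (a + b) / 2, by linarith, by linarith, by simp [h]⟩
    · refine ⟨sInf (tsupport ψ), sSup (tsupport ψ), (hs (hc.isCompact.sInf_mem h)).1,
        (hs (hc.isCompact.sSup_mem h)).2, fun t ht => ⟨?_, ?_⟩⟩
      · exact csInf_le hc.isCompact.bddBelow ht
      · exact le_csSup hc.isCompact.bddAbove ht
  have hψ0 : ∀ t, t ∉ Icc α β → ψ t = 0 := fun t ht =>
    image_eq_zero_of_notMem_tsupport fun h => ht (hsub h)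
  have hd : ∀ t, HasDerivAt (fun t => ∫ s in a..t, ψ s) (ψ t) t := fun t =>
    (hψ.continuous.integral_hasStrictDerivAt a t).hasDerivAt
  have hderiv : deriv (fun t => ∫ s in a..t, ψ s) = ψ := funext fun t => (hd t).deriv
  have hsupp : ∀ t, t ∉ Icc α β → ∫ s in a..t, ψ s = 0 := by
    intro t ht
    rcases lt_or_ge t α with h | h
    · refine (intervalIntegral.integral_congr (g := fun _ => 0) fun s hs => hψ0 s fun h' => ?_).trans
        (by simp)
      have := hs.2
      have h3 : max a t < α := max_lt hα h
      exact absurd (h'.1.trans this) (not_le.2 h3)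
    · have h2 : β < t := by
        by_contra! h'
        exact ht ⟨h, h'⟩
      rcases le_or_gt α β with h3 | h3
      -- To the right of the support the primitive equals the full integral, which is zero.
      · rw [intervalIntegral.integral_of_le (by linarith), ← h0]
        refine setIntegral_eq_integral_of_forall_compl_eq_zero fun s hs => hψ0 s fun h' => hs ?_
        exact ⟨hα.trans_le h'.1, h'.2.trans h2.le⟩
      · have : ψ = fun _ => 0 := funext fun s => hψ0 s (by simp [h3])
        simp [this]
  have hts : tsupport (fun t => ∫ s in a..t, ψ s) ⊆ Icc α β :=
    closure_minimal (fun t ht => by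
      by_contra h
      exact ht (hsupp t h)) isClosed_Icc
  refine ⟨fun t => ∫ s in a..t, ψ s, ?_, ?_, hts.trans (Icc_subset_Ioo hα hβ), hderiv⟩
  · rw [contDiff_infty_iff_deriv]
    refine ⟨fun t => (hd t).differentiableAt, ?_⟩
    rw [hderiv]
    exact hψ
  · exact HasCompactSupport.intro isCompact_Icc hsupp

/-- If `g' = f` in the sense of distributions on `(0, b)`, then `g` is a primitive of `f`. -/
lemma exists_ae_eq_add_integral {b : ℝ} (hb : 0 < b) {f g : ℝ → ℝ}
    (hf : IntegrableOn f (Ioo 0 b)) (hg : IntegrableOn g (Ioo 0 b))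
    (h : ∀ η : ℝ → ℝ, ContDiff ℝ ∞ η → HasCompactSupport η → tsupport η ⊆ Ioo 0 b →
      ∫ t in Ioo 0 b, (deriv η t * g t + η t * f t) = 0) :
    ∃ k, ∀ᵐ t ∂(volume.restrict (Ioo 0 b)), g t = k + ∫ s in (0 : ℝ)..t, f s := by
  have hfi : IntervalIntegrable f volume 0 b :=
    (intervalIntegrable_iff_integrableOn_Ioo_of_le hb.le).2 hf
  set I : ℝ → ℝ := fun t => ∫ s in (0 : ℝ)..t, f s with hI
  have hIac : AbsolutelyContinuousOnInterval I 0 b :=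
    hfi.absolutelyContinuousOnInterval_intervalIntegral (by simp [hb.le])
  have hIi : IntegrableOn I (Ioo 0 b) := by
    have := hIac.continuousOn
    rw [uIcc_of_le hb.le] at this
    exact (this.integrableOn_compact isCompact_Icc).mono_set Ioo_subset_Icc_self
  have hId : ∀ᵐ t ∂volume, t ∈ Ioo 0 b → deriv I t = f t := by
    filter_upwards [hfi.ae_hasDerivAt_integral] with t ht htm
    have htm' : t ∈ uIcc 0 b := by
      rw [uIcc_of_le hb.le]
      exact Ioo_subset_Icc_self htm
    exact (ht htm' 0 (by simp [hb.le])).deriv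
  -- Integration by parts moves `f` into its primitive `I`, so that `g - I` has distributional
  -- derivative zero.
  have key : ∀ η : ℝ → ℝ, ContDiff ℝ ∞ η → HasCompactSupport η → tsupport η ⊆ Ioo 0 b →
      ∫ t in Ioo 0 b, deriv η t * (g t - I t) = 0 := by
    intro η hη hηc hs
    have hηac : AbsolutelyContinuousOnInterval η 0 b :=
      ContDiffOn.absolutelyContinuousOnInterval (hη.of_le (by simp)).contDiffOn
    have h1 := hηac.integral_deriv_mul_eq_sub hIac
    have e0 : η 0 = 0 := image_eq_zero_of_notMem_tsupport fun h => lt_irrefl _ (hs h).1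
    have eb : η b = 0 := image_eq_zero_of_notMem_tsupport fun h => lt_irrefl _ (hs h).2
    rw [e0, eb, zero_mul, zero_mul, sub_zero, intervalIntegral.integral_of_le hb.le,
      MeasureTheory.integral_Ioc_eq_integral_Ioo] at h1
    have h2 : ∫ t in Ioo 0 b, (deriv η t * I t + η t * f t) = 0 := by
      refine Eq.trans (setIntegral_congr_ae measurableSet_Ioo ?_) h1
      filter_upwards [hId] with t ht htm
      rw [ht htm]
    obtain ⟨K₁, hK₁⟩ := hη.continuous.bounded_above_of_compact_support hηc
    obtain ⟨K₂, hK₂⟩ := (hη.continuous_deriv (by simp)).bounded_above_of_compact_support hηc.deriv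
    have m₁ : AEStronglyMeasurable η (volume.restrict (Ioo 0 b)) :=
      hη.continuous.aestronglyMeasurable
    have m₂ : AEStronglyMeasurable (deriv η) (volume.restrict (Ioo 0 b)) :=
      (hη.continuous_deriv (by simp)).aestronglyMeasurable
    have i₁ : IntegrableOn (fun t => deriv η t * g t) (Ioo 0 b) :=
      hg.bdd_mul m₂ (Eventually.of_forall hK₂)
    have i₂ : IntegrableOn (fun t => η t * f t) (Ioo 0 b) :=
      hf.bdd_mul m₁ (Eventually.of_forall hK₁)
    have i₃ : IntegrableOn (fun t => deriv η t * I t) (Ioo 0 b) :=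
      hIi.bdd_mul m₂ (Eventually.of_forall hK₂)
    have h3 := h η hη hηc hs
    rw [integral_add i₁ i₂] at h3
    rw [integral_add i₃ i₂] at h2
    simp only [mul_sub]
    rw [integral_sub i₁ i₃]
    linarith
  -- Subtracting `∫ ζ` times a fixed bump of integral one from a test function `ζ` leaves mean zero,
  -- hence the derivative of an admissible `η`. The constant is the mean of `g - I` against this
  -- bump.
  let φ : ContDiffBump (b / 2) := ⟨b / 8, b / 4, by positivity, by linarith⟩
  set η₀ := φ.normed volume with hη₀
  have hη₀s : tsupport η₀ ⊆ Ioo 0 b := by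
    rw [φ.tsupport_normed_eq, Real.closedBall_eq_Icc]
    exact Icc_subset_Ioo (by change 0 < b / 2 - b / 4; linarith)
      (by change b / 2 + b / 4 < b; linarith)
  have hη₀c : HasCompactSupport η₀ := φ.hasCompactSupport_normed
  have hη₀d : ContDiff ℝ ∞ η₀ := φ.contDiff_normed
  set k := ∫ t in Ioo 0 b, η₀ t * (g t - I t) with hk
  have hGi : IntegrableOn (fun t => g t - I t) (Ioo 0 b) := hg.sub hIi
  refine ⟨k, ?_⟩
  have hz : ∀ᵐ t ∂volume, t ∈ Ioo 0 b → g t - I t - k = 0 := by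
    refine isOpen_Ioo.ae_eq_zero_of_integral_contDiff_smul_eq_zero
      (hGi.sub (integrable_const k)).locallyIntegrableOn fun ζ hζ hζc hζs => ?_
    have hsm : HasCompactSupport (fun t => ζ t - (∫ s, ζ s) * η₀ t) :=
      hζc.sub hη₀c.mul_left
    have hψs : tsupport (fun t => ζ t - (∫ s, ζ s) * η₀ t) ⊆ Ioo 0 b := by
      refine (closure_minimal (t := tsupport ζ ∪ tsupport η₀) (fun t ht => ?_)
        ((isClosed_tsupport _).union (isClosed_tsupport _))).trans (union_subset hζs hη₀s)
      by_contra h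
      rw [mem_union, not_or] at h
      refine ht ?_
      simp [image_eq_zero_of_notMem_tsupport h.1, image_eq_zero_of_notMem_tsupport h.2]
    have iζ : Integrable ζ := hζ.continuous.integrable_of_hasCompactSupport hζc
    have iη : Integrable η₀ := hη₀d.continuous.integrable_of_hasCompactSupport hη₀c
    obtain ⟨η, e1, e2, e3, e4⟩ := exists_primitive_tsupport_subset hb
      (hζ.sub (contDiff_const.mul hη₀d)) hsm hψs (by
        rw [integral_sub iζ (iη.const_mul _), integral_const_mul, φ.integral_normed]
        ring)
    have h5 := key η e1 e2 e3
    rw [e4] at h5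
    obtain ⟨K₁, hK₁⟩ := hζ.continuous.bounded_above_of_compact_support hζc
    obtain ⟨K₂, hK₂⟩ := hη₀d.continuous.bounded_above_of_compact_support hη₀c
    have i₁ : IntegrableOn (fun t => ζ t * (g t - I t)) (Ioo 0 b) :=
      hGi.bdd_mul hζ.continuous.aestronglyMeasurable (Eventually.of_forall hK₁)
    have i₂ : IntegrableOn (fun t => η₀ t * (g t - I t)) (Ioo 0 b) :=
      hGi.bdd_mul hη₀d.continuous.aestronglyMeasurable (Eventually.of_forall hK₂)
    simp only [sub_mul, mul_assoc] at h5
    rw [integral_sub i₁ (i₂.const_mul _), integral_const_mul, ← hk] at h5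
    have e5 : ∫ t, ζ t • (g t - I t - k) = ∫ t in Ioo 0 b, (ζ t * (g t - I t) - k * ζ t) := by
      rw [← setIntegral_eq_integral_of_forall_compl_eq_zero (s := Ioo 0 b)]
      · refine integral_congr_ae (Eventually.of_forall fun t => ?_)
        simp only [smul_eq_mul]
        ring
      · intro t ht
        rw [image_eq_zero_of_notMem_tsupport fun h => ht (hζs h), zero_smul]
    rw [e5, integral_sub i₁ (iζ.integrableOn.const_mul k), integral_const_mul,
      setIntegral_eq_integral_of_forall_compl_eq_zero (s := Ioo 0 b) (f := ζ) fun t ht =>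
        image_eq_zero_of_notMem_tsupport fun h => ht (hζs h)]
    linarith
  rw [ae_restrict_iff' measurableSet_Ioo]
  filter_upwards [hz] with t ht htm
  linarith [ht htm]

/-! ### The filter of essential limits at time zero -/

/-- A null set contains no interval `(0, u)`. This makes limits along the filter unique. -/
instance neBot_aeZeroRight : NeBot aeZeroRight := by
  rw [aeZeroRight, inf_neBot_iff]
  intro s hs t ht
  obtain ⟨u, hu, hsub⟩ := mem_nhdsGT_iff_exists_Ioo_subset.1 hs
  by_contra h
  rw [not_nonempty_iff_eq_empty, ← disjoint_iff_inter_eq_empty] at h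
  have h1 : volume (Ioo 0 u) = 0 :=
    measure_mono_null (hsub.trans h.subset_compl_right) ht
  rw [Real.volume_Ioo, ENNReal.ofReal_eq_zero] at h1
  rw [mem_Ioi] at hu
  linarith

lemma eventually_aeZeroRight {b : ℝ} (hb : 0 < b) {p : ℝ → Prop}
    (h : ∀ᵐ t ∂(volume.restrict (Ioo 0 b)), p t) : ∀ᶠ t in aeZeroRight, p t := by
  rw [ae_restrict_iff' measurableSet_Ioo] at h
  filter_upwards [mem_inf_of_left (Ioo_mem_nhdsGT hb), mem_inf_of_right h] with t h1 h2 using h2 h1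

lemma aeZeroRight_le : aeZeroRight ≤ 𝓝[>] 0 := inf_le_left

/-! ### The initial condition tested with the Oseen kernel -/

lemma abs_linPair_sub_le {b b' : E3 → E3} (hb : MemLp b threeHalves) (hb' : MemLp b' threeHalves)
    (u : L3) : |linPair b u - linPair b' u|
      ≤ ‖u‖ * (eLpNorm (fun x => b x - b' x) threeHalves volume).toReal := by
  have h1 : linPair b u - linPair b' u = linPair (fun x => b x - b' x) u := by
    simp only [linPair, inner_sub_right]
    rw [integral_sub (integrable_inner hb u) (integrable_inner hb' u)]
  have h2 := enorm_linPair_le (hb.sub hb').1 u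
  have h3 := ENNReal.toReal_mono (ENNReal.mul_ne_top enorm_ne_top (hb.sub hb').2.ne) h2
  rw [ENNReal.toReal_mul, toReal_enorm, toReal_enorm] at h3
  rw [h1]
  exact h3

/-- For bounded families weak convergence passes to strong limits of the test functions: a
three-term estimate in which the outer terms are small uniformly in `s`. -/
lemma tendsto_linPair_of_tendsto_eLpNorm {ι : Type*} {l : Filter ι} {u : ι → L3} {u₀ : L3} {M : ℝ}
    (hM : ∀ᶠ s in l, ‖u s‖ ≤ M) {b : E3 → E3} (hb : MemLp b threeHalves) {ψ : ℕ → E3 → E3}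
    (hψ : ∀ n, MemLp (ψ n) threeHalves)
    (hlim : Tendsto (fun n => eLpNorm (fun x => ψ n x - b x) threeHalves volume) atTop (𝓝 0))
    (h : ∀ n, Tendsto (fun s => linPair (ψ n) (u s)) l (𝓝 (linPair (ψ n) u₀))) :
    Tendsto (fun s => linPair b (u s)) l (𝓝 (linPair b u₀)) := by
  have hlim' : Tendsto (fun n => (|M| + ‖u₀‖)
      * (eLpNorm (fun x => ψ n x - b x) threeHalves volume).toReal) atTop (𝓝 0) := by
    have := ((ENNReal.continuousAt_toReal ENNReal.zero_ne_top).tendsto.comp hlim).const_mul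
      (|M| + ‖u₀‖)
    simpa using this
  rw [Metric.tendsto_nhds]
  intro ε hε
  obtain ⟨n, hn⟩ := (hlim'.eventually (gt_mem_nhds (half_pos hε))).exists
  filter_upwards [hM, Metric.tendsto_nhds.1 (h n) (ε / 2) (half_pos hε)] with s h1 h2
  rw [Real.dist_eq] at h2 ⊢
  have h3 := abs_linPair_sub_le (hψ n) hb (u s)
  have h4 := abs_linPair_sub_le (hψ n) hb u₀
  set N := (eLpNorm (fun x => ψ n x - b x) threeHalves volume).toReal
  have hN : 0 ≤ N := ENNReal.toReal_nonneg
  have h5 : ‖u s‖ * N ≤ |M| * N := by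
    gcongr
    exact h1.trans (le_abs_self M)
  rw [abs_lt] at h2 ⊢
  rw [abs_le] at h3 h4
  constructor <;> nlinarith

lemma continuous_oseen_lam (j : Fin 3) (x₀ y : E3) :
    Continuous fun lam => oseen j lam x₀ y := by
  have h : Continuous fun lam : ℝ => ((lam, x₀), y) := by fun_prop
  simpa only [Function.comp_def] using (continuous_oseen j).comp h

lemma continuous_oseen_space (j : Fin 3) (lam : ℝ) (x₀ : E3) :
    Continuous (oseen j lam x₀) := by
  have h : Continuous fun y : E3 => ((lam, x₀), y) := by fun_prop
  simpa only [Function.comp_def] using (continuous_oseen j).comp h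

lemma continuous_oseenGrad_space (j : Fin 3) (lam : ℝ) (x₀ : E3) :
    Continuous (oseenGrad j lam x₀) := by
  have h : Continuous fun y : E3 => ((lam, x₀), y) := by fun_prop
  simpa only [Function.comp_def] using (continuous_oseenGrad j).comp h

/-- The weak initial condition extends from test fields to the Oseen kernel. -/
lemma tendsto_linPair_oseen_of_testField {U : ℝ → L3} {U₀ : L3} {M : ℝ}
    (hM : ∀ᶠ s in aeZeroRight, ‖U s‖ ≤ M)
    (h : ∀ ψ : E3 → E3, IsTestField ψ →
      Tendsto (fun t : ℝ => ∫ x, ⟪U t x, ψ x⟫_ℝ) aeZeroRight (𝓝 (∫ x, ⟪U₀ x, ψ x⟫_ℝ)))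
    (j : Fin 3) (lam : ℝ) (x₀ : E3) :
    Tendsto (fun s => linPair (oseen j lam x₀) (U s)) aeZeroRight
      (𝓝 (linPair (oseen j lam x₀) U₀)) := by
  obtain ⟨ρ, hρ, hρc, h1⟩ := exists_cutoff
  obtain ⟨C₁, hC₁⟩ := exists_symbolBound_heatPot_single 2 lam
  obtain ⟨C₂, hC₂⟩ := exists_symbolBound_dilate hρ hρc 2
  set a : ℕ → E3 → ℝ := fun n y => dilate ρ n y * heatPot lam y with ha
  have has : ∀ n, ContDiff ℝ ∞ (a n) := fun n => (contDiff_dilate hρ n).mul (contDiff_heatPot lam)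
  have hac : ∀ n, HasCompactSupport (a n) := fun n => (hasCompactSupport_dilate hρc n).mul_right
  have hψ : ∀ n, IsTestField fun y => sol j (a n) (y - x₀) := fun n =>
    isTestField_sol (has n) (hac n) j x₀
  have hbd : ∀ n x, ‖sol j (a n) (x - x₀)‖
      ≤ max (6 * (2 ^ 2 * (C₂ * C₁))) (6 * C₁) * (1 + ‖x - x₀‖) ^ (-3 : ℤ) := fun n x => by
    refine (((hC₂ n).mul (contDiff_dilate hρ n) (contDiff_heatPot lam) hC₁).norm_sol_le
      (n := 0) j (x - x₀)).trans ?_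
    refine mul_le_mul_of_nonneg_right (le_max_left _ _) (zpow_weight_pos _ _).le
  have hbd' : ∀ x, ‖oseen j lam x₀ x‖
      ≤ max (6 * (2 ^ 2 * (C₂ * C₁))) (6 * C₁) * (1 + ‖x - x₀‖) ^ (-3 : ℤ) := fun x => by
    refine (hC₁.norm_sol_le (n := 0) j (x - x₀)).trans ?_
    exact mul_le_mul_of_nonneg_right (le_max_right _ _) (zpow_weight_pos _ _).le
  refine tendsto_linPair_of_tendsto_eLpNorm (ψ := fun n y => sol j (a n) (y - x₀)) hM
    (memLp_oseen j lam x₀)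
    (fun n => memLp_of_norm_le_weight memLp_weight_three_halves
      (hψ n).contDiff.continuous.aestronglyMeasurable x₀ (hbd n)) ?_ fun n => h _ (hψ n)
  refine tendsto_eLpNorm_sub_of_dominated (by norm_num)
    (Eventually.of_forall fun n => (hψ n).contDiff.continuous.stronglyMeasurable)
    (continuous_oseen_space j lam x₀).stronglyMeasurable
    ((MemLp.comp_sub memLp_weight_three_halves x₀).const_mul _) (Eventually.of_forall hbd) hbd'
    fun x => ?_
  refine tendsto_const_nhds.congr' ?_
  filter_upwards [eventually_dilate_eq_one h1 (x - x₀)] with n hn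
  have e : a n =ᶠ[𝓝 (x - x₀)] heatPot lam := by
    filter_upwards [hn] with y hy
    simp [ha, hy]
  exact (sol_congr_nhds e j).self_of_nhds.symm

/-- Bounds for the Oseen kernel which are uniform in time up to a positive distance of the
singularity. -/
lemma exists_oseen_le (j : Fin 3) {c₀ : ℝ} (hc₀ : 0 < c₀) (c₁ : ℝ) :
    ∃ C, ∀ lam ∈ Icc c₀ c₁, ∀ x₀ x, ‖oseen j lam x₀ x‖ ≤ C * (1 + ‖x - x₀‖) ^ (-3 : ℤ) ∧
      ‖oseenGrad j lam x₀ x‖ ≤ C * (1 + ‖x - x₀‖) ^ (-4 : ℤ) := by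
  obtain ⟨C, hC⟩ := exists_symbolBound_heatPot 3 hc₀ c₁
  refine ⟨18 * C, fun lam hl x₀ x => ⟨?_, ?_⟩⟩
  · refine ((hC ⟨lam, hl⟩).norm_sol_le (n := 1) j (x - x₀)).trans ?_
    have := (hC ⟨lam, hl⟩).nonneg
    refine mul_le_mul_of_nonneg_right (by linarith) (zpow_weight_pos _ _).le
  · exact (hC ⟨lam, hl⟩).norm_fderiv_sol_le (n := 0) (contDiff_heatPot lam) j (x - x₀)

/-- Both factors move with `s`: the kernel converges strongly in L^{3/2}, while `U s` stays bounded
in L³ and converges weakly. -/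
lemma tendsto_linPair_oseen_zero {T : ℝ} (hT : 0 < T) {U : ℝ → L3} {U₀ : L3}
    (hU : MemLinftyJ3 T U)
    (h : ∀ ψ : E3 → E3, IsTestField ψ →
      Tendsto (fun t : ℝ => ∫ x, ⟪U t x, ψ x⟫_ℝ) aeZeroRight (𝓝 (∫ x, ⟪U₀ x, ψ x⟫_ℝ)))
    (j : Fin 3) {c : ℝ} (hc : 0 < c) (x₀ : E3) :
    Tendsto (fun s => linPair (oseen j (Real.sqrt (c - s))⁻¹ x₀) (U s)) aeZeroRight
      (𝓝 (linPair (oseen j (Real.sqrt c)⁻¹ x₀) U₀)) := by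
  obtain ⟨M, hM0, hM⟩ := hU.exists_norm_le
  have hM' := eventually_aeZeroRight hT hM
  have h1 := tendsto_linPair_oseen_of_testField hM' h j (Real.sqrt c)⁻¹ x₀
  obtain ⟨C, hC⟩ := exists_oseen_le j (inv_pos.2 (Real.sqrt_pos.2 hc)) (Real.sqrt (c - c / 2))⁻¹
  have hlam : Tendsto (fun s => (Real.sqrt (c - s))⁻¹) (𝓝[>] 0) (𝓝 (Real.sqrt c)⁻¹) := by
    have : ContinuousAt (fun s => (Real.sqrt (c - s))⁻¹) 0 :=
      (hasDerivAt_invSqrt (by simpa using hc)).continuousAt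
    have := this.tendsto.mono_left (nhdsWithin_le_nhds (s := Ioi 0))
    simpa using this
  have h2 : Tendsto (fun s => eLpNorm (fun x => oseen j (Real.sqrt (c - s))⁻¹ x₀ x
      - oseen j (Real.sqrt c)⁻¹ x₀ x) threeHalves volume) (𝓝[>] 0) (𝓝 0) := by
    refine tendsto_eLpNorm_sub_of_dominated (by norm_num)
      (Eventually.of_forall fun s => (continuous_oseen_space j _ x₀).stronglyMeasurable)
      (continuous_oseen_space j _ x₀).stronglyMeasurable
      ((MemLp.comp_sub memLp_weight_three_halves x₀).const_mul C) ?_ (fun x => ?_) fun x => ?_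
    · filter_upwards [Ioo_mem_nhdsGT (half_pos hc)] with s hs x
      exact (hC _ (invSqrt_mem_Icc (by linarith) hs) x₀ x).1
    · refine (hC _ ⟨le_rfl, ?_⟩ x₀ x).1
      have : 0 < Real.sqrt (c - c / 2) := Real.sqrt_pos.2 (by linarith)
      gcongr
      linarith
    · exact ((continuous_oseen_lam j x₀ x).tendsto _).comp hlam
  have h3 : Tendsto (fun s => M * (eLpNorm (fun x => oseen j (Real.sqrt (c - s))⁻¹ x₀ x
      - oseen j (Real.sqrt c)⁻¹ x₀ x) threeHalves volume).toReal) aeZeroRight (𝓝 0) := by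
    have := (((ENNReal.continuousAt_toReal ENNReal.zero_ne_top).tendsto.comp h2).const_mul
      M).mono_left aeZeroRight_le
    simpa using this
  have h4 : Tendsto (fun s => linPair (oseen j (Real.sqrt (c - s))⁻¹ x₀) (U s)
      - linPair (oseen j (Real.sqrt c)⁻¹ x₀) (U s)) aeZeroRight (𝓝 0) := by
    refine squeeze_zero_norm' ?_ h3
    filter_upwards [hM'] with s hs
    refine (abs_linPair_sub_le (memLp_oseen j _ x₀) (memLp_oseen j _ x₀) (U s)).trans ?_
    gcongr
  simpa using h4.add h1

/-! ### The integrated equation -/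

lemma stronglyMeasurable_linPair_oseen (j : Fin 3) :
    StronglyMeasurable fun q : L3 × (ℝ × E3) => linPair (oseen j q.2.1 q.2.2) q.1 :=
  stronglyMeasurable_linPair (b := fun p : ℝ × E3 => oseen j p.1 p.2)
    (continuous_oseen j).stronglyMeasurable fun p => memLp_oseen j p.1 p.2

lemma stronglyMeasurable_quadPair_oseenGrad (j : Fin 3) :
    StronglyMeasurable fun q : L3 × (ℝ × E3) => quadPair (oseenGrad j q.2.1 q.2.2) q.1 :=
  stronglyMeasurable_quadPair (b := fun p : ℝ × E3 => oseenGrad j p.1 p.2)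
    (continuous_oseenGrad j).stronglyMeasurable fun p => memLp_oseenGrad j p.1 p.2

lemma measurable_invSqrt (c : ℝ) : Measurable fun s : ℝ => (Real.sqrt (c - s))⁻¹ :=
  ((measurable_const.sub measurable_id).sqrt).inv

lemma integrableOn_pairings {T : ℝ} {U : ℝ → L3} (hU : MemLinftyJ3 T U) (hm : StronglyMeasurable U)
    {b c : ℝ} (hb : 0 < b) (hbc : b < c) (hbT : b ≤ T) (j : Fin 3) (x₀ : E3) :
    IntegrableOn (fun t => linPair (oseen j (Real.sqrt (c - t))⁻¹ x₀) (U t)) (Ioo 0 b) ∧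
      IntegrableOn (fun t => quadPair (oseenGrad j (Real.sqrt (c - t))⁻¹ x₀) (U t)) (Ioo 0 b) := by
  obtain ⟨M, hM0, hM⟩ := hU.exists_norm_le
  have hM' := ae_restrict_of_ae_restrict_of_subset (Ioo_subset_Ioo_right hbT) hM
  obtain ⟨C, hC⟩ := exists_oseen_le j (inv_pos.2 (Real.sqrt_pos.2 (hb.trans hbc)))
    (Real.sqrt (c - b))⁻¹
  obtain ⟨K, hK0, hK₁, hK₂⟩ := exists_pairing_le C
  have hmeas : Measurable fun t => (U t, (Real.sqrt (c - t))⁻¹, x₀) :=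
    hm.measurable.prodMk ((measurable_invSqrt c).prodMk measurable_const)
  constructor
  · refine Integrable.of_bound (C := K * M)
      ((stronglyMeasurable_linPair_oseen j).comp_measurable hmeas).aestronglyMeasurable ?_
    filter_upwards [hM', ae_restrict_mem measurableSet_Ioo] with t ht htm
    exact (hK₁ _ x₀ (continuous_oseen_space j _ x₀).aestronglyMeasurable
      (fun x => (hC _ (invSqrt_mem_Icc hbc htm) x₀ x).1) (U t)).trans (by gcongr)
  · refine Integrable.of_bound (C := K * M ^ 2)
      ((stronglyMeasurable_quadPair_oseenGrad j).comp_measurable hmeas).aestronglyMeasurable ?_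
    filter_upwards [hM', ae_restrict_mem measurableSet_Ioo] with t ht htm
    exact (hK₂ _ x₀ (continuous_oseenGrad_space j _ x₀).aestronglyMeasurable
      (fun x => (hC _ (invSqrt_mem_Icc hbc htm) x₀ x).2) (U t)).trans (by gcongr)

/-- The lemma of du Bois-Reymond leaves a free constant. As `t → 0` the integral vanishes, so the
constant is the limit of the left side, given by the initial condition. -/
lemma IsSolution.linPair_oseen_eq {T : ℝ} {U : ℝ → L3} (hU : IsSolution T U)
    (hm : StronglyMeasurable U) {U₀ : L3}
    (h : ∀ ψ : E3 → E3, IsTestField ψ →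
      Tendsto (fun t : ℝ => ∫ x, ⟪U t x, ψ x⟫_ℝ) aeZeroRight (𝓝 (∫ x, ⟪U₀ x, ψ x⟫_ℝ)))
    {b c : ℝ} (hb : 0 < b) (hbc : b < c) (hbT : b ≤ T) (j : Fin 3) (x₀ : E3) :
    ∀ᵐ t ∂(volume.restrict (Ioo 0 b)), linPair (oseen j (Real.sqrt (c - t))⁻¹ x₀) (U t)
      = linPair (oseen j (Real.sqrt c)⁻¹ x₀) U₀
        + ∫ s in (0 : ℝ)..t, quadPair (oseenGrad j (Real.sqrt (c - s))⁻¹ x₀) (U s) := by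
  obtain ⟨h1, h2⟩ := integrableOn_pairings hU.memLinftyJ3 hm hb hbc hbT j x₀
  obtain ⟨k, hk⟩ := exists_ae_eq_add_integral hb h2 h1 fun η hη hηc hs => by
    have := hU.integral_oseen_eq_zero hm hb hbc hbT hη hηc hs j x₀
    refine Eq.trans (setIntegral_eq_of_subset_of_forall_sdiff_eq_zero measurableSet_Ioo
      (Ioo_subset_Ioo_right hbT) fun t ht => ?_).symm this
    have hn : t ∉ tsupport η := fun h' => ht.2 (hs h')
    have h0 := notMem_tsupport_iff_eventuallyEq.1 hn
    rw [h0.deriv_eq, h0.self_of_nhds]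
    simp
  have hi : Tendsto (fun t => ∫ s in (0 : ℝ)..t,
      quadPair (oseenGrad j (Real.sqrt (c - s))⁻¹ x₀) (U s)) aeZeroRight (𝓝 0) := by
    have hfi := (intervalIntegrable_iff_integrableOn_Ioo_of_le hb.le).2 h2
    have hac := (hfi.absolutelyContinuousOnInterval_intervalIntegral
      (c := 0) (by simp [hb.le])).continuousOn
    have h3 := hac 0 (by simp [hb.le])
    rw [uIcc_of_le hb.le] at h3
    have h4 := (h3.mono (Ioo_subset_Icc_self)).tendsto
    rw [nhdsWithin_Ioo_eq_nhdsGT hb] at h4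
    simpa using h4.mono_left aeZeroRight_le
  have hT : 0 < T := hb.trans_le hbT
  have h5 := tendsto_linPair_oseen_zero hT hU.memLinftyJ3 h j (hb.trans hbc) x₀
  have h6 : Tendsto (fun s => linPair (oseen j (Real.sqrt (c - s))⁻¹ x₀) (U s)) aeZeroRight
      (𝓝 (k + 0)) := by
    refine (tendsto_const_nhds.add hi).congr' ?_
    filter_upwards [eventually_aeZeroRight hb hk] with t ht using ht.symm
  have h7 := tendsto_nhds_unique h5 h6
  rw [add_zero] at h7
  rw [h7]
  exact hk

/-! ### The integrated equation for the difference of two solutions -/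

/-- The difference of the nonlinear terms of two fields, tested with the Oseen kernel. -/
noncomputable def quadDiff (U V : ℝ → L3) (j : Fin 3) (c : ℝ) (x₀ : E3) (s : ℝ) : ℝ :=
  quadPair (oseenGrad j (Real.sqrt (c - s))⁻¹ x₀) (U s)
    - quadPair (oseenGrad j (Real.sqrt (c - s))⁻¹ x₀) (V s)

lemma measurable_quadDiff {U V : ℝ → L3} (hU : StronglyMeasurable U) (hV : StronglyMeasurable V)
    (j : Fin 3) (c : ℝ) : Measurable fun p : E3 × ℝ => quadDiff U V j c p.1 p.2 := by
  have h : ∀ {W : ℝ → L3}, StronglyMeasurable W → Measurable fun p : E3 × ℝ =>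
      quadPair (oseenGrad j (Real.sqrt (c - p.2))⁻¹ p.1) (W p.2) := fun {W} hW =>
    ((stronglyMeasurable_quadPair_oseenGrad j).comp_measurable
      ((hW.measurable.comp measurable_snd).prodMk
        (((measurable_invSqrt c).comp measurable_snd).prodMk measurable_fst))).measurable
  exact (h hU).sub (h hV)

/-- Writing the variable limit of integration as an indicator puts `t` into the integrand, where
joint measurability applies. -/
lemma measurable_integral_indicator_Ioc {X : Type*} [MeasurableSpace X] {f : X → ℝ → ℝ}
    (hf : Measurable fun p : X × ℝ => f p.1 p.2) :
    Measurable fun p : X × ℝ => ∫ s, (Ioc 0 p.2).indicator (f p.1) s := by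
  have hset : MeasurableSet {q : (X × ℝ) × ℝ | 0 < q.2 ∧ q.2 ≤ q.1.2} :=
    (measurableSet_lt measurable_const measurable_snd).inter
      (measurableSet_le measurable_snd measurable_fst.snd)
  have hq : Measurable fun q : (X × ℝ) × ℝ => (q.1.1, q.2) :=
    measurable_fst.fst.prodMk measurable_snd
  have h1 : Measurable fun q : (X × ℝ) × ℝ => f q.1.1 q.2 := hf.comp hq
  have h2 := (h1.indicator hset).stronglyMeasurable.integral_prod_right' (ν := volume)
  exact h2.measurable

/-- For each centre the identity fails on a null set of times depending on the centre; Fubini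
exchanges the two quantifiers. -/
lemma ae_linPair_oseen_sub_eq {T : ℝ} {U V : ℝ → L3} {U₀ : L3} (hU : IsSolution T U)
    (hV : IsSolution T V) (hUm : StronglyMeasurable U) (hVm : StronglyMeasurable V)
    (hU_init : ∀ ψ : E3 → E3, IsTestField ψ →
      Tendsto (fun t : ℝ => ∫ x, ⟪U t x, ψ x⟫_ℝ) aeZeroRight (𝓝 (∫ x, ⟪U₀ x, ψ x⟫_ℝ)))
    (hV_init : ∀ ψ : E3 → E3, IsTestField ψ →
      Tendsto (fun t : ℝ => ∫ x, ⟪V t x, ψ x⟫_ℝ) aeZeroRight (𝓝 (∫ x, ⟪U₀ x, ψ x⟫_ℝ)))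
    {b c : ℝ} (hb : 0 < b) (hbc : b < c) (hbT : b ≤ T) (j : Fin 3) :
    ∀ᵐ t ∂(volume.restrict (Ioo 0 b)), ∀ᵐ x₀ : E3,
      linPair (oseen j (Real.sqrt (c - t))⁻¹ x₀) (U t - V t)
        = ∫ s, (Ioc 0 t).indicator (quadDiff U V j c x₀) s := by
  have hQ := measurable_quadDiff hUm hVm j c
  have hL : ∀ {W : ℝ → L3}, StronglyMeasurable W → Measurable fun p : E3 × ℝ =>
      linPair (oseen j (Real.sqrt (c - p.2))⁻¹ p.1) (W p.2) := fun {W} hW =>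
    ((stronglyMeasurable_linPair_oseen j).comp_measurable
      ((hW.measurable.comp measurable_snd).prodMk
        (((measurable_invSqrt c).comp measurable_snd).prodMk measurable_fst))).measurable
  have hI : Measurable fun p : E3 × ℝ => ∫ s, (Ioc 0 p.2).indicator (quadDiff U V j c p.1) s :=
    measurable_integral_indicator_Ioc hQ
  refine (Measure.ae_ae_comm ?_).1 (Eventually.of_forall fun x₀ => ?_)
  · exact measurableSet_eq_fun (hL (hUm.sub hVm)) hI
  · filter_upwards [hU.linPair_oseen_eq hUm hU_init hb hbc hbT j x₀,
      hV.linPair_oseen_eq hVm hV_init hb hbc hbT j x₀, ae_restrict_mem measurableSet_Ioo]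
      with t h1 h2 ht
    have hsub : Ioc 0 t ⊆ Ioo 0 b := fun s hs => ⟨hs.1, hs.2.trans_lt ht.2⟩
    have i1 := (integrableOn_pairings hU.memLinftyJ3 hUm hb hbc hbT j x₀).2.mono_set hsub
    have i2 := (integrableOn_pairings hV.memLinftyJ3 hVm hb hbc hbT j x₀).2.mono_set hsub
    rw [linPair_sub (memLp_oseen j _ x₀), h1, h2, integral_indicator measurableSet_Ioc,
      intervalIntegral.integral_of_le ht.1.le, intervalIntegral.integral_of_le ht.1.le]
    simp only [quadDiff]
    rw [integral_sub i1 i2]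
    ring

/-- The exceptional times depend also on `c`, which is therefore restricted to rationals. A second
rational between `t` and `c` provides the endpoint `b` strictly below the singularity. -/
lemma ae_forall_rat_linPair_oseen_sub_eq {T : ℝ} {U V : ℝ → L3} {U₀ : L3} (hU : IsSolution T U)
    (hV : IsSolution T V) (hUm : StronglyMeasurable U) (hVm : StronglyMeasurable V)
    (hU_init : ∀ ψ : E3 → E3, IsTestField ψ →
      Tendsto (fun t : ℝ => ∫ x, ⟪U t x, ψ x⟫_ℝ) aeZeroRight (𝓝 (∫ x, ⟪U₀ x, ψ x⟫_ℝ)))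
    (hV_init : ∀ ψ : E3 → E3, IsTestField ψ →
      Tendsto (fun t : ℝ => ∫ x, ⟪V t x, ψ x⟫_ℝ) aeZeroRight (𝓝 (∫ x, ⟪U₀ x, ψ x⟫_ℝ))) :
    ∀ᵐ t : ℝ ∂(volume.restrict (Ioo 0 T)), ∀ q : ℚ, t < q → ∀ j : Fin 3, ∀ᵐ x₀ : E3,
      linPair (oseen j (Real.sqrt (q - t))⁻¹ x₀) (U t - V t)
        = ∫ s : ℝ, (Ioc (0 : ℝ) t).indicator (quadDiff U V j (q : ℝ) x₀) s := by
  have h : ∀ᵐ t : ℝ, ∀ (p q : ℚ) (j : Fin 3), (0 : ℝ) < min (p : ℝ) T → (p : ℝ) < q →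
      t ∈ Ioo 0 (min (p : ℝ) T) → ∀ᵐ x₀ : E3,
      linPair (oseen j (Real.sqrt (q - t))⁻¹ x₀) (U t - V t)
        = ∫ s : ℝ, (Ioc (0 : ℝ) t).indicator (quadDiff U V j (q : ℝ) x₀) s := by
    simp only [ae_all_iff]
    intro p q j hp hpq
    exact (ae_restrict_iff' measurableSet_Ioo).1
      (ae_linPair_oseen_sub_eq hU hV hUm hVm hU_init hV_init hp
        ((min_le_left _ _).trans_lt hpq) (min_le_right _ _) j)
  rw [ae_restrict_iff' measurableSet_Ioo]
  filter_upwards [h] with t ht htT q hq j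
  obtain ⟨p, hp1, hp2⟩ := exists_rat_btwn hq
  have h1 : t < min (p : ℝ) T := lt_min hp1 htT.2
  exact ht p q j (htT.1.trans h1) hp2 ⟨htT.1, h1⟩

/-! ### The Oseen kernel acts on solenoidal fields as the heat kernel -/

/-- Integration by parts on test fields, where compact support removes boundary terms; the
continuous pairing then vanishes on the closure. -/
lemma linPair_gradient_eq_zero {q : E3 → ℝ} (hq : ContDiff ℝ ∞ q)
    (hLp : MemLp (fun x => ∑ i, pd i q x • stdVec i) threeHalves) {u : L3} (hu : u ∈ J3) :
    linPair (fun x => ∑ i, pd i q x • stdVec i) u = 0 := by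
  have hcl : IsClosed {u : L3 | linPair (fun x => ∑ i, pd i q x • stdVec i) u = 0} :=
    isClosed_eq (continuous_linPair hLp) continuous_const
  refine closure_minimal (s := {f : L3 | ∃ ψ : E3 → E3, IsTestField ψ ∧ f =ᵐ[volume] ψ}) ?_ hcl hu
  rintro f ⟨ψ, hψ, hf⟩
  have e : ∀ i, ContDiff ℝ ∞ fun x => ψ x i := fun i =>
    (EuclideanSpace.proj (𝕜 := ℝ) i).contDiff.comp hψ.contDiff
  have hc : ∀ i, HasCompactSupport fun x => ψ x i := fun i =>
    hψ.hasCompactSupport.comp_left (g := fun v : E3 => v i) rfl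
  have hpd : ∀ i x, fderiv ℝ ψ x (EuclideanSpace.single i 1) i
      = fderiv ℝ (fun x => ψ x i) x (stdVec i) := fun i x => by
    have : HasFDerivAt (fun x => ψ x i) _ x := (EuclideanSpace.proj (𝕜 := ℝ) i).hasFDerivAt.comp x
      (hψ.contDiff.differentiable_of_smooth x).hasFDerivAt
    rw [this.fderiv]
    simp
  have hcd : ∀ i, HasCompactSupport fun x => fderiv ℝ (fun x => ψ x i) x (stdVec i) := fun i =>
    (hc i).fderiv_apply (𝕜 := ℝ) (stdVec i)
  have cd : ∀ i, Continuous fun x => fderiv ℝ (fun x => ψ x i) x (stdVec i) := fun i =>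
    (((e i).fderiv_right (m := ∞) (by simp)).clm_apply contDiff_const).continuous
  have cq : ∀ i, Continuous fun x => fderiv ℝ q x (stdVec i) := fun i => (contDiff_pd hq i).continuous
  have i1 : ∀ i, Integrable fun x => ψ x i * pd i q x := fun i =>
    ((e i).continuous.mul (cq i)).integrable_of_hasCompactSupport (hc i).mul_right
  have i2 : ∀ i, Integrable fun x => fderiv ℝ (fun x => ψ x i) x (stdVec i) * q x := fun i =>
    ((cd i).mul hq.continuous).integrable_of_hasCompactSupport (hcd i).mul_right
  have i3 : ∀ i, Integrable fun x => ψ x i * q x := fun i =>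
    ((e i).continuous.mul hq.continuous).integrable_of_hasCompactSupport (hc i).mul_right
  have h1 : ∀ i, ∫ x, ψ x i * pd i q x = -∫ x, fderiv ℝ (fun x => ψ x i) x (stdVec i) * q x :=
    fun i => integral_mul_fderiv_eq_neg_fderiv_mul_of_integrable (i2 i) (i1 i) (i3 i)
      (fun x _ => (e i).differentiable_of_smooth x) (fun x _ => hq.differentiable_of_smooth x)
  calc linPair (fun x => ∑ i, pd i q x • stdVec i) f
      = ∫ x, ∑ i, ψ x i * pd i q x := by
        refine integral_congr_ae ?_
        filter_upwards [hf] with x hx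
        rw [hx, inner_sum]
        refine Finset.sum_congr rfl fun i _ => ?_
        rw [inner_smul_right, EuclideanSpace.inner_single_right]
        simp [mul_comm]
    _ = ∑ i, ∫ x, ψ x i * pd i q x := integral_finsetSum _ fun i _ => i1 i
    _ = -∫ x, ∑ i, fderiv ℝ (fun x => ψ x i) x (stdVec i) * q x := by
        rw [integral_finsetSum _ fun i _ => i2 i, ← Finset.sum_neg_distrib]
        exact Finset.sum_congr rfl fun i _ => h1 i
    _ = 0 := by
        have : ∀ x, ∑ i, fderiv ℝ (fun x => ψ x i) x (stdVec i) * q x = 0 := fun x => by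
          rw [← Finset.sum_mul]
          have := hψ.divergence_eq_zero x
          simp only [divergence, hpd] at this
          rw [this, zero_mul]
        simp [this]

lemma norm_gradient_le {f : E3 → ℝ} {x : E3} {C : ℝ} (h : ∀ i, |pd i f x| ≤ C) :
    ‖∑ i, pd i f x • stdVec i‖ ≤ 3 * C := by
  calc ‖∑ i, pd i f x • stdVec i‖ ≤ ∑ _i : Fin 3, C := norm_sum_le_of_le _ fun i _ => by
        rw [norm_smul]; simpa using h i
    _ = 3 * C := by simp

/-- Only the Gaussian part of the kernel survives, since the gradient part annihilates `J3`. Both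
parts lie separately in L^{3/2}. -/
lemma linPair_oseen_of_mem_J3 {u : L3} (hu : u ∈ J3) (j : Fin 3) (lam : ℝ) (x₀ : E3) :
    linPair (oseen j lam x₀) u
      = 1 / 2 * (lam ^ 3 * ∫ y, Real.exp (-(‖lam • (y - x₀)‖ ^ 2 / 4)) * u y j) := by
  obtain ⟨C, hC⟩ := exists_symbolBound_heatPot_single 2 lam
  set q : E3 → ℝ := fun y => pd j (heatPot lam) (y - x₀) with hq
  have hqs : ContDiff ℝ ∞ q :=
    (contDiff_pd (contDiff_heatPot lam) j).comp (contDiff_id.sub contDiff_const)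
  have hqd : ∀ i x, pd i q x = pd i (pd j (heatPot lam)) (x - x₀) := fun i x => by
    change fderiv ℝ (fun y => pd j (heatPot lam) (y - x₀)) x (stdVec i) = _
    rw [fderiv_comp_sub]
    rfl
  have hgc : Continuous fun x => ∑ i, pd i q x • stdVec i :=
    continuous_finsetSum _ fun i _ => (contDiff_pd hqs i).continuous.smul continuous_const
  have hLp : MemLp (fun x => ∑ i, pd i q x • stdVec i) threeHalves := by
    refine memLp_of_norm_le_weight (C := 3 * C) memLp_weight_three_halves hgc.aestronglyMeasurable
      x₀ fun x => ?_
    rw [mul_assoc]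
    refine norm_gradient_le fun i => ?_
    rw [hqd]
    exact ((hC.pd j).pd i).bound (x - x₀)
  have h0 := linPair_gradient_eq_zero hqs hLp hu
  have e1 : ∀ y, oseen j lam x₀ y - ∑ i, pd i q y • stdVec i
      = (1 / 2 * (lam ^ 3 * Real.exp (-(‖lam • (y - x₀)‖ ^ 2 / 4)))) • stdVec j := fun y => by
    rw [oseen, sol_heatPot]
    simp only [hqd]
    abel
  calc linPair (oseen j lam x₀) u
      = linPair (oseen j lam x₀) u - linPair (fun x => ∑ i, pd i q x • stdVec i) u := by
        rw [h0, sub_zero]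
    _ = ∫ y, ⟪u y, oseen j lam x₀ y - ∑ i, pd i q y • stdVec i⟫_ℝ := by
        simp only [linPair, inner_sub_right]
        rw [integral_sub (integrable_inner (memLp_oseen j lam x₀) u) (integrable_inner hLp u)]
    _ = _ := by
        simp only [e1, inner_smul_right, EuclideanSpace.inner_single_right]
        rw [← integral_const_mul, ← integral_const_mul]
        refine integral_congr_ae (Eventually.of_forall fun y => ?_)
        simp
        ring

/-! ### The Gaussian as an approximate identity -/

/-- The mass `∫ exp (-|ζ|² / 4)` of the Gaussian. -/
noncomputable def gaussMass : ℝ := ∫ ζ : E3, Real.exp (-(‖ζ‖ ^ 2 / 4))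

lemma gaussMass_pos : 0 < gaussMass := by
  have h := GaussianFourier.integral_rexp_neg_mul_sq_norm (V := E3) (b := 1 / 4) (by norm_num)
  have e : gaussMass = ∫ v : E3, Real.exp (-(1 / 4) * ‖v‖ ^ 2) := by
    refine integral_congr_ae (Eventually.of_forall fun v => ?_)
    simp only
    ring_nf
  rw [e, h]
  positivity

lemma integrable_gauss : Integrable fun ζ : E3 => Real.exp (-(‖ζ‖ ^ 2 / 4)) := by
  -- A non-integrable function would have integral zero by convention, contrary to the explicit
  -- positive value.
  by_contra h
  exact gaussMass_pos.ne' (integral_undef h)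

variable {χ f : E3 → ℝ}

lemma lintegral_enorm_mul_le {χ f : E3 → ℝ} (hχ : AEStronglyMeasurable χ)
    (hf : AEStronglyMeasurable f) :
    ∫⁻ x, ‖χ x‖ₑ * ‖f x‖ₑ ≤ eLpNorm χ threeHalves volume * eLpNorm f 3 volume := by
  have := eLpNorm_le_eLpNorm_mul_eLpNorm_of_nnnorm (p := threeHalves) (q := 3) (r := 1)
    hχ hf (fun x y => x * y) 1 (Eventually.of_forall fun x => by simp)
  simpa [eLpNorm_one_eq_lintegral_enorm, enorm_mul] using this

lemma eLpNorm_comp_add {F : Type*} [NormedAddCommGroup F] {f : E3 → F}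
    (hf : AEStronglyMeasurable f) (z : E3) (p : ℝ≥0∞) :
    eLpNorm (fun x => f (x + z)) p volume = eLpNorm f p volume :=
  eLpNorm_comp_measurePreserving hf (measurePreserving_add_right volume z)

lemma lintegral_enorm_mul_translate_le (hχ : AEStronglyMeasurable χ)
    (hf : AEStronglyMeasurable f) (z : E3) :
    ∫⁻ x, ‖χ x‖ₑ * ‖f (x + z)‖ₑ ≤ eLpNorm χ threeHalves volume * eLpNorm f 3 volume := by
  have h := lintegral_enorm_mul_le (f := fun x => f (x + z)) hχ
    (hf.comp_measurePreserving (measurePreserving_add_right volume z))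
  rwa [eLpNorm_comp_add hf] at h

/-- A weighted form of Young's inequality for convolutions. -/
lemma lintegral_mul_lintegral_translate_le {g : E3 → ℝ≥0∞} (hg : Measurable g)
    (hχ : Measurable χ) (hf : Measurable f) {θ : E3 → E3} (hθ : Measurable θ) :
    ∫⁻ x, ‖χ x‖ₑ * ∫⁻ z, g z * ‖f (x + θ z)‖ₑ
      ≤ (∫⁻ z, g z) * (eLpNorm χ threeHalves volume * eLpNorm f 3 volume) := by
  have hfz : Measurable fun p : E3 × E3 => ‖f (p.1 + θ p.2)‖ₑ :=
    (hf.comp (measurable_fst.add (hθ.comp measurable_snd))).enorm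
  have h1 : ∀ x, Measurable fun z => g z * ‖f (x + θ z)‖ₑ := fun x =>
    hg.mul (hf.comp (measurable_const.add hθ)).enorm
  calc ∫⁻ x, ‖χ x‖ₑ * ∫⁻ z, g z * ‖f (x + θ z)‖ₑ
      = ∫⁻ x, ∫⁻ z, ‖χ x‖ₑ * (g z * ‖f (x + θ z)‖ₑ) :=
        lintegral_congr fun x => (lintegral_const_mul _ (h1 x)).symm
    _ = ∫⁻ z, ∫⁻ x, ‖χ x‖ₑ * (g z * ‖f (x + θ z)‖ₑ) := by
        refine lintegral_lintegral_swap (Measurable.aemeasurable ?_)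
        exact (hχ.comp measurable_fst).enorm.mul ((hg.comp measurable_snd).mul hfz)
    _ = ∫⁻ z, g z * ∫⁻ x, ‖χ x‖ₑ * ‖f (x + θ z)‖ₑ := by
        refine lintegral_congr fun z => ?_
        rw [← lintegral_const_mul]
        · exact lintegral_congr fun x => by ring
        · exact hχ.enorm.mul (hf.comp (measurable_id.add_const _)).enorm
    _ ≤ ∫⁻ z, g z * (eLpNorm χ threeHalves volume * eLpNorm f 3 volume) := by
        gcongr with z
        exact lintegral_enorm_mul_translate_le hχ.aestronglyMeasurable hf.aestronglyMeasurable _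
    _ = _ := lintegral_mul_const _ hg

/-- The function is the convolution of the reflected `χ` with `f`. -/
lemma continuous_integral_mul_translate (hχ : Continuous χ) (hχc : HasCompactSupport χ)
    (hf : MemLp f 3) : Continuous fun z => ∫ x, χ x * f (x + z) := by
  have h1 : HasCompactSupport fun x => χ (-x) := hχc.comp_homeomorph (Homeomorph.neg E3)
  have h2 := h1.continuous_convolution_left (ContinuousLinearMap.mul ℝ ℝ) (μ := volume)
    (hχ.comp continuous_neg) (hf.locallyIntegrable (by norm_num))
  refine h2.congr fun z => ?_
  rw [convolution_def, ← integral_neg_eq_self]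
  refine integral_congr_ae (Eventually.of_forall fun x => ?_)
  simp [add_comm]

lemma pow_mul_integral_gauss_eq {lam : ℝ} (hlam : 0 < lam) (f : E3 → ℝ) (x₀ : E3) :
    lam ^ 3 * ∫ y, Real.exp (-(‖lam • (y - x₀)‖ ^ 2 / 4)) * f y
      = ∫ ζ, Real.exp (-(‖ζ‖ ^ 2 / 4)) * f (x₀ + lam⁻¹ • ζ) := by
  have h1 := integral_sub_right_eq_self (μ := volume)
    (fun z : E3 => Real.exp (-(‖lam • z‖ ^ 2 / 4)) * f (x₀ + z)) x₀
  have h2 := Measure.integral_comp_smul (volume : Measure E3)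
    (fun ζ : E3 => Real.exp (-(‖ζ‖ ^ 2 / 4)) * f (x₀ + lam⁻¹ • ζ)) lam
  simp only [add_sub_cancel, smul_smul, inv_mul_cancel₀ hlam.ne', one_smul] at h1 h2
  rw [h1, h2, finrank_euclideanSpace_fin, abs_of_pos (by positivity), smul_eq_mul,
    mul_inv_cancel_left₀ (by positivity)]

lemma integral_mul_gauss_eq (hχ : Continuous χ) (hχc : HasCompactSupport χ)
    (hf : MemLp f 3) (hfm : Measurable f) {lam : ℝ} (hlam : 0 < lam) :
    ∫ x₀, χ x₀ * (lam ^ 3 * ∫ y, Real.exp (-(‖lam • (y - x₀)‖ ^ 2 / 4)) * f y)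
      = ∫ ζ, Real.exp (-(‖ζ‖ ^ 2 / 4)) * ∫ x, χ x * f (x + lam⁻¹ • ζ) := by
  have hg : Continuous fun ζ : E3 => Real.exp (-(‖ζ‖ ^ 2 / 4)) := by fun_prop
  have hθ : Measurable fun ζ : E3 => lam⁻¹ • ζ := by fun_prop
  have hm : Measurable fun p : E3 × E3 =>
      χ p.1 * (Real.exp (-(‖p.2‖ ^ 2 / 4)) * f (p.1 + lam⁻¹ • p.2)) :=
    (hχ.measurable.comp measurable_fst).mul ((hg.measurable.comp measurable_snd).mul
      (hfm.comp (measurable_fst.add (hθ.comp measurable_snd))))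
  have hχL : MemLp χ threeHalves := hχ.memLp_of_hasCompactSupport hχc
  have hint : Integrable (Function.uncurry fun x ζ : E3 =>
      χ x * (Real.exp (-(‖ζ‖ ^ 2 / 4)) * f (x + lam⁻¹ • ζ))) (volume.prod volume) := by
    refine ⟨hm.aestronglyMeasurable, ?_⟩
    rw [hasFiniteIntegral_iff_enorm]
    refine (lintegral_prod _ hm.enorm.aemeasurable).trans_lt ?_
    have h := lintegral_mul_lintegral_translate_le hg.enorm.measurable hχ.measurable hfm hθ
    refine lt_of_eq_of_lt ?_ (h.trans_lt (ENNReal.mul_lt_top integrable_gauss.2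
      (ENNReal.mul_lt_top hχL.2 hf.2)))
    refine lintegral_congr fun x => ?_
    rw [← lintegral_const_mul]
    · simp only [enorm_mul]
    · exact hg.enorm.measurable.mul (hfm.comp (measurable_const.add hθ)).enorm
  simp only [pow_mul_integral_gauss_eq hlam, ← integral_const_mul]
  rw [integral_integral_swap hint]
  refine integral_congr_ae (Eventually.of_forall fun ζ => ?_)
  refine integral_congr_ae (Eventually.of_forall fun x => ?_)
  simp only
  ring

/-- After Fubini the Gaussian averages `z ↦ ∫ χ x * f (x + z)` at scale `lam⁻¹`. This function is
continuous and bounded, so dominated convergence gives its value at 0. Convergence against test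
functions is enough for the duality argument. -/
lemma tendsto_integral_mul_gauss (hχ : Continuous χ) (hχc : HasCompactSupport χ)
    (hf : MemLp f 3) (hfm : Measurable f) :
    Tendsto (fun lam : ℝ => ∫ x₀, χ x₀ *
      (lam ^ 3 * ∫ y, Real.exp (-(‖lam • (y - x₀)‖ ^ 2 / 4)) * f y)) atTop
      (𝓝 (gaussMass * ∫ x, χ x * f x)) := by
  have hχL : MemLp χ threeHalves := hχ.memLp_of_hasCompactSupport hχc
  have hH := continuous_integral_mul_translate hχ hχc hf
  set C : ℝ := (eLpNorm χ threeHalves volume * eLpNorm f 3 volume).toReal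
  have hHC : ∀ z, ‖∫ x, χ x * f (x + z)‖ ≤ C := fun z => by
    have h1 : ‖∫ x, χ x * f (x + z)‖ₑ ≤ eLpNorm χ threeHalves volume * eLpNorm f 3 volume := by
      refine (enorm_integral_le_lintegral_enorm _).trans ?_
      simpa only [enorm_mul] using lintegral_enorm_mul_translate_le hχL.1 hf.1 z
    have := ENNReal.toReal_mono (ENNReal.mul_ne_top hχL.2.ne hf.2.ne) h1
    rwa [toReal_enorm] at this
  have hlim : Tendsto (fun lam : ℝ => ∫ ζ, Real.exp (-(‖ζ‖ ^ 2 / 4))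
      * ∫ x, χ x * f (x + lam⁻¹ • ζ)) atTop
      (𝓝 (∫ ζ : E3, Real.exp (-(‖ζ‖ ^ 2 / 4)) * ∫ x, χ x * f (x + (0 : ℝ) • ζ))) := by
    refine tendsto_integral_filter_of_dominated_convergence
      (fun ζ => Real.exp (-(‖ζ‖ ^ 2 / 4)) * C) (Eventually.of_forall fun lam => ?_)
      (Eventually.of_forall fun lam => Eventually.of_forall fun ζ => ?_)
      (integrable_gauss.mul_const C) (Eventually.of_forall fun ζ => ?_)
    · have : Continuous fun ζ : E3 => ∫ x, χ x * f (x + lam⁻¹ • ζ) :=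
        hH.comp (continuous_const_smul lam⁻¹)
      have hg : Continuous fun ζ : E3 => Real.exp (-(‖ζ‖ ^ 2 / 4)) := by fun_prop
      exact (hg.mul this).aestronglyMeasurable
    · rw [norm_mul, Real.norm_of_nonneg (Real.exp_pos _).le]
      gcongr
      exact hHC _
    · refine Tendsto.const_mul _ ?_
      exact (hH.tendsto _).comp (tendsto_inv_atTop_zero.smul_const ζ)
  simp only [zero_smul, add_zero, integral_mul_const] at hlim
  refine hlim.congr' ?_
  filter_upwards [eventually_gt_atTop 0] with lam hlam
  exact (integral_mul_gauss_eq hχ hχc hf hfm hlam).symm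

/-! ### Duality between `L^{3/2}` and `L³` -/

/-- Compactly supported continuous functions are dense in L^{3/2}, and finiteness of the L³ norm of
`f` controls the error. -/
lemma enorm_integral_mul_le_of_forall (hf : MemLp f 3) {A : ℝ≥0∞} (hA : A ≠ ⊤)
    (h : ∀ χ : E3 → ℝ, Continuous χ → HasCompactSupport χ →
      ‖∫ x, χ x * f x‖ₑ ≤ A * eLpNorm χ threeHalves volume) {g : E3 → ℝ}
    (hg : MemLp g threeHalves) :
    ‖∫ x, g x * f x‖ₑ ≤ A * eLpNorm g threeHalves volume := by
  have hint : ∀ {g : E3 → ℝ}, MemLp g threeHalves → Integrable fun x => g x * f x := fun {g} hg =>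
    memLp_one_iff_integrable.1 ((ContinuousLinearMap.mul ℝ ℝ).memLp_of_bilin 1 hg hf)
  have hB : A + eLpNorm f 3 volume ≠ ⊤ := ENNReal.add_ne_top.2 ⟨hA, hf.2.ne⟩
  have key : ∀ ε : ℝ≥0, 0 < ε → ‖∫ x, g x * f x‖ₑ
      ≤ A * eLpNorm g threeHalves volume + ε * (A + eLpNorm f 3 volume) := fun ε hε => by
    obtain ⟨χ, hχc, hχε, hχ, hχL⟩ := hg.exists_hasCompactSupport_eLpNorm_sub_le
      ENNReal.ofReal_ne_top (ε := (ε : ℝ≥0∞)) (by exact_mod_cast hε.ne')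
    have e1 : ∫ x, g x * f x = (∫ x, χ x * f x) + ∫ x, (g - χ) x * f x := by
      rw [← integral_add (hint hχL) (hint (hg.sub hχL))]
      refine integral_congr_ae (Eventually.of_forall fun x => ?_)
      simp only [Pi.sub_apply]
      ring
    have e2 : ‖∫ x, (g - χ) x * f x‖ₑ ≤ ε * eLpNorm f 3 volume := by
      refine (enorm_integral_le_lintegral_enorm _).trans ?_
      simp only [enorm_mul]
      exact (lintegral_enorm_mul_le (hg.sub hχL).1 hf.1).trans (by gcongr)
    have e3 : eLpNorm χ threeHalves volume ≤ eLpNorm g threeHalves volume + ε := by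
      have := eLpNorm_add_le hg.1 (hχL.sub hg).1 (Fact.out : 1 ≤ threeHalves)
      rw [add_sub_cancel, eLpNorm_sub_comm] at this
      exact this.trans (by gcongr)
    calc ‖∫ x, g x * f x‖ₑ ≤ ‖∫ x, χ x * f x‖ₑ + ‖∫ x, (g - χ) x * f x‖ₑ := by
          rw [e1]; exact enorm_add_le _ _
      _ ≤ A * (eLpNorm g threeHalves volume + ε) + ε * eLpNorm f 3 volume :=
          add_le_add ((h χ hχ hχc).trans (by gcongr)) e2
      _ = _ := by ring
  refine ENNReal.le_of_forall_pos_le_add fun δ hδ _ => ?_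
  set B : ℝ≥0 := (A + eLpNorm f 3 volume).toNNReal with hBdef
  have hBe : (B : ℝ≥0∞) = A + eLpNorm f 3 volume := ENNReal.coe_toNNReal hB
  refine (key (δ / (B + 1)) (by positivity)).trans ?_
  rw [← hBe]
  gcongr
  rw [← ENNReal.coe_mul]
  norm_cast
  rw [div_mul_eq_mul_div]
  refine div_le_of_le_mul₀ (by positivity) (by positivity) ?_
  gcongr
  exact le_self_add

/-- Test with the extremal function `‖f‖ * f`: the pairing is the cube of the norm of `f`, and its
L^{3/2} norm is the square. Since the norm is finite, the square can be cancelled when it is not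
zero. -/
lemma eLpNorm_le_of_forall_integral_le (hf : MemLp f 3) {A : ℝ≥0∞}
    (h : ∀ χ : E3 → ℝ, Continuous χ → HasCompactSupport χ →
      ‖∫ x, χ x * f x‖ₑ ≤ A * eLpNorm χ threeHalves volume) :
    eLpNorm f 3 volume ≤ A := by
  rcases eq_or_ne A ⊤ with rfl | hA
  · exact le_top
  have h32 : (3 : ℝ≥0∞) = threeHalves * ENNReal.ofReal 2 := by
    rw [← ENNReal.ofReal_mul (by norm_num)]
    norm_num
  have hgn : ∀ x, ‖‖f x‖ * f x‖ = ‖f x‖ ^ (2 : ℝ) := fun x => by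
    rw [norm_mul, norm_norm, Real.rpow_two, sq]
  have hge : eLpNorm (fun x => ‖f x‖ * f x) threeHalves volume = eLpNorm f 3 volume ^ (2 : ℝ) := by
    rw [h32, ← eLpNorm_norm_rpow f (by norm_num : (0 : ℝ) < 2)]
    refine eLpNorm_congr_norm_ae (Eventually.of_forall fun x => ?_)
    rw [hgn, Real.norm_of_nonneg (Real.rpow_nonneg (norm_nonneg _) _)]
  have hg : MemLp (fun x => ‖f x‖ * f x) threeHalves :=
    ⟨hf.1.norm.mul hf.1, by rw [hge]; exact ENNReal.rpow_lt_top_of_nonneg (by norm_num) hf.2.ne⟩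
  have h1 := enorm_integral_mul_le_of_forall hf hA h hg
  have h2 : ‖∫ x, ‖f x‖ * f x * f x‖ₑ = eLpNorm f 3 volume ^ (3 : ℝ) := by
    have e : ∀ x, ‖‖f x‖ * f x * f x‖ₑ = ‖f x‖ₑ ^ (3 : ℝ) := fun x => by
      rw [enorm_mul, enorm_mul, enorm_norm]
      norm_cast
      ring
    have hnn : ∀ x, 0 ≤ ‖f x‖ * f x * f x := fun x => by
      rw [mul_assoc]
      exact mul_nonneg (norm_nonneg _) (mul_self_nonneg _)
    have hm : AEStronglyMeasurable fun x => ‖f x‖ * f x * f x := hg.1.mul hf.1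
    rw [Real.enorm_of_nonneg (integral_nonneg hnn),
      integral_eq_lintegral_of_nonneg_ae (Eventually.of_forall hnn) hm]
    simp only [← Real.enorm_of_nonneg (hnn _), e]
    have h3 := lintegral_rpow_enorm_lt_top_of_eLpNorm_lt_top (by norm_num) (by norm_num) hf.2
    rw [eLpNorm_eq_lintegral_rpow_enorm_toReal (by norm_num) (by norm_num),
      ENNReal.ofReal_toReal (by simpa using h3.ne), ← ENNReal.rpow_mul]
    simp
  rw [h2, hge] at h1
  rcases eq_or_ne (eLpNorm f 3 volume) 0 with h0 | h0
  · simp [h0]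
  · rw [show (3 : ℝ) = 1 + 2 by norm_num, ENNReal.rpow_add _ _ h0 hf.2.ne, ENNReal.rpow_one] at h1
    exact (ENNReal.mul_le_mul_iff_left (by simp [h0]) (by simpa using hf.2.ne)).1 h1

/-! ### The smoothing estimate for the difference of two solutions -/

lemma IsTestField.sub {ψ φ : E3 → E3} (hψ : IsTestField ψ) (hφ : IsTestField φ) :
    IsTestField (ψ - φ) where
  contDiff := hψ.contDiff.sub hφ.contDiff
  hasCompactSupport := hψ.hasCompactSupport.sub hφ.hasCompactSupport
  divergence_eq_zero x := by
    have h1 := hψ.divergence_eq_zero x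
    have h2 := hφ.divergence_eq_zero x
    simp only [divergence] at h1 h2 ⊢
    rw [fderiv_sub (hψ.contDiff.differentiable_of_smooth x) (hφ.contDiff.differentiable_of_smooth x)]
    simp only [_root_.sub_apply, PiLp.sub_apply, Finset.sum_sub_distrib, h1, h2, sub_zero]

lemma sub_mem_J3 {u v : L3} (hu : u ∈ J3) (hv : v ∈ J3) : u - v ∈ J3 := by
  refine map_mem_closure₂ continuous_sub hu hv ?_
  rintro f ⟨ψ, hψ, hf⟩ g ⟨φ, hφ, hg⟩
  refine ⟨ψ - φ, hψ.sub hφ, ?_⟩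
  filter_upwards [hf, hg, Lp.coeFn_sub f g] with x h1 h2 h3
  rw [h3, Pi.sub_apply, h1, h2, Pi.sub_apply]

/-- Polarization: `⟪Bu, u⟫ - ⟪Bv, v⟫ = ⟪B(u - v), u⟫ + ⟪Bv, u - v⟫`, with the undifferenced field
taken out in the supremum norm. -/
lemma enorm_quadPair_sub_le {B : E3 → E3 →L[ℝ] E3} (hB : MemLp B 3) (u v : L3) :
    ‖quadPair B u - quadPair B v‖ₑ
      ≤ (eLpNorm u ⊤ volume + eLpNorm v ⊤ volume) * ∫⁻ y, ‖B y‖ₑ * ‖(u - v) y‖ₑ := by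
  rw [quadPair, quadPair, ← integral_sub (integrable_quadPair hB u) (integrable_quadPair hB v)]
  refine (enorm_integral_le_lintegral_enorm _).trans ?_
  have hm : AEMeasurable fun y => ‖B y‖ₑ * ‖(u - v) y‖ₑ :=
    hB.1.enorm.mul (Lp.memLp (u - v)).1.enorm
  rw [← lintegral_const_mul'' _ hm]
  refine lintegral_mono_ae ?_
  filter_upwards [Lp.coeFn_sub u v, enorm_ae_le_eLpNormEssSup u volume,
    enorm_ae_le_eLpNormEssSup v volume] with x h1 h2 h3
  rw [h1, Pi.sub_apply]
  rw [eLpNorm_exponent_top, eLpNorm_exponent_top]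
  have e : ⟪B x (u x), u x⟫_ℝ - ⟪B x (v x), v x⟫_ℝ
      = ⟪B x (u x - v x), u x⟫_ℝ + ⟪B x (v x), u x - v x⟫_ℝ := by
    rw [map_sub, inner_sub_left, inner_sub_right]
    ring
  have hi : ∀ a b : E3, ‖⟪a, b⟫_ℝ‖ₑ ≤ ‖a‖ₑ * ‖b‖ₑ := fun a b => by
    rw [← enorm_norm a, ← enorm_norm b, ← enorm_mul, enorm_le_iff_norm_le,
      Real.norm_of_nonneg (by positivity : 0 ≤ ‖a‖ * ‖b‖)]
    exact norm_inner_le_norm a b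
  rw [e]
  calc ‖⟪B x (u x - v x), u x⟫_ℝ + ⟪B x (v x), u x - v x⟫_ℝ‖ₑ
      ≤ ‖⟪B x (u x - v x), u x⟫_ℝ‖ₑ + ‖⟪B x (v x), u x - v x⟫_ℝ‖ₑ := enorm_add_le _ _
    _ ≤ ‖B x‖ₑ * ‖u x - v x‖ₑ * ‖u x‖ₑ + ‖B x‖ₑ * ‖v x‖ₑ * ‖u x - v x‖ₑ := by
        refine add_le_add ((hi _ _).trans ?_) ((hi _ _).trans ?_) <;> gcongr <;>
          exact (B x).le_opENorm _
    _ = (‖u x‖ₑ + ‖v x‖ₑ) * (‖B x‖ₑ * ‖u x - v x‖ₑ) := by ring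
    _ ≤ _ := by gcongr

/-- The sum of the suprema of two fields at a time. -/
noncomputable def supSum (U V : ℝ → L3) (s : ℝ) : ℝ≥0∞ :=
  eLpNorm (U s) ⊤ volume + eLpNorm (V s) ⊤ volume

/-- Young's inequality L¹ * L³ → L³ in dual form, with the scaled L¹ norm of the kernel gradient. -/
lemma exists_lintegral_quadDiff_le : ∃ K : ℝ≥0, ∀ (U V : ℝ → L3) (j : Fin 3) (χ : E3 → ℝ)
    (c s : ℝ), Continuous χ → s < c → ∫⁻ x₀, ‖χ x₀‖ₑ * ‖quadDiff U V j c x₀ s‖ₑ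
      ≤ K * eLpNorm χ threeHalves volume
        * (ENNReal.ofReal (Real.sqrt (c - s))⁻¹ * (supSum U V s * ‖U s - V s‖ₑ)) := by
  obtain ⟨K, hK⟩ := exists_lintegral_fderiv_sol_heatPot_le
  refine ⟨K, fun U V j χ c s hχ hsc => ?_⟩
  set lam : ℝ := (Real.sqrt (c - s))⁻¹
  have hlam : 0 < lam := inv_pos.2 (Real.sqrt_pos.2 (by linarith))
  set g : E3 → ℝ≥0∞ := fun z => ‖fderiv ℝ (sol j (heatPot lam)) z‖ₑ with hg
  have hgm : Measurable g := (measurable_fderiv ℝ _).enorm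
  set f : E3 → ℝ := fun x => ‖(U s - V s) x‖ with hf
  have hfm : Measurable f := (Lp.stronglyMeasurable (U s - V s)).norm.measurable
  have hfn : eLpNorm f 3 volume = ‖U s - V s‖ₑ := by
    rw [hf, eLpNorm_norm, Lp.enorm_def]
  have hconv : Measurable fun x => ∫⁻ z, g z * ‖f (x + z)‖ₑ := by
    refine Measurable.lintegral_prod_right' (f := fun p : E3 × E3 => g p.2 * ‖f (p.1 + p.2)‖ₑ) ?_
    exact (hgm.comp measurable_snd).mul (hfm.comp (measurable_fst.add measurable_snd)).enorm
  have h1 : ∀ x₀, ‖quadDiff U V j c x₀ s‖ₑ ≤ supSum U V s * ∫⁻ z, g z * ‖f (x₀ + z)‖ₑ :=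
    fun x₀ => by
    refine (enorm_quadPair_sub_le (memLp_oseenGrad j lam x₀) (U s) (V s)).trans_eq ?_
    rw [supSum]
    congr 1
    rw [← lintegral_sub_right_eq_self (fun z => g z * ‖f (x₀ + z)‖ₑ) x₀]
    refine lintegral_congr fun y => ?_
    rw [add_sub_cancel, hf, enorm_norm]
    rfl
  calc ∫⁻ x₀, ‖χ x₀‖ₑ * ‖quadDiff U V j c x₀ s‖ₑ
      ≤ ∫⁻ x₀, supSum U V s * (‖χ x₀‖ₑ * ∫⁻ z, g z * ‖f (x₀ + z)‖ₑ) := by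
        refine lintegral_mono fun x₀ => ?_
        rw [mul_left_comm]
        gcongr
        exact h1 x₀
    _ = supSum U V s * ∫⁻ x₀, ‖χ x₀‖ₑ * ∫⁻ z, g z * ‖f (x₀ + z)‖ₑ :=
        lintegral_const_mul _ (hχ.enorm.measurable.mul hconv)
    _ ≤ supSum U V s * ((∫⁻ z, g z) * (eLpNorm χ threeHalves volume * eLpNorm f 3 volume)) := by
        gcongr
        exact lintegral_mul_lintegral_translate_le hgm hχ.measurable hfm measurable_id
    _ ≤ supSum U V s * ((K * ENNReal.ofReal lam)
          * (eLpNorm χ threeHalves volume * ‖U s - V s‖ₑ)) := by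
        rw [hfn]
        gcongr
        exact hK lam j hlam
    _ = _ := by ring

/-- The kernel `(t - s)^{-1/2} (|U(s)|_∞ + |V(s)|_∞)` integrated against the norm of the
difference. -/
noncomputable def duhamelBound (U V : ℝ → L3) (t : ℝ) : ℝ≥0∞ :=
  ∫⁻ s in Ioo 0 t, ENNReal.ofReal (Real.sqrt (t - s))⁻¹ * (supSum U V s * ‖U s - V s‖ₑ)

lemma lintegral_mul_setLIntegral_le {Q : E3 → ℝ → ℝ} (hQ : Measurable fun p : E3 × ℝ => Q p.1 p.2)
    {χ : E3 → ℝ} (hχ : Measurable χ) {A : ℝ≥0∞} (hA : A ≠ ⊤) {h : ℝ → ℝ≥0∞} {t : ℝ}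
    (hle : ∀ s ∈ Ioo 0 t, ∫⁻ x₀, ‖χ x₀‖ₑ * ‖Q x₀ s‖ₑ ≤ A * h s) :
    ∫⁻ x₀, ‖χ x₀‖ₑ * ∫⁻ s in Ioo 0 t, ‖Q x₀ s‖ₑ ≤ A * ∫⁻ s in Ioo 0 t, h s := by
  have hQ1 : ∀ x₀, Measurable fun s => ‖Q x₀ s‖ₑ := fun x₀ =>
    (hQ.comp (measurable_prodMk_left (x := x₀))).enorm
  calc ∫⁻ x₀, ‖χ x₀‖ₑ * ∫⁻ s in Ioo 0 t, ‖Q x₀ s‖ₑ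
      = ∫⁻ x₀, ∫⁻ s in Ioo 0 t, ‖χ x₀‖ₑ * ‖Q x₀ s‖ₑ :=
        lintegral_congr fun x₀ => (lintegral_const_mul _ (hQ1 x₀)).symm
    _ = ∫⁻ s in Ioo 0 t, ∫⁻ x₀, ‖χ x₀‖ₑ * ‖Q x₀ s‖ₑ :=
        lintegral_lintegral_swap
          ((hχ.comp measurable_fst).enorm.mul hQ.enorm).aemeasurable
    _ ≤ ∫⁻ s in Ioo 0 t, A * h s := setLIntegral_mono' measurableSet_Ioo hle
    _ = _ := lintegral_const_mul' _ _ hA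

/-- Since `t < c`, the factor `(c - s)^{-1/2}` is at most `(t - s)^{-1/2}`: the bound no longer
depends on `c`, which can then tend to `t`. -/
lemma lintegral_lintegral_quadDiff_le {K : ℝ≥0} {U V : ℝ → L3} (hU : StronglyMeasurable U)
    (hV : StronglyMeasurable V) {j : Fin 3} {χ : E3 → ℝ} (hχ : Continuous χ)
    (hχc : HasCompactSupport χ) {c t : ℝ} (htc : t < c)
    (hK : ∀ s < c, ∫⁻ x₀, ‖χ x₀‖ₑ * ‖quadDiff U V j c x₀ s‖ₑ
      ≤ K * eLpNorm χ threeHalves volume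
        * (ENNReal.ofReal (Real.sqrt (c - s))⁻¹ * (supSum U V s * ‖U s - V s‖ₑ))) :
    ∫⁻ x₀, ‖χ x₀‖ₑ * ∫⁻ s in Ioo 0 t, ‖quadDiff U V j c x₀ s‖ₑ
      ≤ K * eLpNorm χ threeHalves volume * duhamelBound U V t := by
  have hχL : MemLp χ threeHalves := hχ.memLp_of_hasCompactSupport hχc
  refine lintegral_mul_setLIntegral_le (measurable_quadDiff hU hV j c) hχ.measurable
    (ENNReal.mul_ne_top ENNReal.coe_ne_top hχL.2.ne) fun s hs => (hK s (hs.2.trans htc)).trans ?_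
  have : 0 < Real.sqrt (t - s) := Real.sqrt_pos.2 (by linarith [hs.2])
  gcongr

lemma enorm_le_sum_component (u : L3) : ‖u‖ₑ ≤ ∑ j : Fin 3, eLpNorm (fun x => u x j) 3 volume := by
  have hm : ∀ j, AEStronglyMeasurable fun x => u x j • stdVec j := fun j =>
    ((EuclideanSpace.proj (𝕜 := ℝ) j).continuous.comp_aestronglyMeasurable
      (Lp.memLp u).1).smul_const _
  have h := eLpNorm_sum_le (μ := volume) (p := 3) (s := Finset.univ)
    (f := fun (j : Fin 3) x => u x j • stdVec j) (fun j _ => hm j) (by norm_num)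
  have e : (∑ j : Fin 3, fun x => u x j • stdVec j) = u := by
    ext1 x
    rw [Finset.sum_apply, sum_apply_stdVec]
  rw [e] at h
  rw [Lp.enorm_def]
  refine h.trans_eq (Finset.sum_congr rfl fun j _ => ?_)
  exact eLpNorm_congr_norm_ae (Eventually.of_forall fun x => by simp [norm_smul])

/-- Rational times just above `t` give arbitrarily large `lam`. Since the limit as `lam → ∞` is
already known to exist, a bound along such values passes to it. -/
lemma frequently_invSqrt_sub_rat (t : ℝ) {p : ℝ → Prop}
    (h : ∀ q : ℚ, t < q → p (Real.sqrt (q - t))⁻¹) : ∃ᶠ lam in atTop, p lam := by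
  rw [frequently_atTop]
  intro a
  have ha : 0 < |a| + 1 := by positivity
  obtain ⟨q, hq1, hq2⟩ := exists_rat_btwn
    (show t < t + ((|a| + 1)⁻¹) ^ 2 by linarith [pow_pos (inv_pos.2 ha) 2])
  refine ⟨_, ?_, h q hq1⟩
  have h1 : 0 < Real.sqrt (q - t) := Real.sqrt_pos.2 (by linarith)
  have h2 : Real.sqrt (q - t) ≤ (|a| + 1)⁻¹ := by
    rw [Real.sqrt_le_left (inv_pos.2 ha).le]
    linarith
  have h3 := inv_anti₀ h1 h2
  rw [inv_inv] at h3
  linarith [le_abs_self a]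

lemma exists_enorm_sub_le : ∃ C : ℝ≥0, ∀ (T : ℝ) (U V : ℝ → L3) (U₀ : L3), IsSolution T U →
    IsSolution T V → StronglyMeasurable U → StronglyMeasurable V →
    (∀ ψ : E3 → E3, IsTestField ψ →
      Tendsto (fun t : ℝ => ∫ x, ⟪U t x, ψ x⟫_ℝ) aeZeroRight (𝓝 (∫ x, ⟪U₀ x, ψ x⟫_ℝ))) →
    (∀ ψ : E3 → E3, IsTestField ψ →
      Tendsto (fun t : ℝ => ∫ x, ⟪V t x, ψ x⟫_ℝ) aeZeroRight (𝓝 (∫ x, ⟪U₀ x, ψ x⟫_ℝ))) →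
    ∀ᵐ t ∂(volume.restrict (Ioo 0 T)), ‖U t - V t‖ₑ ≤ C * duhamelBound U V t := by
  obtain ⟨K, hK⟩ := exists_lintegral_quadDiff_le
  -- Three components, the mass of the Gaussian, and 2 against the factor 1/2 of the Gaussian in the
  -- kernel.
  refine ⟨3 * (gaussMass.toNNReal⁻¹ * (2 * K)),
    fun T U V U₀ hU hV hUm hVm hU_init hV_init => ?_⟩
  filter_upwards [ae_forall_rat_linPair_oseen_sub_eq hU hV hUm hVm hU_init hV_init,
    hU.memLinftyJ3.mem_J3, hV.memLinftyJ3.mem_J3] with t ht hUt hVt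
  have hw := sub_mem_J3 hUt hVt
  set w := U t - V t
  have hcomp : ∀ j : Fin 3, eLpNorm (fun x => w x j) 3 volume
      ≤ (gaussMass.toNNReal⁻¹ * (2 * K) : ℝ≥0) * duhamelBound U V t := fun j => by
    have hfm : Measurable fun x => w x j :=
      (EuclideanSpace.proj (𝕜 := ℝ) j).measurable.comp (Lp.stronglyMeasurable w).measurable
    have hf : MemLp (fun x => w x j) 3 :=
      (Lp.memLp w).of_le hfm.aestronglyMeasurable
        (Eventually.of_forall fun x => abs_apply_le_norm _ _)
    refine eLpNorm_le_of_forall_integral_le hf fun χ hχ hχc => ?_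
    have hlim := (tendsto_integral_mul_gauss hχ hχc hf hfm).enorm
    have hle : ‖gaussMass * ∫ x, χ x * w x j‖ₑ
        ≤ 2 * (K * eLpNorm χ threeHalves volume * duhamelBound U V t) := by
      refine le_of_tendsto_of_frequently hlim (frequently_invSqrt_sub_rat t fun q hq => ?_)
      have e : ∫ x₀, χ x₀ * ((Real.sqrt (q - t))⁻¹ ^ 3
          * ∫ y, Real.exp (-(‖(Real.sqrt (q - t))⁻¹ • (y - x₀)‖ ^ 2 / 4)) * w y j)
          = ∫ x₀, χ x₀ * (2 * ∫ s, (Ioc 0 t).indicator (quadDiff U V j q x₀) s) := by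
        refine integral_congr_ae ?_
        filter_upwards [ht q hq j] with x₀ hx
        rw [← hx, linPair_oseen_of_mem_J3 hw]
        ring
      rw [e]
      refine (enorm_integral_le_lintegral_enorm _).trans ?_
      calc ∫⁻ x₀, ‖χ x₀ * (2 * ∫ s, (Ioc 0 t).indicator (quadDiff U V j q x₀) s)‖ₑ
          ≤ ∫⁻ x₀, 2 * (‖χ x₀‖ₑ * ∫⁻ s in Ioo 0 t, ‖quadDiff U V j q x₀ s‖ₑ) := by
            refine lintegral_mono fun x₀ => ?_
            have e2 : ‖(2 : ℝ)‖ₑ = 2 := by simp [enorm, nnnorm]; rfl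
            rw [enorm_mul, enorm_mul, e2, mul_left_comm]
            gcongr
            rw [integral_indicator measurableSet_Ioc, integral_Ioc_eq_integral_Ioo]
            exact enorm_integral_le_lintegral_enorm _
        _ = 2 * ∫⁻ x₀, ‖χ x₀‖ₑ * ∫⁻ s in Ioo 0 t, ‖quadDiff U V j q x₀ s‖ₑ :=
            lintegral_const_mul' _ _ (by norm_num)
        _ ≤ _ := by
            gcongr
            exact lintegral_lintegral_quadDiff_le hUm hVm hχ hχc hq
              fun s hs => hK U V j χ q s hχ hs
    have hκ : ‖gaussMass‖ₑ = (gaussMass.toNNReal : ℝ≥0∞) :=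
      Real.enorm_of_nonneg gaussMass_pos.le
    have hκ0 : gaussMass.toNNReal ≠ 0 := (Real.toNNReal_pos.2 gaussMass_pos).ne'
    rw [enorm_mul, hκ] at hle
    calc ‖∫ x, χ x * w x j‖ₑ
        = (gaussMass.toNNReal⁻¹ : ℝ≥0) * (gaussMass.toNNReal * ‖∫ x, χ x * w x j‖ₑ) := by
          rw [← mul_assoc, ← ENNReal.coe_mul, inv_mul_cancel₀ hκ0, ENNReal.coe_one, one_mul]
      _ ≤ (gaussMass.toNNReal⁻¹ : ℝ≥0)
          * (2 * (K * eLpNorm χ threeHalves volume * duhamelBound U V t)) := by gcongr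
      _ = _ := by
          push_cast
          ring
  refine (enorm_le_sum_component w).trans ((Finset.sum_le_sum fun j _ => hcomp j).trans_eq ?_)
  simp only [Finset.sum_const, Finset.card_univ, Fintype.card_fin, nsmul_eq_mul]
  push_cast
  ring

/-! ### Gronwall's lemma for the kernel `r^{-1/2}` -/

lemma lintegral_invSqrt_le (r : ℝ) :
    ∫⁻ s in Ioo 0 r, ENNReal.ofReal (Real.sqrt s)⁻¹ ≤ ENNReal.ofReal (2 * Real.sqrt r) := by
  rcases le_or_gt r 0 with hr | hr
  · simp [Ioo_eq_empty (not_lt.2 hr)]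
  have h1 : IntervalIntegrable (fun s : ℝ => s ^ (-(1 / 2) : ℝ)) volume 0 r :=
    intervalIntegral.intervalIntegrable_rpow' (by norm_num)
  rw [intervalIntegrable_iff_integrableOn_Ioo_of_le hr.le] at h1
  have h2 : ∫ s in Ioo 0 r, s ^ (-(1 / 2) : ℝ) = 2 * Real.sqrt r := by
    rw [← integral_Ioc_eq_integral_Ioo, ← intervalIntegral.integral_of_le hr.le,
      integral_rpow (by norm_num), Real.sqrt_eq_rpow]
    norm_num
    ring
  rw [← h2, ofReal_integral_eq_lintegral_ofReal h1]
  · refine setLIntegral_mono' measurableSet_Ioo fun s hs => ?_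
    rw [Real.rpow_neg hs.1.le, Real.sqrt_eq_rpow]
  · filter_upwards [ae_restrict_mem measurableSet_Ioo] with s hs
    exact Real.rpow_nonneg hs.1.le _

lemma lintegral_invSqrt_sub_le (a t : ℝ) :
    ∫⁻ s in Ioo a t, ENNReal.ofReal (Real.sqrt (t - s))⁻¹ ≤ ENNReal.ofReal (2 * Real.sqrt (t - a)) := by
  refine le_trans (le_of_eq ?_) (lintegral_invSqrt_le (t - a))
  rw [← lintegral_indicator measurableSet_Ioo, ← lintegral_indicator measurableSet_Ioo,
    ← lintegral_sub_left_eq_self _ t]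
  refine lintegral_congr fun s => ?_
  have e : t - s ∈ Ioo a t ↔ s ∈ Ioo 0 (t - a) := by
    rw [mem_Ioo, mem_Ioo]
    constructor <;> rintro ⟨h1, h2⟩ <;> constructor <;> linarith
  simp only [indicator, e, sub_sub_cancel]

/-- This is `√t ≤ √s + √(t - s)` divided by the product of the three roots. It splits the doubly
singular kernel into two simply singular ones. -/
lemma invSqrt_mul_invSqrt_le {s t : ℝ} (hs : s ∈ Ioo 0 t) :
    (Real.sqrt (t - s))⁻¹ * (Real.sqrt s)⁻¹
      ≤ (Real.sqrt t)⁻¹ * ((Real.sqrt s)⁻¹ + (Real.sqrt (t - s))⁻¹) := by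
  have h1 : 0 < Real.sqrt s := Real.sqrt_pos.2 hs.1
  have h2 : 0 < Real.sqrt (t - s) := Real.sqrt_pos.2 (by linarith [hs.2])
  have h3 : 0 < Real.sqrt t := Real.sqrt_pos.2 (hs.1.trans hs.2)
  have h4 : Real.sqrt t ≤ Real.sqrt s + Real.sqrt (t - s) := by
    refine Real.sqrt_le_iff.2 ⟨by positivity, ?_⟩
    nlinarith [Real.sq_sqrt hs.1.le, Real.sq_sqrt (sub_nonneg.2 hs.2.le), mul_pos h1 h2]
  rw [← sub_nonneg]
  have e : (Real.sqrt t)⁻¹ * ((Real.sqrt s)⁻¹ + (Real.sqrt (t - s))⁻¹)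
      - (Real.sqrt (t - s))⁻¹ * (Real.sqrt s)⁻¹
      = (Real.sqrt s + Real.sqrt (t - s) - Real.sqrt t)
        / (Real.sqrt t * Real.sqrt s * Real.sqrt (t - s)) := by
    field_simp
    ring
  rw [e]
  have := sub_nonneg.2 h4
  positivity

lemma lintegral_invSqrt_mul_invSqrt_le {t : ℝ} (ht : 0 < t) :
    ∫⁻ s in Ioo 0 t, ENNReal.ofReal (Real.sqrt (t - s))⁻¹ * ENNReal.ofReal (Real.sqrt s)⁻¹
      ≤ 4 := by
  have h0 : 0 < Real.sqrt t := Real.sqrt_pos.2 ht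
  have hm : Measurable fun s => ENNReal.ofReal (Real.sqrt s)⁻¹ := by fun_prop
  calc ∫⁻ s in Ioo 0 t, ENNReal.ofReal (Real.sqrt (t - s))⁻¹ * ENNReal.ofReal (Real.sqrt s)⁻¹
      ≤ ∫⁻ s in Ioo 0 t, ENNReal.ofReal (Real.sqrt t)⁻¹
          * (ENNReal.ofReal (Real.sqrt s)⁻¹ + ENNReal.ofReal (Real.sqrt (t - s))⁻¹) := by
        refine setLIntegral_mono' measurableSet_Ioo fun s hs => ?_
        rw [← ENNReal.ofReal_mul (by positivity), ← ENNReal.ofReal_add (by positivity)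
          (by positivity), ← ENNReal.ofReal_mul (by positivity)]
        exact ENNReal.ofReal_le_ofReal (invSqrt_mul_invSqrt_le hs)
    _ = ENNReal.ofReal (Real.sqrt t)⁻¹ * ((∫⁻ s in Ioo 0 t, ENNReal.ofReal (Real.sqrt s)⁻¹)
          + ∫⁻ s in Ioo 0 t, ENNReal.ofReal (Real.sqrt (t - s))⁻¹) := by
        rw [lintegral_const_mul' _ _ ENNReal.ofReal_ne_top, lintegral_add_left hm]
    _ ≤ ENNReal.ofReal (Real.sqrt t)⁻¹
          * (ENNReal.ofReal (2 * Real.sqrt t) + ENNReal.ofReal (2 * Real.sqrt (t - 0))) := by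
        gcongr
        · exact lintegral_invSqrt_le t
        · exact lintegral_invSqrt_sub_le 0 t
    _ = 4 := by
        rw [sub_zero, ← ENNReal.ofReal_add (by positivity) (by positivity),
          ← ENNReal.ofReal_mul (by positivity)]
        have : (Real.sqrt t)⁻¹ * (2 * Real.sqrt t + 2 * Real.sqrt t) = 4 := by
          field_simp
          norm_num
        rw [this]
        norm_num

variable {C : ℝ≥0∞} {S y : ℝ → ℝ≥0∞} {T : ℝ}

/-- The essential supremum of `y` is at most half of itself and finite, hence zero. The majorant `g`
need dominate `S` only where `y` does not vanish. -/
lemma ae_eq_zero_of_le_lintegral {b : ℝ} {M : ℝ≥0∞} (hM : M ≠ ⊤) (g : ℝ → ℝ≥0∞)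
    (hy : ∀ᵐ t ∂(volume.restrict (Ioo 0 b)), y t ≤ M)
    (hle : ∀ᵐ t ∂(volume.restrict (Ioo 0 b)),
      y t ≤ C * ∫⁻ s in Ioo 0 t, ENNReal.ofReal (Real.sqrt (t - s))⁻¹ * (S s * y s))
    (hS : ∀ᵐ s ∂(volume.restrict (Ioo 0 b)), S s * y s ≤ g s * y s)
    (hg : ∀ t ∈ Ioo 0 b,
      C * ∫⁻ s in Ioo 0 t, ENNReal.ofReal (Real.sqrt (t - s))⁻¹ * g s ≤ 2⁻¹) :
    ∀ᵐ t ∂(volume.restrict (Ioo 0 b)), y t = 0 := by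
  set A := essSup y (volume.restrict (Ioo 0 b)) with hA
  have hyA : ∀ᵐ t ∂(volume.restrict (Ioo 0 b)), y t ≤ A := ENNReal.ae_le_essSup y
  have hAM : A ≠ ⊤ := ((essSup_le_of_ae_le M hy).trans_lt hM.lt_top).ne
  have h1 : ∀ᵐ t ∂(volume.restrict (Ioo 0 b)), y t ≤ A * 2⁻¹ := by
    filter_upwards [hle, ae_restrict_mem measurableSet_Ioo] with t ht htb
    have hsub : Ioo 0 t ⊆ Ioo 0 b := Ioo_subset_Ioo_right htb.2.le
    refine ht.trans ?_
    calc C * ∫⁻ s in Ioo 0 t, ENNReal.ofReal (Real.sqrt (t - s))⁻¹ * (S s * y s)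
        ≤ C * ∫⁻ s in Ioo 0 t, A * (ENNReal.ofReal (Real.sqrt (t - s))⁻¹ * g s) := by
          gcongr 1
          refine lintegral_mono_ae ?_
          filter_upwards [ae_restrict_of_ae_restrict_of_subset hsub hS,
            ae_restrict_of_ae_restrict_of_subset hsub hyA] with s h2 h3
          calc ENNReal.ofReal (Real.sqrt (t - s))⁻¹ * (S s * y s)
              ≤ ENNReal.ofReal (Real.sqrt (t - s))⁻¹ * (g s * A) :=
                mul_le_mul' le_rfl (h2.trans (mul_le_mul' le_rfl h3))
            _ = _ := by ring
      _ = A * (C * ∫⁻ s in Ioo 0 t, ENNReal.ofReal (Real.sqrt (t - s))⁻¹ * g s) := by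
          rw [lintegral_const_mul' _ _ hAM]
          ring
      _ ≤ A * 2⁻¹ := by
          gcongr
          exact hg t htb
  have h2 : A ≤ A * 2⁻¹ := essSup_le_of_ae_le _ h1
  have h3 : A = 0 := by
    by_contra h0
    have := ENNReal.half_lt_self h0 hAM
    rw [div_eq_mul_inv] at this
    exact absurd h2 (not_le.2 this)
  filter_upwards [hyA] with t ht
  simpa [h3] using ht

/-- Near zero `S s ≤ ε s^{-1/2}`, and the remaining kernel integral is at most 4 on every interval,
so smallness of `ε` alone suffices. -/
lemma exists_pos_ae_eq_zero {M : ℝ≥0∞} (hM : M ≠ ⊤) (hT : 0 < T) (hC : C ≠ ⊤)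
    (hy : ∀ᵐ t ∂(volume.restrict (Ioo 0 T)), y t ≤ M)
    (hle : ∀ᵐ t ∂(volume.restrict (Ioo 0 T)),
      y t ≤ C * ∫⁻ s in Ioo 0 t, ENNReal.ofReal (Real.sqrt (t - s))⁻¹ * (S s * y s))
    (hS : Tendsto (fun t => ENNReal.ofReal (Real.sqrt t) * S t) aeZeroRight (𝓝 0)) :
    ∃ a ∈ Ioc 0 T, ∀ᵐ t ∂(volume.restrict (Ioo 0 a)), y t = 0 := by
  -- Chosen so that `(C + 1) * (4 * ε) = 1 / 2`; adding one to `C` keeps `ε` finite.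
  set ε : ℝ≥0∞ := (8 * (C + 1))⁻¹ with hε
  have hC1 : C + 1 ≠ ⊤ := ENNReal.add_ne_top.2 ⟨hC, by simp⟩
  have hε0 : 0 < ε := ENNReal.inv_pos.2 (ENNReal.mul_ne_top (by simp) hC1)
  have h1 : ∀ᶠ t in aeZeroRight, ENNReal.ofReal (Real.sqrt t) * S t ≤ ε :=
    (hS.eventually (gt_mem_nhds hε0)).mono fun t ht => ht.le
  rw [aeZeroRight, eventually_inf] at h1
  obtain ⟨u, hu, v, hv, h2⟩ := h1
  obtain ⟨d, hd, hdu⟩ := mem_nhdsGT_iff_exists_Ioo_subset.1 hu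
  rw [mem_Ioi] at hd
  refine ⟨min d T, ⟨lt_min hd hT, min_le_right _ _⟩, ?_⟩
  have hsub : Ioo 0 (min d T) ⊆ Ioo 0 T := Ioo_subset_Ioo_right (min_le_right _ _)
  refine ae_eq_zero_of_le_lintegral hM (fun s => ENNReal.ofReal (Real.sqrt s)⁻¹ * ε)
    (ae_restrict_of_ae_restrict_of_subset hsub hy)
    (ae_restrict_of_ae_restrict_of_subset hsub hle) ?_ fun t ht => ?_
  · filter_upwards [ae_restrict_mem measurableSet_Ioo, ae_restrict_of_ae hv] with s hs hsv
    have h3 := h2 s ⟨hdu ⟨hs.1, hs.2.trans_le (min_le_left _ _)⟩, hsv⟩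
    have h4 : 0 < Real.sqrt s := Real.sqrt_pos.2 hs.1
    gcongr
    calc S s = ENNReal.ofReal (Real.sqrt s)⁻¹ * (ENNReal.ofReal (Real.sqrt s) * S s) := by
          rw [← mul_assoc, ← ENNReal.ofReal_mul (by positivity), inv_mul_cancel₀ h4.ne']
          simp
      _ ≤ _ := by gcongr
  · have hεt : ε ≠ ⊤ := ENNReal.inv_ne_top.2 (by simp)
    simp only [← mul_assoc]
    rw [lintegral_mul_const' _ _ hεt]
    calc C * ((∫⁻ s in Ioo 0 t, ENNReal.ofReal (Real.sqrt (t - s))⁻¹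
          * ENNReal.ofReal (Real.sqrt s)⁻¹) * ε) ≤ (C + 1) * (4 * ε) := by
          gcongr
          · exact le_self_add
          · exact lintegral_invSqrt_mul_invSqrt_le ht.1
      _ = 2⁻¹ := by
          have h0 : C + 1 ≠ 0 := by simp
          rw [hε, ENNReal.mul_inv (Or.inl (by simp)) (Or.inl (by simp)),
            show (8 : ℝ≥0∞) = 4 * 2 by norm_num, ENNReal.mul_inv (Or.inl (by simp)) (Or.inl (by simp))]
          calc (C + 1) * (4 * (4⁻¹ * 2⁻¹ * (C + 1)⁻¹))
              = ((C + 1) * (C + 1)⁻¹) * (4 * 4⁻¹) * 2⁻¹ := by ring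
            _ = 2⁻¹ := by
              rw [ENNReal.mul_inv_cancel h0 hC1, ENNReal.mul_inv_cancel (by simp) (by simp)]
              simp

/-- As `y` vanishes up to `a`, only `S` on `(a, b)` matters. There it is bounded, and the kernel has
mass at most `2 √h`. -/
lemma ae_eq_zero_extend {M M' : ℝ≥0∞} (hM : M ≠ ⊤) {a b h : ℝ}
    (hy : ∀ᵐ t ∂(volume.restrict (Ioo 0 b)), y t ≤ M)
    (hle : ∀ᵐ t ∂(volume.restrict (Ioo 0 b)),
      y t ≤ C * ∫⁻ s in Ioo 0 t, ENNReal.ofReal (Real.sqrt (t - s))⁻¹ * (S s * y s))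
    (hM' : M' ≠ ⊤) (hS : ∀ᵐ s ∂(volume.restrict (Ioo a b)), S s ≤ M') (hab : b ≤ a + h)
    (hh : C * (ENNReal.ofReal (2 * Real.sqrt h) * M') ≤ 2⁻¹) (ha0 : 0 ≤ a)
    (ha : ∀ᵐ t ∂(volume.restrict (Ioo 0 a)), y t = 0) :
    ∀ᵐ t ∂(volume.restrict (Ioo 0 b)), y t = 0 := by
  refine ae_eq_zero_of_le_lintegral hM ((Ioi a).indicator fun _ => M') hy hle ?_ fun t ht => ?_
  · rw [ae_restrict_iff' measurableSet_Ioo] at hS ha ⊢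
    filter_upwards [hS, ha, volume.ae_ne a] with s h1 h2 h3 hs
    rcases lt_or_gt_of_ne h3 with h4 | h4
    · simp [h2 ⟨hs.1, h4⟩]
    · rw [indicator_of_mem (mem_Ioi.2 h4)]
      gcongr
      exact h1 ⟨h4, hs.2⟩
  · refine le_trans ?_ hh
    gcongr
    have e : ∀ s, ENNReal.ofReal (Real.sqrt (t - s))⁻¹ * (Ioi a).indicator (fun _ => M') s
        = (Ioi a).indicator (fun s => ENNReal.ofReal (Real.sqrt (t - s))⁻¹ * M') s := fun s => by
      by_cases hs : s ∈ Ioi a <;> simp [hs]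
    simp only [e]
    rw [setLIntegral_indicator measurableSet_Ioi, Ioi_inter_Ioo, sup_of_le_left ha0,
      lintegral_mul_const' _ _ hM']
    gcongr
    refine (lintegral_invSqrt_sub_le a t).trans ?_
    gcongr
    linarith [ht.2]

lemma ae_eq_zero_of_singular_gronwall {M : ℝ≥0∞} (hM : M ≠ ⊤) (hT : 0 < T) (hC : C ≠ ⊤)
    (hy : ∀ᵐ t ∂(volume.restrict (Ioo 0 T)), y t ≤ M)
    (hle : ∀ᵐ t ∂(volume.restrict (Ioo 0 T)),
      y t ≤ C * ∫⁻ s in Ioo 0 t, ENNReal.ofReal (Real.sqrt (t - s))⁻¹ * (S s * y s))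
    (hS : Tendsto (fun t => ENNReal.ofReal (Real.sqrt t) * S t) aeZeroRight (𝓝 0))
    (hSloc : ∀ a b : ℝ, 0 < a → a < b → b < T →
      ∃ M' : ℝ≥0∞, M' ≠ ⊤ ∧ ∀ᵐ t ∂(volume.restrict (Ioo a b)), S t ≤ M') :
    ∀ᵐ t ∂(volume.restrict (Ioo 0 T)), y t = 0 := by
  obtain ⟨a, ha, hya⟩ := exists_pos_ae_eq_zero hM hT hC hy hle hS
  have key : ∀ b, b < T → ∀ᵐ t ∂(volume.restrict (Ioo 0 b)), y t = 0 := fun b hb => by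
    rcases le_or_gt b a with hab | hab
    · exact ae_restrict_of_ae_restrict_of_subset (Ioo_subset_Ioo_right hab) hya
    obtain ⟨M', hM', hSM⟩ := hSloc a b ha.1 hab hb
    obtain ⟨h, hh0, hh⟩ : ∃ h : ℝ, 0 < h ∧ C * (ENNReal.ofReal (2 * Real.sqrt h) * M') ≤ 2⁻¹ := by
      have h1 : Continuous fun h : ℝ => C * (ENNReal.ofReal (2 * Real.sqrt h) * M') := by
        refine ENNReal.continuous_const_mul hC |>.comp
          ((ENNReal.continuous_mul_const hM').comp (ENNReal.continuous_ofReal.comp ?_))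
        fun_prop
      have h2 : ∀ᶠ h in 𝓝[>] (0 : ℝ), C * (ENNReal.ofReal (2 * Real.sqrt h) * M') < 2⁻¹ := by
        refine ((h1.tendsto 0).mono_left nhdsWithin_le_nhds).eventually (gt_mem_nhds ?_)
        simp
      obtain ⟨h, h3, h4⟩ := (h2.and self_mem_nhdsWithin).exists
      exact ⟨h, h4, h3.le⟩
    -- The step `h` depends only on the bound for `S` on `(a, b)`, so it stays fixed and finitely
    -- many steps reach `b`.
    have step : ∀ n : ℕ, ∀ᵐ t ∂(volume.restrict (Ioo 0 (min (a + n * h) b))), y t = 0 := fun n => by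
      induction n with
      | zero => 
        refine ae_restrict_of_ae_restrict_of_subset (Ioo_subset_Ioo_right ?_) hya
        simp
      | succ n ih =>
        have hbT : Ioo 0 (min (a + (n + 1 : ℕ) * h) b) ⊆ Ioo 0 T :=
          Ioo_subset_Ioo_right ((min_le_right _ _).trans hb.le)
        have han : a ≤ min (a + n * h) b := le_min (by linarith [mul_nonneg n.cast_nonneg hh0.le])
          hab.le
        refine ae_eq_zero_extend hM (ae_restrict_of_ae_restrict_of_subset hbT hy)
          (ae_restrict_of_ae_restrict_of_subset hbT hle) hM'
          (ae_restrict_of_ae_restrict_of_subset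
            (Ioo_subset_Ioo han (min_le_right _ _)) hSM) ?_ hh (ha.1.le.trans han) ih
        push_cast
        rw [min_add]
        refine min_le_min ?_ ?_ <;> linarith
    obtain ⟨n, hn⟩ := exists_nat_gt ((b - a) / h)
    have h1 := step n
    rw [div_lt_iff₀ hh0] at hn
    rwa [min_eq_right (by linarith)] at h1
  have h1 : ∀ᵐ t : ℝ, ∀ q : ℚ, (q : ℝ) < T → t ∈ Ioo 0 (q : ℝ) → y t = 0 := by
    simp only [ae_all_iff]
    exact fun q hq => (ae_restrict_iff' measurableSet_Ioo).1 (key q hq)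
  rw [ae_restrict_iff' measurableSet_Ioo]
  filter_upwards [h1] with t ht htT
  obtain ⟨q, hq1, hq2⟩ := exists_rat_btwn htT.2
  exact ht q hq2 ⟨htT.1, hq1⟩

/-! ### Uniqueness -/

/-- All conditions concern almost every time, which permits the passage to strongly measurable
representatives used in the measurability arguments. -/
lemma IsSolution.congr {T : ℝ} {U U' : ℝ → L3} (hU : IsSolution T U)
    (h : U =ᵐ[volume.restrict (Ioo 0 T)] U') : IsSolution T U' where
  memLinftyJ3 :=
    { memLp := (memLp_congr_ae h).1 hU.memLinftyJ3.memLp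
      mem_J3 := by
        filter_upwards [h, hU.memLinftyJ3.mem_J3] with t h1 h2
        rwa [← h1] }
  isLocallyBounded s t hs hst ht := by
    obtain ⟨M, hM⟩ := hU.isLocallyBounded s t hs hst ht
    refine ⟨M, ?_⟩
    filter_upwards [hM, ae_restrict_of_ae_restrict_of_subset (Ioo_subset_Ioo hs.le ht.le) h]
      with τ h1 h2
    rwa [← h2]
  satisfiesWeakNS φ hφ := by
    refine Eq.trans (integral_congr_ae ?_) (hU.satisfiesWeakNS φ hφ)
    filter_upwards [h] with t ht
    rw [ht]

lemma tendsto_aeZeroRight_congr {T : ℝ} (hT : 0 < T) {U U' : ℝ → L3}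
    (h : U =ᵐ[volume.restrict (Ioo 0 T)] U') {X : Type*} [TopologicalSpace X]
    (F : ℝ → L3 → X) {a : X} (hF : Tendsto (fun t => F t (U t)) aeZeroRight (𝓝 a)) :
    Tendsto (fun t => F t (U' t)) aeZeroRight (𝓝 a) := by
  refine hF.congr' ?_
  filter_upwards [eventually_aeZeroRight hT h] with t ht
  rw [ht]

lemma ae_eq_of_stronglyMeasurable {T : ℝ} (hT : 0 < T) {U V : ℝ → L3} {U₀ : L3}
    (hU : IsSolution T U) (hV : IsSolution T V) (hUm : StronglyMeasurable U)
    (hVm : StronglyMeasurable V)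
    (hU_sup : Tendsto (fun t : ℝ => ENNReal.ofReal (t ^ (1 / 2 : ℝ)) * eLpNorm (U t) ∞ volume)
      aeZeroRight (𝓝 0))
    (hV_sup : Tendsto (fun t : ℝ => ENNReal.ofReal (t ^ (1 / 2 : ℝ)) * eLpNorm (V t) ∞ volume)
      aeZeroRight (𝓝 0))
    (hU_init : ∀ ψ : E3 → E3, IsTestField ψ →
      Tendsto (fun t : ℝ => ∫ x, ⟪U t x, ψ x⟫_ℝ) aeZeroRight (𝓝 (∫ x, ⟪U₀ x, ψ x⟫_ℝ)))
    (hV_init : ∀ ψ : E3 → E3, IsTestField ψ →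
      Tendsto (fun t : ℝ => ∫ x, ⟪V t x, ψ x⟫_ℝ) aeZeroRight (𝓝 (∫ x, ⟪U₀ x, ψ x⟫_ℝ))) :
    U =ᵐ[volume.restrict (Ioo 0 T)] V := by
  obtain ⟨C, hC⟩ := exists_enorm_sub_le
  obtain ⟨M₁, hM₁0, hM₁⟩ := hU.memLinftyJ3.exists_norm_le
  obtain ⟨M₂, hM₂0, hM₂⟩ := hV.memLinftyJ3.exists_norm_le
  have hS : Tendsto (fun t => ENNReal.ofReal (Real.sqrt t) * supSum U V t) aeZeroRight (𝓝 0) := by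
    have := hU_sup.add hV_sup
    simpa only [supSum, ← mul_add, ← Real.sqrt_eq_rpow, add_zero] using this
  have h0 := ae_eq_zero_of_singular_gronwall (y := fun t => ‖U t - V t‖ₑ)
    (M := ENNReal.ofReal (M₁ + M₂)) ENNReal.ofReal_ne_top hT ENNReal.coe_ne_top (by
      filter_upwards [hM₁, hM₂] with t h1 h2
      rw [← ofReal_norm]
      exact ENNReal.ofReal_le_ofReal ((norm_sub_le _ _).trans (add_le_add h1 h2)))
    (hC T U V U₀ hU hV hUm hVm hU_init hV_init) hS fun a b ha hab hb => by
      obtain ⟨N₁, hN₁⟩ := hU.isLocallyBounded a b ha hab hb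
      obtain ⟨N₂, hN₂⟩ := hV.isLocallyBounded a b ha hab hb
      refine ⟨N₁ + N₂, ENNReal.add_ne_top.2 ⟨ENNReal.coe_ne_top, ENNReal.coe_ne_top⟩, ?_⟩
      filter_upwards [hN₁, hN₂] with t h1 h2 using add_le_add h1 h2
  filter_upwards [h0] with t ht
  rwa [enorm_eq_zero, sub_eq_zero] at ht

end NSUniqueness

theorem theorem1p2 (T : ℝ) (hT : 0 < T) (U₀ : NSUniqueness.L3) (hU₀ : U₀ ∈ NSUniqueness.J3)
    (U V : ℝ → NSUniqueness.L3)
    (hU : NSUniqueness.IsSolution T U) (hV : NSUniqueness.IsSolution T V)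
    (hU_sup : Tendsto (fun t : ℝ => ENNReal.ofReal (t ^ (1 / 2 : ℝ)) * eLpNorm (U t) ∞ volume)
      NSUniqueness.aeZeroRight (𝓝 0))
    (hV_sup : Tendsto (fun t : ℝ => ENNReal.ofReal (t ^ (1 / 2 : ℝ)) * eLpNorm (V t) ∞ volume)
      NSUniqueness.aeZeroRight (𝓝 0))
    (hU_init : ∀ ψ : NSUniqueness.E3 → NSUniqueness.E3, NSUniqueness.IsTestField ψ →
      Tendsto (fun t : ℝ => ∫ x, ⟪U t x, ψ x⟫_ℝ) NSUniqueness.aeZeroRight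
        (𝓝 (∫ x, ⟪U₀ x, ψ x⟫_ℝ)))
    (hV_init : ∀ ψ : NSUniqueness.E3 → NSUniqueness.E3, NSUniqueness.IsTestField ψ →
      Tendsto (fun t : ℝ => ∫ x, ⟪V t x, ψ x⟫_ℝ) NSUniqueness.aeZeroRight
        (𝓝 (∫ x, ⟪U₀ x, ψ x⟫_ℝ))) :
    U =ᵐ[volume.restrict (Ioo 0 T)] V := by
  have hUmk := hU.memLinftyJ3.memLp.1.ae_eq_mk
  have hVmk := hV.memLinftyJ3.memLp.1.ae_eq_mk
  have h := NSUniqueness.ae_eq_of_stronglyMeasurable hT (hU.congr hUmk) (hV.congr hVmk)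
    hU.memLinftyJ3.memLp.1.stronglyMeasurable_mk hV.memLinftyJ3.memLp.1.stronglyMeasurable_mk
    (NSUniqueness.tendsto_aeZeroRight_congr hT hUmk
      (fun t u => ENNReal.ofReal (t ^ (1 / 2 : ℝ)) * eLpNorm u ∞ volume) hU_sup)
    (NSUniqueness.tendsto_aeZeroRight_congr hT hVmk
      (fun t u => ENNReal.ofReal (t ^ (1 / 2 : ℝ)) * eLpNorm u ∞ volume) hV_sup)
    (fun ψ hψ => NSUniqueness.tendsto_aeZeroRight_congr hT hUmk
      (fun _ u => ∫ x, ⟪u x, ψ x⟫_ℝ) (hU_init ψ hψ))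
    (fun ψ hψ => NSUniqueness.tendsto_aeZeroRight_congr hT hVmk
      (fun _ u => ∫ x, ⟪u x, ψ x⟫_ℝ) (hV_init ψ hψ))
  exact hUmk.trans (h.trans hVmk.symm)
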